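/- **Setting.** For a potential $V:[0,\infty)\to\mathbb R\cup\{+\infty\}$ and a probability measure $\mu$ on $[0,\infty)$ let $$E_V(\mu)=\int V\,d\mu-\iint\log|x-y|\,\mu(dx)\,\mu(dy)$$ if both integrals exist and are finite, and $E_V(\mu)=+\infty$ otherwise. The equilibrium measure $\mu_V$ of $V$ on $[0,\infty)$ is the minimizer of $E_V$ among all probability measures on $[0,\infty)$. For $a<b$ and $\phi$ smooth ($C^\infty$) on $[a,b]$ put $$\mathcal E_{a,b}(\phi)=\int_a^b\!\int_a^b\Big(\frac{\phi(x)-\phi(y)}{x-y}\Big)^2\frac{-2ab+(a+b)(x+y)-2xy}{2\sqrt{(x-a)(b-x)}\sqrt{(y-a)(b-y)}}\,dx\,dy,$$ and let $\mathrm{Var}_{\mathrm{arcsine}_{[a,b]}}$ be the variance under the law $\mathbf 1_{[a,b]}(x)\frac{dx}{\pi\sqrt{(x-a)(b-x)}}$. **Theorem (Poincaré inequality for Marcenko–Pastur type potentials).** 1. Let $Q:[0,\infty)\to\mathbb R$ be convex, let $s>0$, let $V(x)=Q(x)-s\log x$, and suppose that $\lim_{x\to\infty}(V(x)-2\log x)=\infty$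 and that $\operatorname{supp}\mu_V=[a,b]$. (a) For every smooth $\phi$ on $[a,b]$, $$\int x^2\phi'(x)^2\,\mu_V(dx)\ \ge\ \frac{s}{4\pi^2}\,\mathcal E_{a,b}(\phi).$$ (b) If $Q(x)=rx+t$, then equality holds in (a) for $\phi(x)=c_1+c_2/x$ with any $c_1,c_2\in\mathbb R$, and (a) is sharp: if $C\in\mathbb R$ is such that (a) holds for all smooth $\phi$ with $C$ in place of $\frac{s}{4\pi^2}$, then $C\le \frac{s}{4\pi^2}$. (c) For every smooth $\phi$ on $[a,b]$, $$\int x^2\phi'(x)^2\,\mu_V(dx)\ \ge\ \frac s2\,\mathrm{Var}_{\mathrm{arcsine}_{[a,b]}}(\phi),$$ with equality if and only if $\phi$ is constant on $[a,b]$. 2. Let $V(x)=rx$ on $[0,\infty)$ with $r>0$, and let $\operatorname{supp}\mu_V=[a,b]$. (a) There is no constant $C>0$ such that $\int x^2\phi'(x)^2\,\mu_V(dx)\ge C\,\mathcal E_{a,b}(\phi)$ for all smooth $\phi$ on $[a,b]$. (b) For every smooth $\phi$ on $[a,b]$, $$\int x\,\phi'(x)^2\,\mu_V(dx)\ \ge\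 \frac{r}{4\pi^2}\,\mathcal E_{a,b}(\phi),$$ with equality for $\phi(x)=c_1+c_2x$ with any $c_1,c_2\in\mathbb R$. -/

import Mathlib

open MeasureTheory ProbabilityTheory Set Filter
open scoped ContDiff

noncomputable section

/-- Both integrals in the logarithmic energy of `μ` with external field `V` exist and are finite.
The kernel `log |x - y|` equals `-∞` on the diagonal (where `Real.log` returns the default
value `0`), so its integral is finite only if the diagonal is a null set of `μ ⊗ μ`. -/
def HasFiniteLogEnergy (V : ℝ → ℝ) (μ : Measure ℝ) : Prop :=
  Integrable V μ ∧
  (μ.prod μ) (diagonal ℝ) = 0 ∧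
  Integrable (fun p : ℝ × ℝ => Real.log |p.1 - p.2|) (μ.prod μ)

open Classical in
/-- The logarithmic energy `E_V(μ) = ∫ V dμ - ∬ log |x - y| dμ(x) dμ(y)` if both integrals exist
and are finite, and `+∞` otherwise. -/
def logEnergy (V : ℝ → ℝ) (μ : Measure ℝ) : EReal :=
  if HasFiniteLogEnergy V μ then
    (((∫ x, V x ∂μ) - ∫ p : ℝ × ℝ, Real.log |p.1 - p.2| ∂(μ.prod μ) : ℝ) : EReal)
  else ⊤

/-- `μ` is a probability measure on `[0,∞)`, regarded as a measure on `ℝ`. -/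
def IsProbOnHalfLine (μ : Measure ℝ) : Prop :=
  IsProbabilityMeasure μ ∧ μ (Iio 0) = 0

/-- `μ` is an equilibrium measure of `V` on `[0,∞)`: it minimizes `E_V` among all probability
measures on `[0,∞)`. Measures of finite energy have no atoms, so the value of `V` at the single
point `0` (where `- s log x` is `+∞`) plays no role, nor do the values of `V` on `(-∞,0)`. -/
def IsEquilibriumMeasure (V : ℝ → ℝ) (μ : Measure ℝ) : Prop :=
  IsProbOnHalfLine μ ∧ ∀ ν : Measure ℝ, IsProbOnHalfLine ν → logEnergy V μ ≤ logEnergy V ν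

/-- The arcsine law of `[a,b]`. -/
def arcsineLaw (a b : ℝ) : Measure ℝ :=
  (volume.restrict (Icc a b)).withDensity
    (fun x => ENNReal.ofReal (1 / (Real.pi * √((x - a) * (b - x)))))

/-- The double integral
`∫_a^b ∫_a^b ((φ x - φ y)/(x - y))² (-2ab + (a+b)(x+y) - 2xy) / (2 √((x-a)(b-x)) √((y-a)(b-y)))`
with respect to `dx dy`. -/
def arcsineEnergy (a b : ℝ) (φ : ℝ → ℝ) : ℝ :=
  ∫ x in Icc a b, ∫ y in Icc a b,
    ((φ x - φ y) / (x - y)) ^ 2 *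
      ((-2 * a * b + (a + b) * (x + y) - 2 * x * y) /
        (2 * √((x - a) * (b - x)) * √((y - a) * (b - y))))

/-- The weighted Dirichlet form `∫ w(x) φ'(x)² μ(dx)` of a function `φ` on `[a,b]`, for a measure
`μ` with support `[a,b]`. -/
def dirichletForm (a b : ℝ) (w : ℝ → ℝ) (μ : Measure ℝ) (φ : ℝ → ℝ) : ℝ :=
  ∫ x, w x * (derivWithin φ (Icc a b) x) ^ 2 ∂μ

end

/-!
# Poincaré inequalities for equilibrium measures of Marchenko–Pastur type

All integrals are written in the angle `θ` of the parametrization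
`x = (a + b)/2 + (b - a)/2 * cos θ` of `[a, b]` (`arcPoint`), which turns the arcsine law into the
uniform law on `[0, π]`. Put `m = (a + b)/2` and `d = (b - a)/2`.

*The equilibrium measure.* A variational argument yields the Euler–Lagrange conditions, hence
`V - 2 ∫ log |x - y| dμ(y)` is constant almost everywhere on `[a, b]`. Since the logarithmic kernel
is diagonal in the basis `cos nθ`, this determines the moments of `μ` against the Chebyshev
polynomials (`integral_chebyshev_T`). Testing the energy against arcsine laws of other intervals
shows that `[a, b]` minimizes the Mhaskar–Saff functional (`mhaskarSaff_le`), which gives the two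
endpoint conditions `∫ V'(x) dθ = 0` and `d ∫ V'(x) cos θ dθ = 2π`. Together they express
`∫ U_k dμ` through `∫ V'(x) cos((k + 1)θ) dθ` (`integral_chebyshev_U`). In case `V = Q - s log x`,
the term `-s/x` of `V'` contributes the moments of the Marchenko–Pastur type density
`s √((x - a)(b - x)) / (2π √(ab) x)`. The contribution of `Q'` is nonnegative on polynomials
that are nonnegative on `[a, b]`: it is an integral of the antitone function `θ ↦ Q'(x)` against
the derivative of a function which vanishes at `0` and `π` and is nonnegative by positivity of a
logarithmic kernel (`sum_sin_div_nonneg_of_sum_U_nonneg`). So `μ` dominates that density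
(`integral_marchenkoPasturWeight_le`), with equality if `Q` is affine. For `V = r x` the moments
give `a = 0`, `b = 4/r` and the law with density `(1 - cos θ)/π` in `θ`.

*The functional inequality.* If `φ(x) = c + ∑ γ_k cos kθ`, the energy is `π² ∑ k γ_k²`: folded onto
the circle it is a Douglas integral, which Parseval and the Fejér kernel evaluate
(`integral_angularKernel_sum_cos`). The variance is `½ ∑ γ_k²`, and the
Dirichlet integral of the lower bound of `μ` is a Jacobi quadratic form in `k γ_k`. The difference
of the form and `√(M² - δ²) ∑ k γ_k²` is an explicit sum of squares (`sum_quadratic_form_eq`).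
Approximation by polynomials in `C¹` extends the inequality to smooth functions
(`mul_arcsineEnergy_le`). For the variance the constant can be improved
(`exists_mul_variance_le`), so that equality occurs for constants only.

*Extremal functions.* The squares vanish when the `γ_k` form a geometric sequence, as they do for
`1/(x + e)`, whose energy and Dirichlet forms are elementary. This gives the equality cases and the
sharpness, and, for `V = r x` and `e → 0`, the failure of the inequality with weight `x²`.
-/

section
open Real intervalIntegral Polynomial
open scoped Topology ENNReal

/-! ### Trigonometric integrals -/

lemma integral_cos_int_mul (k : ℤ) :
    ∫ θ in (0 : ℝ)..π, cos (k * θ) = if k = 0 then π else 0 := by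
  split_ifs with h
  · simp [h]
  · have hk : (k : ℝ) ≠ 0 := by exact_mod_cast h
    rw [intervalIntegral.integral_comp_mul_left (fun x => cos x) hk]
    simp [Real.sin_int_mul_pi]

lemma integral_cos_mul_cos (n m : ℤ) :
    ∫ θ in (0 : ℝ)..π, cos (n * θ) * cos (m * θ) =
      ((if n = m then π else 0) + (if n = -m then π else 0)) / 2 := by
  have h : ∀ θ : ℝ, cos (n * θ) * cos (m * θ) =
      (cos (((n - m : ℤ) : ℝ) * θ) + cos (((n + m : ℤ) : ℝ) * θ)) / 2 := by
    intro θ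
    push_cast
    rw [sub_mul, add_mul, cos_sub, cos_add]; ring
  simp_rw [h]
  rw [intervalIntegral.integral_div, intervalIntegral.integral_add
    (Continuous.intervalIntegrable (by fun_prop) _ _)
    (Continuous.intervalIntegrable (by fun_prop) _ _), integral_cos_int_mul, integral_cos_int_mul]
  simp only [sub_eq_zero, add_eq_zero_iff_eq_neg]

lemma integral_sin_mul_sin (n m : ℤ) :
    ∫ θ in (0 : ℝ)..π, sin (n * θ) * sin (m * θ) =
      ((if n = m then π else 0) - (if n = -m then π else 0)) / 2 := by
  have h : ∀ θ : ℝ, sin (n * θ) * sin (m * θ) =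
      (cos (((n - m : ℤ) : ℝ) * θ) - cos (((n + m : ℤ) : ℝ) * θ)) / 2 := by
    intro θ
    push_cast
    rw [sub_mul, add_mul, cos_sub, cos_add]; ring
  simp_rw [h]
  rw [intervalIntegral.integral_div, intervalIntegral.integral_sub
    (Continuous.intervalIntegrable (by fun_prop) _ _)
    (Continuous.intervalIntegrable (by fun_prop) _ _), integral_cos_int_mul, integral_cos_int_mul]
  simp only [sub_eq_zero, add_eq_zero_iff_eq_neg]

lemma integral_sin_succ_mul_sin_succ (n m : ℕ) :
    ∫ θ in (0 : ℝ)..π, sin ((n + 1 : ℝ) * θ) * sin ((m + 1 : ℝ) * θ) =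
      if n = m then π / 2 else 0 := by
  have := integral_sin_mul_sin (n + 1) (m + 1)
  push_cast at this
  rw [this]
  have h1 : ¬ ((n : ℤ) + 1 = -((m : ℤ) + 1)) := by omega
  have h2 : ((n : ℤ) + 1 = (m : ℤ) + 1) ↔ n = m := by omega
  simp only [h1, h2, if_false]
  split_ifs <;> simp

lemma integral_cos_succ_mul_cos_succ (n m : ℕ) :
    ∫ θ in (0 : ℝ)..π, cos ((n + 1 : ℝ) * θ) * cos ((m + 1 : ℝ) * θ) =
      if n = m then π / 2 else 0 := by
  have := integral_cos_mul_cos (n + 1) (m + 1)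
  push_cast at this
  rw [this]
  have h1 : ¬ ((n : ℤ) + 1 = -((m : ℤ) + 1)) := by omega
  have h2 : ((n : ℤ) + 1 = (m : ℤ) + 1) ↔ n = m := by omega
  simp only [h1, h2, if_false]
  split_ifs <;> simp

lemma integral_cos_mul_sin_succ_mul_sin_succ (n m : ℕ) :
    ∫ θ in (0 : ℝ)..π, cos θ * (sin ((n + 1 : ℝ) * θ) * sin ((m + 1 : ℝ) * θ)) =
      (if m = n + 1 then π / 4 else 0) + (if n = m + 1 then π / 4 else 0) := by
  have h : ∀ θ : ℝ, cos θ * (sin ((n + 1 : ℝ) * θ) * sin ((m + 1 : ℝ) * θ)) =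
      (sin (((n + 2 : ℤ) : ℝ) * θ) * sin (((m + 1 : ℤ) : ℝ) * θ) +
        sin (((n : ℤ) : ℝ) * θ) * sin (((m + 1 : ℤ) : ℝ) * θ)) / 2 := by
    intro θ
    push_cast
    have e1 : ((n : ℝ) + 2) * θ = (n + 1) * θ + θ := by ring
    have e2 : (n : ℝ) * θ = (n + 1) * θ - θ := by ring
    rw [e1, e2, sin_add, sin_sub]; ring
  simp_rw [h]
  rw [intervalIntegral.integral_div, intervalIntegral.integral_add
    (Continuous.intervalIntegrable (by fun_prop) _ _)
    (Continuous.intervalIntegrable (by fun_prop) _ _), integral_sin_mul_sin, integral_sin_mul_sin]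
  have h1 : ((n : ℤ) + 2 = (m : ℤ) + 1) ↔ m = n + 1 := by omega
  have h2 : ¬ ((n : ℤ) + 2 = -((m : ℤ) + 1)) := by omega
  have h3 : ((n : ℤ) = (m : ℤ) + 1) ↔ n = m + 1 := by omega
  have h4 : ¬ ((n : ℤ) = -((m : ℤ) + 1)) := by omega
  simp only [h1, h2, h3, h4, if_false]
  split_ifs <;> ring

lemma abs_sin_nat_mul_le (n : ℕ) (x : ℝ) : |sin (n * x)| ≤ n * |sin x| := by
  induction n with
  | zero => simp
  | succ n ih =>
    push_cast
    rw [add_mul, one_mul, sin_add]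
    calc |sin (n * x) * cos x + cos (n * x) * sin x|
        ≤ |sin (n * x)| * |cos x| + |cos (n * x)| * |sin x| := by
          rw [← abs_mul, ← abs_mul]; exact abs_add_le _ _
      _ ≤ n * |sin x| * 1 + 1 * |sin x| := by
          gcongr
          · exact abs_cos_le_one _
          · exact abs_cos_le_one _
      _ = _ := by ring

/-- The integrand is bounded because `|sin (n x)| ≤ n |sin x|`; its value at the zeros of `sin` is
irrelevant. -/
lemma intervalIntegrable_fejer (n : ℕ) (a b : ℝ) :
    IntervalIntegrable (fun t => sin (n * (t / 2)) ^ 2 / sin (t / 2) ^ 2) volume a b := by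
  rw [intervalIntegrable_iff]
  refine Measure.integrableOn_of_bounded (M := (n : ℝ) ^ 2) (by simp)
    (Measurable.aestronglyMeasurable (by fun_prop)) (Eventually.of_forall fun t => ?_)
  rw [norm_of_nonneg (by positivity), ← sq_abs (sin (n * _)), ← sq_abs (sin (t / 2))]
  refine div_le_of_le_mul₀ (by positivity) (by positivity) ?_
  rw [← mul_pow]
  exact pow_le_pow_left₀ (abs_nonneg _) (abs_sin_nat_mul_le n _) 2

lemma ae_sin_half_ne_zero : ∀ᵐ t : ℝ, sin (t / 2) ≠ 0 := by
  have : {t : ℝ | ¬ sin (t / 2) ≠ 0} ⊆ range (fun k : ℤ => (k : ℝ) * π * 2) := by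
    intro t ht
    simp only [ne_eq, not_not, mem_ofPred_eq, sin_eq_zero_iff] at ht
    obtain ⟨k, hk⟩ := ht
    exact ⟨k, by simp only; linarith⟩
  exact measure_mono_null this ((countable_range _).measure_zero _)

/-- The integral of the Dirichlet kernel. -/
lemma integral_dirichlet_kernel (n : ℕ) :
    IntervalIntegrable (fun t => sin ((2 * n + 1) * (t / 2)) / sin (t / 2)) volume (-π) π ∧
    ∫ t in (-π)..π, sin ((2 * n + 1) * (t / 2)) / sin (t / 2) = 2 * π := by
  induction n with
  | zero =>
    have h : (fun _ : ℝ => (1 : ℝ)) =ᵐ[volume]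
        (fun t => sin ((2 * (0 : ℕ) + 1) * (t / 2)) / sin (t / 2)) := by
      filter_upwards [ae_sin_half_ne_zero] with t ht
      simp [div_self ht]
    refine ⟨(intervalIntegrable_const (c := (1 : ℝ))).congr_ae (ae_restrict_of_ae h), ?_⟩
    rw [← intervalIntegral.integral_congr_ae (h.mono fun t ht _ => ht)]
    simp; ring
  | succ n ih =>
    have hc : Continuous (fun t : ℝ => 2 * cos ((n + 1) * t)) := by fun_prop
    have h : (fun t : ℝ => sin ((2 * n + 1) * (t / 2)) / sin (t / 2) + 2 * cos ((n + 1) * t))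
        =ᵐ[volume] (fun t => sin ((2 * (n + 1 : ℕ) + 1) * (t / 2)) / sin (t / 2)) := by
      filter_upwards [ae_sin_half_ne_zero] with t ht
      rw [div_add' _ _ _ ht]
      congr 1
      push_cast
      have e1 : (2 * (n : ℝ) + 1) * (t / 2) = (n + 1) * t - t / 2 := by ring
      have e2 : (2 * ((n : ℝ) + 1) + 1) * (t / 2) = (n + 1) * t + t / 2 := by ring
      rw [e1, e2, sin_add, sin_sub]; ring
    have hi := ih.1.add (hc.intervalIntegrable (-π) π)
    refine ⟨hi.congr_ae (ae_restrict_of_ae h), ?_⟩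
    rw [← intervalIntegral.integral_congr_ae (h.mono fun t ht _ => ht),
      intervalIntegral.integral_add ih.1 (hc.intervalIntegrable _ _), ih.2,
      intervalIntegral.integral_const_mul,
      intervalIntegral.integral_comp_mul_left (fun x => cos x) (by positivity)]
    have := sin_nat_mul_pi (n + 1)
    push_cast at this
    simp [this]

/-- The integral of the Fejér kernel. -/
lemma integral_fejer_kernel (n : ℕ) :
    ∫ t in (-π)..π, sin (n * (t / 2)) ^ 2 / sin (t / 2) ^ 2 = 2 * π * n := by
  induction n with
  | zero => simp
  | succ n ih =>
    have h : (fun t : ℝ => sin (n * (t / 2)) ^ 2 / sin (t / 2) ^ 2 +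
        sin ((2 * n + 1) * (t / 2)) / sin (t / 2))
        =ᵐ[volume] (fun t => sin ((n + 1 : ℕ) * (t / 2)) ^ 2 / sin (t / 2) ^ 2) := by
      filter_upwards [ae_sin_half_ne_zero] with t ht
      rw [div_add_div _ _ (pow_ne_zero 2 ht) ht,
        div_eq_div_iff (mul_ne_zero (pow_ne_zero 2 ht) ht) (pow_ne_zero 2 ht)]
      push_cast
      have e1 : (2 * (n : ℝ) + 1) * (t / 2) = n * (t / 2) + (n + 1) * (t / 2) := by ring
      have e2 : sin (n * (t / 2)) = sin ((n + 1) * (t / 2) - t / 2) := by ring_nf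
      have e3 : cos (n * (t / 2)) = cos ((n + 1) * (t / 2) - t / 2) := by ring_nf
      rw [e1, sin_add, e2, e3, sin_sub, cos_sub]
      have e4 := sin_sq_add_cos_sq (t / 2)
      generalize sin (t / 2) = s at *
      generalize cos (t / 2) = c at *
      generalize sin ((n + 1) * (t / 2)) = S
      generalize cos ((n + 1) * (t / 2)) = C
      have : c ^ 2 = 1 - s ^ 2 := by linarith
      ring_nf
      rw [this]; ring
    rw [← intervalIntegral.integral_congr_ae (h.mono fun t ht _ => ht),
      intervalIntegral.integral_add (intervalIntegrable_fejer n _ _)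
        (integral_dirichlet_kernel n).1, ih, (integral_dirichlet_kernel n).2]
    push_cast; ring

/-! ### Rational trigonometric integrals -/

lemma add_mul_cos_pos {m d : ℝ} (hd : |d| < m) (θ : ℝ) : 0 < m + d * cos θ := by
  have h1 : |d * cos θ| ≤ |d| := by
    rw [abs_mul]; exact mul_le_of_le_one_right (abs_nonneg _) (abs_cos_le_one _)
  linarith [neg_abs_le (d * cos θ)]

/-- With `D = √(m² - d²)`, the function `θ - 2 arctan (d sin θ / (m + D + d cos θ))` is a smooth
primitive of `D / (m + d cos θ)` on the whole line. -/
lemma integral_inv_add_mul_cos {m d D : ℝ} (hd : |d| < m) (hD : 0 < D) (hDm : D ^ 2 = m ^ 2 - d ^ 2) :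
    ∫ θ in (0 : ℝ)..π, 1 / (m + d * cos θ) = π / D := by
  have hpos : ∀ θ, 0 < m + d * cos θ := add_mul_cos_pos hd
  have hder : ∀ θ : ℝ, HasDerivAt
      (fun θ => (θ - 2 * arctan (d * sin θ / (m + D + d * cos θ))) / D)
      (1 / (m + d * cos θ)) θ := by
    intro θ
    have hp : m + D + d * cos θ ≠ 0 := by linarith [hpos θ]
    have h1 : HasDerivAt (fun θ => d * sin θ / (m + D + d * cos θ))
        ((d * cos θ * (m + D + d * cos θ) - d * sin θ * (d * (-sin θ))) /
          (m + D + d * cos θ) ^ 2) θ :=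
      ((hasDerivAt_sin θ).const_mul d).div
        (((hasDerivAt_cos θ).const_mul d).const_add (m + D)) hp
    have h2 := ((hasDerivAt_id θ).sub ((h1.arctan).const_mul 2)).div_const D
    refine h2.congr_deriv ?_
    have hp0 := (hpos θ).ne'
    have hsc := sin_sq_add_cos_sq θ
    have hq : (m + D + d * cos θ) ^ 2 + (d * sin θ) ^ 2 = 2 * (m + D) * (m + d * cos θ) := by
      linear_combination d ^ 2 * hsc + hDm
    have hmD : m + D ≠ 0 := by
      have := (abs_nonneg d).trans_lt hd; positivity
    have e : 1 + (d * sin θ / (m + D + d * cos θ)) ^ 2 =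
        2 * (m + D) * (m + d * cos θ) / (m + D + d * cos θ) ^ 2 := by
      rw [← hq]; field_simp
    rw [e]
    field_simp
    linear_combination (-d ^ 2) * hsc - hDm
  rw [integral_eq_sub_of_hasDerivAt (fun θ _ => hder θ)
    (Continuous.intervalIntegrable (by
      refine continuous_const.div (by fun_prop) fun θ => (hpos θ).ne') _ _)]
  simp

lemma integral_inv_sq_add_mul_cos {m d D : ℝ} (hd : |d| < m) (hD : 0 < D)
    (hDm : D ^ 2 = m ^ 2 - d ^ 2) :
    (∫ θ in (0 : ℝ)..π, 1 / (m + d * cos θ) ^ 2 = π * m / D ^ 3) ∧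
    (∫ θ in (0 : ℝ)..π, cos θ / (m + d * cos θ) ^ 2 = -(π * d / D ^ 3)) := by
  have hpos : ∀ θ, 0 < m + d * cos θ := add_mul_cos_pos hd
  have hi1 : IntervalIntegrable (fun θ => 1 / (m + d * cos θ) ^ 2) volume 0 π :=
    Continuous.intervalIntegrable (by
      refine continuous_const.div (by fun_prop) fun θ => (pow_pos (hpos θ) 2).ne') _ _
  have hi2 : IntervalIntegrable (fun θ => cos θ / (m + d * cos θ) ^ 2) volume 0 π :=
    Continuous.intervalIntegrable (by
      refine Continuous.div (by fun_prop) (by fun_prop) fun θ => (pow_pos (hpos θ) 2).ne') _ _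
  have h1 : m * (∫ θ in (0 : ℝ)..π, 1 / (m + d * cos θ) ^ 2) +
      d * (∫ θ in (0 : ℝ)..π, cos θ / (m + d * cos θ) ^ 2) = π / D := by
    rw [← integral_inv_add_mul_cos hd hD hDm, ← intervalIntegral.integral_const_mul,
      ← intervalIntegral.integral_const_mul,
      ← intervalIntegral.integral_add (hi1.const_mul _) (hi2.const_mul _)]
    refine intervalIntegral.integral_congr fun θ _ => ?_
    have := (hpos θ).ne'
    field_simp
  have h2 : m * (∫ θ in (0 : ℝ)..π, cos θ / (m + d * cos θ) ^ 2) +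
      d * (∫ θ in (0 : ℝ)..π, 1 / (m + d * cos θ) ^ 2) = 0 := by
    have hder : ∀ θ : ℝ, HasDerivAt (fun θ => sin θ / (m + d * cos θ))
        (m * (cos θ / (m + d * cos θ) ^ 2) + d * (1 / (m + d * cos θ) ^ 2)) θ := by
      intro θ
      have hp := (hpos θ).ne'
      refine ((hasDerivAt_sin θ).div (((hasDerivAt_cos θ).const_mul d).const_add m) hp).congr_deriv ?_
      rw [← mul_div_assoc, ← mul_div_assoc, ← add_div]
      congr 1
      linear_combination d * sin_sq_add_cos_sq θ
    rw [← intervalIntegral.integral_const_mul,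
      ← intervalIntegral.integral_const_mul,
      ← intervalIntegral.integral_add (hi2.const_mul _) (hi1.const_mul _),
      integral_eq_sub_of_hasDerivAt (fun θ _ => hder θ)
      ((hi2.const_mul _).add (hi1.const_mul _))]
    simp
  set A := ∫ θ in (0 : ℝ)..π, 1 / (m + d * cos θ) ^ 2
  set B := ∫ θ in (0 : ℝ)..π, cos θ / (m + d * cos θ) ^ 2
  have hA : D ^ 2 * A = m * (π / D) := by
    rw [hDm]; linear_combination m * h1 - d * h2
  have hB : D ^ 2 * B = -(d * (π / D)) := by
    rw [hDm]; linear_combination m * h2 - d * h1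
  constructor
  · field_simp at hA ⊢; linarith
  · field_simp at hB ⊢; linarith

lemma integral_sin_sq_div_cube {m d D : ℝ} (hd : |d| < m) (hd0 : d ≠ 0) (hD : 0 < D)
    (hDm : D ^ 2 = m ^ 2 - d ^ 2) :
    ∫ θ in (0 : ℝ)..π, sin θ ^ 2 / (m + d * cos θ) ^ 3 = π / (2 * D ^ 3) := by
  have hpos : ∀ θ, 0 < m + d * cos θ := add_mul_cos_pos hd
  have hi1 : IntervalIntegrable (fun θ => sin θ ^ 2 / (m + d * cos θ) ^ 3) volume 0 π :=
    Continuous.intervalIntegrable (by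
      refine Continuous.div (by fun_prop) (by fun_prop) fun θ => (pow_pos (hpos θ) 3).ne') _ _
  have hi2 : IntervalIntegrable (fun θ => cos θ / (m + d * cos θ) ^ 2) volume 0 π :=
    Continuous.intervalIntegrable (by
      refine Continuous.div (by fun_prop) (by fun_prop) fun θ => (pow_pos (hpos θ) 2).ne') _ _
  have hder : ∀ θ : ℝ, HasDerivAt (fun θ => sin θ / (m + d * cos θ) ^ 2)
      (cos θ / (m + d * cos θ) ^ 2 + 2 * d * (sin θ ^ 2 / (m + d * cos θ) ^ 3)) θ := by
    intro θ
    have hp := (hpos θ).ne'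
    refine ((hasDerivAt_sin θ).div ((((hasDerivAt_cos θ).const_mul d).const_add m).pow 2)
      (pow_ne_zero 2 hp)).congr_deriv ?_
    simp only [Nat.cast_ofNat, Nat.add_one_sub_one, pow_one, Pi.pow_apply]
    field_simp
    ring
  have h : (∫ θ in (0 : ℝ)..π, cos θ / (m + d * cos θ) ^ 2) +
      2 * d * (∫ θ in (0 : ℝ)..π, sin θ ^ 2 / (m + d * cos θ) ^ 3) = 0 := by
    rw [← intervalIntegral.integral_const_mul,
      ← intervalIntegral.integral_add hi2 (hi1.const_mul _),
      integral_eq_sub_of_hasDerivAt (fun θ _ => hder θ) (hi2.add (hi1.const_mul _))]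
    simp
  rw [(integral_inv_sq_add_mul_cos hd hD hDm).2] at h
  have h' : 2 * d * (∫ θ in (0 : ℝ)..π, sin θ ^ 2 / (m + d * cos θ) ^ 3) = π * d / D ^ 3 := by
    linarith
  have : (∫ θ in (0 : ℝ)..π, sin θ ^ 2 / (m + d * cos θ) ^ 3) = π * d / D ^ 3 / (2 * d) := by
    rw [← h']; field_simp
  rw [this]; field_simp

/-! ### Chebyshev bases -/

lemma span_range_eq_top_of_X_mul_mem {P : ℕ → ℝ[X]} (h1 : 1 ∈ Submodule.span ℝ (range P))
    (hX : ∀ n, X * P n ∈ Submodule.span ℝ (range P)) (p : ℝ[X]) :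
    p ∈ Submodule.span ℝ (range P) := by
  have hmul : ∀ p ∈ Submodule.span ℝ (range P), X * p ∈ Submodule.span ℝ (range P) := by
    intro p hp
    induction hp using Submodule.span_induction with
    | mem x hx => obtain ⟨n, rfl⟩ := hx; exact hX n
    | zero => simp
    | add x y _ _ hx hy => rw [mul_add]; exact add_mem hx hy
    | smul a x _ hx => rw [mul_smul_comm]; exact Submodule.smul_mem _ _ hx
  induction p using Polynomial.induction_on with
  | C a =>
    have := Submodule.smul_mem _ a h1
    rwa [smul_eq_C_mul, mul_one] at this
  | add p q hp hq => exact add_mem hp hq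
  | monomial n a h =>
    have := hmul _ h
    rwa [show X * (C a * X ^ n) = C a * X ^ (n + 1) by ring] at this

lemma mem_span_chebyshev_T (p : ℝ[X]) :
    p ∈ Submodule.span ℝ (range fun n : ℕ => Chebyshev.T ℝ n) := by
  have hmem : ∀ n : ℕ, Chebyshev.T ℝ n ∈ Submodule.span ℝ (range fun n : ℕ => Chebyshev.T ℝ n) :=
    fun n => Submodule.subset_span ⟨n, rfl⟩
  refine span_range_eq_top_of_X_mul_mem (by simpa using hmem 0) (fun n => ?_) p
  match n with
  | 0 => simpa using hmem 1
  | n + 1 =>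
    have h := Chebyshev.T_add_two ℝ n
    have e : X * Chebyshev.T ℝ ((n + 1 : ℕ) : ℤ) =
        (1 / 2 : ℝ) • (Chebyshev.T ℝ ((n + 2 : ℕ) : ℤ) + Chebyshev.T ℝ (n : ℤ)) := by
      push_cast
      rw [h, smul_eq_C_mul]
      have : C (1 / 2 : ℝ) * 2 = 1 := by
        rw [show (2 : ℝ[X]) = C 2 from rfl, ← C_mul]; norm_num
      linear_combination (-(X * Chebyshev.T ℝ ((n : ℤ) + 1))) * this
    rw [e]
    exact Submodule.smul_mem _ _ (add_mem (hmem _) (hmem _))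

lemma mem_span_chebyshev_U (p : ℝ[X]) :
    p ∈ Submodule.span ℝ (range fun n : ℕ => Chebyshev.U ℝ n) := by
  have hmem : ∀ n : ℕ, Chebyshev.U ℝ n ∈ Submodule.span ℝ (range fun n : ℕ => Chebyshev.U ℝ n) :=
    fun n => Submodule.subset_span ⟨n, rfl⟩
  have half : C (1 / 2 : ℝ) * 2 = 1 := by
    rw [show (2 : ℝ[X]) = C 2 from rfl, ← C_mul]; norm_num
  refine span_range_eq_top_of_X_mul_mem (by simpa using hmem 0) (fun n => ?_) p
  match n with
  | 0 =>
    have e : X * Chebyshev.U ℝ ((0 : ℕ) : ℤ) = (1 / 2 : ℝ) • Chebyshev.U ℝ ((1 : ℕ) : ℤ) := by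
      push_cast
      rw [Chebyshev.U_zero, Chebyshev.U_one, smul_eq_C_mul]
      linear_combination (-X) * half
    rw [e]
    exact Submodule.smul_mem _ _ (hmem _)
  | n + 1 =>
    have h := Chebyshev.U_add_two ℝ n
    have e : X * Chebyshev.U ℝ ((n + 1 : ℕ) : ℤ) =
        (1 / 2 : ℝ) • (Chebyshev.U ℝ ((n + 2 : ℕ) : ℤ) + Chebyshev.U ℝ (n : ℤ)) := by
      push_cast
      rw [h, smul_eq_C_mul]
      linear_combination (-(X * Chebyshev.U ℝ ((n : ℤ) + 1))) * half
    rw [e]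
    exact Submodule.smul_mem _ _ (add_mem (hmem _) (hmem _))

/-! ### Logarithmic kernels -/

/-- The function `log |1 - r e^{it}|²`. -/
noncomputable def diskLog (r t : ℝ) : ℝ := log (1 - 2 * r * cos t + r ^ 2)

lemma one_sub_two_mul_cos_add_sq_pos {r : ℝ} (hr0 : 0 ≤ r) (hr : r < 1) (t : ℝ) :
    0 < 1 - 2 * r * cos t + r ^ 2 := by
  have : 0 < (1 - r) ^ 2 := by have := sub_pos.2 hr; positivity
  nlinarith [mul_le_mul_of_nonneg_left (cos_le_one t) hr0]

lemma continuous_diskLog {r : ℝ} (hr0 : 0 ≤ r) (hr : r < 1) : Continuous (diskLog r) := by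
  unfold diskLog
  exact Continuous.log (by fun_prop) fun t => (one_sub_two_mul_cos_add_sq_pos hr0 hr t).ne'

/-- The term of index `0` vanishes because of the division by zero. -/
lemma hasSum_diskLog {r : ℝ} (hr0 : 0 ≤ r) (hr : r < 1) (t : ℝ) :
    HasSum (fun k : ℕ => -2 * (r ^ k / k) * cos (k * t)) (diskLog r t) := by
  set z : ℂ := r * Complex.exp (t * Complex.I) with hz
  have hnz : ‖z‖ < 1 := by
    rw [hz, norm_mul, Complex.norm_exp_ofReal_mul_I, mul_one, Complex.norm_real, norm_of_nonneg hr0]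
    exact hr
  have h := (Complex.hasSum_re (Complex.hasSum_taylorSeries_neg_log hnz)).mul_left (-2)
  have hre : ∀ k : ℕ, (z ^ k / k).re = r ^ k / k * cos (k * t) := by
    intro k
    have : z ^ k / k = ((r ^ k / k : ℝ) : ℂ) * Complex.exp (((k * t : ℝ) : ℂ) * Complex.I) := by
      rw [hz, mul_pow, ← Complex.exp_nat_mul]
      push_cast
      ring_nf
    rw [this, Complex.re_ofReal_mul, Complex.exp_ofReal_mul_I_re]
  have hlog : -2 * (-Complex.log (1 - z)).re = diskLog r t := by
    rw [Complex.neg_re, Complex.log_re]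
    have hn : ‖1 - z‖ ^ 2 = 1 - 2 * r * cos t + r ^ 2 := by
      rw [Complex.sq_norm, Complex.normSq_apply, hz]
      simp only [Complex.sub_re, Complex.one_re, Complex.re_ofReal_mul, Complex.exp_ofReal_mul_I_re,
        Complex.sub_im, Complex.one_im, Complex.im_ofReal_mul, Complex.exp_ofReal_mul_I_im]
      linear_combination r ^ 2 * sin_sq_add_cos_sq t
    rw [diskLog, ← hn, log_pow]
    push_cast; ring
  rw [hlog] at h
  refine h.congr_fun fun k => ?_
  rw [hre]; ring

lemma hasSum_integral_mul_diskLog {r : ℝ} (hr0 : 0 ≤ r) (hr : r < 1) {w : ℝ → ℝ}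
    (hw : Continuous w) (c : ℝ) :
    HasSum (fun k : ℕ => ∫ t in (0 : ℝ)..π, w t * (-2 * (r ^ k / k) * cos (k * (t + c))))
      (∫ t in (0 : ℝ)..π, w t * diskLog r (t + c)) := by
  refine intervalIntegral.hasSum_integral_of_dominated_convergence
    (fun k t => |w t| * (2 * r ^ k)) (fun k => ?_) (fun k => ?_) ?_ ?_ ?_
  · exact (Continuous.aestronglyMeasurable (by fun_prop))
  · refine Eventually.of_forall fun t _ => ?_
    rw [norm_mul, norm_eq_abs, norm_eq_abs, abs_mul]
    refine mul_le_mul_of_nonneg_left ?_ (abs_nonneg _)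
    rw [abs_mul]
    have h1 : |r ^ k / k| ≤ r ^ k := by
      rw [abs_of_nonneg (by positivity)]
      rcases Nat.eq_zero_or_pos k with rfl | hk
      · simp
      · exact div_le_self (by positivity) (by exact_mod_cast hk)
    calc |(-2 : ℝ)| * |r ^ k / k| * |cos (k * (t + c))| ≤ |(-2 : ℝ)| * r ^ k * 1 := by
          gcongr
          exact abs_cos_le_one _
      _ = 2 * r ^ k := by norm_num
  · exact Eventually.of_forall fun t _ =>
      ((summable_geometric_of_lt_one hr0 hr).mul_left 2).mul_left _
  · simp_rw [tsum_mul_left]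
    exact Continuous.intervalIntegrable (by fun_prop) _ _
  · exact Eventually.of_forall fun t _ => (hasSum_diskLog hr0 hr _).mul_left _

lemma integral_cos_mul_diskLog_add {r : ℝ} (hr0 : 0 ≤ r) (hr : r < 1) (n : ℕ) (θ : ℝ) :
    ∫ η in (0 : ℝ)..π, cos (n * η) * (diskLog r (η + θ) + diskLog r (η + -θ)) =
      -2 * π * (r ^ n / n) * cos (n * θ) := by
  have hc := continuous_diskLog hr0 hr
  have hw : Continuous fun η : ℝ => cos (n * η) := by fun_prop
  have h := (hasSum_integral_mul_diskLog hr0 hr hw θ).add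
    (hasSum_integral_mul_diskLog hr0 hr hw (-θ))
  rw [← intervalIntegral.integral_add (Continuous.intervalIntegrable (by fun_prop) _ _)
    (Continuous.intervalIntegrable (by fun_prop) _ _)] at h
  simp_rw [mul_add]
  refine h.unique ?_
  have hk : ∀ k : ℕ, (∫ t in (0 : ℝ)..π, cos (n * t) * (-2 * (r ^ k / k) * cos (k * (t + θ)))) +
      (∫ t in (0 : ℝ)..π, cos (n * t) * (-2 * (r ^ k / k) * cos (k * (t + -θ)))) =
      -4 * (r ^ k / k) * cos (k * θ) * (((if (n : ℤ) = k then π else 0) +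
        (if (n : ℤ) = -k then π else 0)) / 2) := by
    intro k
    rw [← integral_cos_mul_cos, ← intervalIntegral.integral_const_mul,
      ← intervalIntegral.integral_add (Continuous.intervalIntegrable (by fun_prop) _ _)
      (Continuous.intervalIntegrable (by fun_prop) _ _)]
    refine intervalIntegral.integral_congr fun t _ => ?_
    simp only [mul_add, cos_add, mul_neg, cos_neg, sin_neg]
    push_cast
    ring
  simp_rw [hk]
  convert hasSum_single n ?_ using 1
  · rcases Nat.eq_zero_or_pos n with rfl | hn
    · simp
    · rw [if_pos rfl, if_neg (by omega)]; ring
  · intro k hkn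
    rw [if_neg (by omega)]
    rcases Nat.eq_zero_or_pos k with rfl | hk
    · simp
    · rw [if_neg (by omega)]; ring

lemma integral_sin_mul_diskLog_sub {r : ℝ} (hr0 : 0 ≤ r) (hr : r < 1) (n : ℕ) (η : ℝ) :
    ∫ θ in (0 : ℝ)..π, sin ((n + 1 : ℝ) * θ) * (diskLog r (θ + η) - diskLog r (θ + -η)) =
      2 * π * (r ^ (n + 1) * (sin ((n + 1 : ℝ) * η) / (n + 1))) := by
  have hc := continuous_diskLog hr0 hr
  have hw : Continuous fun θ : ℝ => sin ((n + 1 : ℝ) * θ) := by fun_prop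
  have h := (hasSum_integral_mul_diskLog hr0 hr hw η).sub
    (hasSum_integral_mul_diskLog hr0 hr hw (-η))
  rw [← intervalIntegral.integral_sub (Continuous.intervalIntegrable (by fun_prop) _ _)
    (Continuous.intervalIntegrable (by fun_prop) _ _)] at h
  simp_rw [mul_sub]
  refine h.unique ?_
  have hk : ∀ k : ℕ,
      (∫ t in (0 : ℝ)..π, sin ((n + 1 : ℝ) * t) * (-2 * (r ^ k / k) * cos (k * (t + η)))) -
      (∫ t in (0 : ℝ)..π, sin ((n + 1 : ℝ) * t) * (-2 * (r ^ k / k) * cos (k * (t + -η)))) =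
      4 * (r ^ k / k) * sin (k * η) * (((if (n + 1 : ℤ) = k then π else 0) -
        (if (n + 1 : ℤ) = -k then π else 0)) / 2) := by
    intro k
    rw [← integral_sin_mul_sin, ← intervalIntegral.integral_const_mul,
      ← intervalIntegral.integral_sub (Continuous.intervalIntegrable (by fun_prop) _ _)
      (Continuous.intervalIntegrable (by fun_prop) _ _)]
    refine intervalIntegral.integral_congr fun t _ => ?_
    simp only [mul_add, cos_add, mul_neg, cos_neg, sin_neg]
    push_cast
    ring
  simp_rw [hk]
  convert hasSum_single (n + 1) ?_ using 1
  · rw [if_pos (by push_cast; rfl), if_neg (by omega)]; push_cast; ring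
  · intro k hkn
    rw [if_neg (by omega), if_neg (by omega)]; ring

lemma ae_cos_ne (θ : ℝ) : ∀ᵐ η : ℝ, cos θ - cos η ≠ 0 := by
  have : {η : ℝ | ¬ cos θ - cos η ≠ 0} ⊆ range (fun k : ℤ => 2 * (k : ℝ) * π + θ) ∪
      range (fun k : ℤ => 2 * (k : ℝ) * π - θ) := by
    intro t ht
    simp only [ne_eq, not_not, mem_ofPred_eq, sub_eq_zero, cos_eq_cos_iff] at ht
    obtain ⟨k, hk | hk⟩ := ht
    · exact Or.inl ⟨k, hk.symm⟩
    · exact Or.inr ⟨k, hk.symm⟩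
  exact measure_mono_null this
    (((countable_range _).union (countable_range _)).measure_zero _)

lemma intervalIntegrable_log_cos_sub_cos (θ : ℝ) :
    IntervalIntegrable (fun η => log |cos θ - cos η|) volume 0 π := by
  simp_rw [log_abs]
  exact MeromorphicOn.intervalIntegrable_log
    (AnalyticOnNhd.meromorphicOn fun x _ => by fun_prop)

lemma two_sub_mul_two_sub (η θ : ℝ) :
    (2 - 2 * cos (η + θ)) * (2 - 2 * cos (η + -θ)) = 4 * (cos θ - cos η) ^ 2 := by
  rw [cos_add, cos_add, cos_neg, sin_neg]
  linear_combination (-4 * sin θ ^ 2) * sin_sq_add_cos_sq η +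
    (4 * cos η ^ 2 - 4) * sin_sq_add_cos_sq θ

/-- The factors `|1 - r e^{i(η±θ)}|²` are at least a quarter of their values at `r = 1`, which gives
an integrable bound uniform in `r`. -/
lemma abs_diskLog_add_le {r : ℝ} (hr0 : 0 ≤ r) (hr : r < 1) {η θ : ℝ} (h : cos θ - cos η ≠ 0) :
    |diskLog r (η + θ) + diskLog r (η + -θ)| ≤ log 16 + 2 * |log (|cos θ - cos η|)| := by
  have hp := one_sub_two_mul_cos_add_sq_pos hr0 hr
  have key : ∀ t, (2 - 2 * cos t) ≤ 4 * (1 - 2 * r * cos t + r ^ 2) := by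
    intro t
    nlinarith [neg_one_le_cos t, cos_le_one t, sq_nonneg (1 - r), mul_nonneg hr0
      (by linarith [neg_one_le_cos t] : 0 ≤ 1 + cos t)]
  have key0 : ∀ t, 0 ≤ (2 - 2 * cos t) := fun t => by linarith [cos_le_one t]
  have key2 : ∀ t, 1 - 2 * r * cos t + r ^ 2 ≤ 4 := by
    intro t
    nlinarith [neg_one_le_cos t]
  have hX : 0 < |cos θ - cos η| := abs_pos.2 h
  rw [diskLog, diskLog, ← log_mul (hp _).ne' (hp _).ne']
  set A := (1 - 2 * r * cos (η + θ) + r ^ 2) * (1 - 2 * r * cos (η + -θ) + r ^ 2) with hA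
  have hA0 : 0 < A := mul_pos (hp _) (hp _)
  have h16 : A ≤ 16 := by
    calc A ≤ 4 * 4 := mul_le_mul (key2 _) (key2 _) (hp _).le (by norm_num)
      _ = 16 := by norm_num
  have hlow : |cos θ - cos η| ^ 2 ≤ 4 * A := by
    have := mul_le_mul (key (η + θ)) (key (η + -θ)) (key0 _) (by have := hp (η + θ); positivity)
    rw [two_sub_mul_two_sub] at this
    rw [sq_abs]; linarith
  have l1 : log A ≤ log 16 := log_le_log hA0 h16
  have l2 : 2 * log |cos θ - cos η| ≤ log 4 + log A := by
    rw [← log_mul (by norm_num) hA0.ne']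
    have := log_le_log (by positivity) hlow
    rwa [log_pow] at this
  have l3 : log 4 ≤ log 16 := log_le_log (by norm_num) (by norm_num)
  have l4 : 0 ≤ log 4 := log_nonneg (by norm_num)
  rw [abs_le]
  have := neg_abs_le (log |cos θ - cos η|)
  have := abs_nonneg (log |cos θ - cos η|)
  constructor <;> linarith

/-- The cosine coefficients of the logarithmic kernel; for `n = 0` the right hand side is `0`. -/
lemma integral_cos_mul_log_cos_sub_cos (n : ℕ) (θ : ℝ) :
    ∫ η in (0 : ℝ)..π, cos (n * η) * (log 4 + 2 * log |cos θ - cos η|) =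
      -2 * π * (1 / n) * cos (n * θ) := by
  have hI := intervalIntegrable_log_cos_sub_cos θ
  have hev : ∀ᶠ r : ℝ in 𝓝[<] 1, 0 ≤ r ∧ r < 1 := by
    filter_upwards [Ioo_mem_nhdsLT (show (0 : ℝ) < 1 by norm_num)] with r hr
    exact ⟨hr.1.le, hr.2⟩
  have h1 : Tendsto (fun r => ∫ η in (0 : ℝ)..π,
      cos (n * η) * (diskLog r (η + θ) + diskLog r (η + -θ))) (𝓝[<] 1)
      (𝓝 (∫ η in (0 : ℝ)..π, cos (n * η) * (log 4 + 2 * log |cos θ - cos η|))) := by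
    refine intervalIntegral.tendsto_integral_filter_of_dominated_convergence
      (fun η => log 16 + 2 * |log (|cos θ - cos η|)|) ?_ ?_ ?_ ?_
    · filter_upwards [hev] with r hr
      have hc := continuous_diskLog hr.1 hr.2
      exact Continuous.aestronglyMeasurable (by fun_prop)
    · filter_upwards [hev] with r hr
      filter_upwards [ae_cos_ne θ] with η hη _
      rw [norm_mul, norm_eq_abs, norm_eq_abs]
      refine (mul_le_of_le_one_left (abs_nonneg _) (abs_cos_le_one _)).trans ?_
      exact abs_diskLog_add_le hr.1 hr.2 hη
    · exact intervalIntegrable_const.add (hI.abs.const_mul 2)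
    · filter_upwards [ae_cos_ne θ] with η hη _
      have hprod : (2 - 2 * cos (η + θ)) * (2 - 2 * cos (η + -θ)) ≠ 0 := by
        rw [two_sub_mul_two_sub]; positivity
      have e : log 4 + 2 * log |cos θ - cos η| =
          log (2 - 2 * cos (η + θ)) + log (2 - 2 * cos (η + -θ)) := by
        rw [← log_mul (left_ne_zero_of_mul hprod) (right_ne_zero_of_mul hprod),
          two_sub_mul_two_sub, log_mul (by norm_num) (pow_ne_zero 2 hη), log_pow, log_abs]
        push_cast; ring
      rw [e]
      have hlim : ∀ t : ℝ, 2 - 2 * cos t ≠ 0 →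
          Tendsto (fun r => diskLog r t) (𝓝[<] 1) (𝓝 (log (2 - 2 * cos t))) := by
        intro t ht
        have hcont : ContinuousAt (fun r : ℝ => diskLog r t) 1 := by
          unfold diskLog
          refine ContinuousAt.log (by fun_prop) ?_
          convert ht using 1; ring
        have := hcont.tendsto.mono_left (nhdsWithin_le_nhds (s := Iio 1))
        convert this using 2
        unfold diskLog; congr 1; ring
      exact ((hlim _ (left_ne_zero_of_mul hprod)).add
        (hlim _ (right_ne_zero_of_mul hprod))).const_mul _
  have h2 : Tendsto (fun r : ℝ => -2 * π * (r ^ n / n) * cos (n * θ)) (𝓝[<] 1)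
      (𝓝 (-2 * π * (1 / n) * cos (n * θ))) := by
    have : Continuous fun r : ℝ => -2 * π * (r ^ n / n) * cos (n * θ) := by fun_prop
    have := (this.tendsto 1).mono_left (nhdsWithin_le_nhds (s := Iio 1))
    simpa using this
  refine tendsto_nhds_unique h1 (h2.congr' ?_)
  filter_upwards [hev] with r hr
  exact (integral_cos_mul_diskLog_add hr.1 hr.2 n θ).symm

/-- The kernel `log |1 - r e^{i(θ+η)}|² - log |1 - r e^{i(θ-η)}|²` is nonnegative on `[0,π]²`, and
its sine coefficients are explicit. -/
lemma sum_sin_div_nonneg_of_sum_U_nonneg (s : Finset ℕ) (h : ℕ → ℝ)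
    (hG : ∀ θ ∈ Icc 0 π, 0 ≤ ∑ k ∈ s, h k * (Chebyshev.U ℝ k).eval (cos θ))
    {η : ℝ} (hη : η ∈ Icc 0 π) :
    0 ≤ ∑ k ∈ s, h k * (sin ((k + 1 : ℝ) * η) / (k + 1)) := by
  have hlim : Tendsto (fun r : ℝ => ∑ k ∈ s, h k * (r ^ (k + 1) * (sin ((k + 1 : ℝ) * η) / (k + 1))))
      (𝓝[<] 1) (𝓝 (∑ k ∈ s, h k * (sin ((k + 1 : ℝ) * η) / (k + 1)))) := by
    have : Continuous fun r : ℝ =>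
        ∑ k ∈ s, h k * (r ^ (k + 1) * (sin ((k + 1 : ℝ) * η) / (k + 1))) := by fun_prop
    have := (this.tendsto 1).mono_left (nhdsWithin_le_nhds (s := Iio 1))
    simpa using this
  refine ge_of_tendsto hlim ?_
  filter_upwards [Ioo_mem_nhdsLT (show (0 : ℝ) < 1 by norm_num)] with r hr
  have hc := continuous_diskLog hr.1.le hr.2
  have hsum : 2 * π * ∑ k ∈ s, h k * (r ^ (k + 1) * (sin ((k + 1 : ℝ) * η) / (k + 1))) =
      ∫ θ in (0 : ℝ)..π, (∑ k ∈ s, h k * (Chebyshev.U ℝ k).eval (cos θ)) *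
        (sin θ * (diskLog r (θ + η) - diskLog r (θ + -η))) := by
    have : ∀ θ : ℝ, (∑ k ∈ s, h k * (Chebyshev.U ℝ k).eval (cos θ)) *
        (sin θ * (diskLog r (θ + η) - diskLog r (θ + -η))) = ∑ k ∈ s, h k *
        (sin ((k + 1 : ℝ) * θ) * (diskLog r (θ + η) - diskLog r (θ + -η))) := by
      intro θ
      rw [Finset.sum_mul]
      refine Finset.sum_congr rfl fun k _ => ?_
      have := Chebyshev.U_real_cos θ k
      push_cast at this
      rw [← this]; ring
    simp_rw [this]
    rw [intervalIntegral.integral_finsetSum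
      (fun k _ => Continuous.intervalIntegrable (by fun_prop) _ _), Finset.mul_sum]
    refine Finset.sum_congr rfl fun k _ => ?_
    rw [intervalIntegral.integral_const_mul, integral_sin_mul_diskLog_sub hr.1.le hr.2]
    ring
  have hpos : 0 ≤ ∫ θ in (0 : ℝ)..π, (∑ k ∈ s, h k * (Chebyshev.U ℝ k).eval (cos θ)) *
        (sin θ * (diskLog r (θ + η) - diskLog r (θ + -η))) := by
    refine intervalIntegral.integral_nonneg pi_pos.le fun θ hθ => ?_
    have hsθ := sin_nonneg_of_nonneg_of_le_pi hθ.1 hθ.2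
    have hsη := sin_nonneg_of_nonneg_of_le_pi hη.1 hη.2
    refine mul_nonneg (hG θ hθ) (mul_nonneg hsθ (sub_nonneg.2 ?_))
    refine log_le_log (one_sub_two_mul_cos_add_sq_pos hr.1.le hr.2 _) ?_
    rw [cos_add, cos_add, cos_neg, sin_neg]
    nlinarith [mul_nonneg hr.1.le (mul_nonneg hsθ hsη)]
  rw [← hsum] at hpos
  exact nonneg_of_mul_nonneg_right hpos (by positivity)

/-! ### A second mean value inequality -/

lemma ae_eq_Ioc_of_initial {L : ℝ} {S : Set ℝ} (hS : S ⊆ Ioc 0 L) (hL : 0 ≤ L)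
    (hinit : ∀ x ∈ S, ∀ y, 0 < y → y ≤ x → y ∈ S) :
    ∃ c ∈ Icc 0 L, S =ᵐ[volume] Ioc 0 c := by
  have hbdd : BddAbove (insert 0 S) := ⟨L, by
    rintro x (rfl | hx)
    · exact hL
    · exact (hS hx).2⟩
  refine ⟨sSup (insert 0 S), ⟨le_csSup hbdd (mem_insert _ _), csSup_le (insert_nonempty _ _) ?_⟩,
    ?_⟩
  · rintro x (rfl | hx)
    · exact hL
    · exact (hS hx).2
  · have h1 : S ⊆ Ioc 0 (sSup (insert 0 S)) := fun x hx =>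
      ⟨(hS hx).1, le_csSup hbdd (mem_insert_of_mem _ hx)⟩
    have h2 : Ioo 0 (sSup (insert 0 S)) ⊆ S := by
      intro y hy
      obtain ⟨x, hx, hxy⟩ := exists_lt_of_lt_csSup (insert_nonempty _ _) hy.2
      rcases hx with rfl | hx
      · exact absurd hy.1 hxy.not_gt
      · exact hinit x hx y hy.1 hxy.le
    exact EventuallyLE.antisymm (LE.le.eventuallyLE h1)
      (Ioo_ae_eq_Ioc.symm.le.trans (LE.le.eventuallyLE h2))

/-- If `f ≥ 0` on `[0,L]` vanishes at both ends, then `∫ q f' ≥ 0` for antitone `q`: write `q` as a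
superposition of indicators of initial segments. -/
lemma integral_antitone_mul_deriv_nonneg {L : ℝ} (hL : 0 ≤ L) {q f f' : ℝ → ℝ}
    (hq : AntitoneOn q (Icc 0 L)) (hf : ∀ x, HasDerivAt f (f' x) x) (hf' : Continuous f')
    (h0 : f 0 = 0) (h1 : f L = 0) (hpos : ∀ x ∈ Icc 0 L, 0 ≤ f x) :
    0 ≤ ∫ x in (0 : ℝ)..L, q x * f' x := by
  have hFTC : ∀ c, ∫ x in (0 : ℝ)..c, f' x = f c := fun c => by
    rw [integral_eq_sub_of_hasDerivAt (fun x _ => hf x) (hf'.intervalIntegrable _ _), h0, sub_zero]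
  have hL' : L ∈ Icc 0 L := ⟨hL, le_rfl⟩
  have h0' : (0 : ℝ) ∈ Icc 0 L := ⟨le_rfl, hL⟩
  set K := q 0 - q L with hK
  have hqi : IntervalIntegrable q volume 0 L :=
    AntitoneOn.intervalIntegrable (by rwa [uIcc_of_le hL])
  have hqm : AEMeasurable q (volume.restrict (Ioc 0 L)) :=
    ((intervalIntegrable_iff_integrableOn_Ioc_of_le hL).1 hqi).aestronglyMeasurable.aemeasurable
  have hqmeas : ∃ q' : ℝ → ℝ, Measurable q' ∧ q =ᵐ[volume.restrict (Ioc 0 L)] q' :=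
    ⟨hqm.mk q, hqm.measurable_mk, hqm.ae_eq_mk⟩
  obtain ⟨q', hq'm, hqq'⟩ := hqmeas
  have hset : MeasurableSet {p : ℝ × ℝ | p.2 < q' p.1 - q L} :=
    measurableSet_lt measurable_snd ((hq'm.comp measurable_fst).sub_const _)
  -- the double integral, with the integration over levels inside
  have e1 : ∫ x in (0 : ℝ)..L, q x * f' x = ∫ x in Ioc 0 L, ∫ t in Ioc 0 K,
      {p : ℝ × ℝ | p.2 < q' p.1 - q L}.indicator (fun p => f' p.1) (x, t) := by
    have hz : ∫ x in (0 : ℝ)..L, q x * f' x = ∫ x in (0 : ℝ)..L, (q x - q L) * f' x := by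
      have : ∫ x in (0 : ℝ)..L, q L * f' x = 0 := by
        rw [intervalIntegral.integral_const_mul, hFTC, h1, mul_zero]
      simp_rw [sub_mul]
      rw [intervalIntegral.integral_sub (hqi.mul_continuousOn hf'.continuousOn)
        (Continuous.intervalIntegrable (by fun_prop) _ _), this, sub_zero]
    rw [hz, integral_of_le hL]
    refine integral_congr_ae ?_
    filter_upwards [hqq', ae_restrict_mem measurableSet_Ioc] with x hx hxm
    have hxm' : x ∈ Icc 0 L := ⟨hxm.1.le, hxm.2⟩
    have hx1 : 0 ≤ q x - q L := sub_nonneg.2 (hq hxm' hL' hxm.2)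
    have hx2 : q x - q L ≤ K := sub_le_sub_right (hq h0' hxm' hxm.1.le) _
    have : ∀ t, {p : ℝ × ℝ | p.2 < q' p.1 - q L}.indicator (fun p => f' p.1) (x, t) =
        (Iio (q x - q L)).indicator (fun _ => f' x) t := by
      intro t
      simp only [indicator, mem_ofPred_eq, mem_Iio, ← hx]
    simp_rw [this]
    rw [setIntegral_indicator measurableSet_Iio]
    have hI : Ioc 0 K ∩ Iio (q x - q L) = Ioo 0 (q x - q L) := by
      ext t; simp only [mem_inter_iff, mem_Ioc, mem_Iio, mem_Ioo]
      constructor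
      · rintro ⟨⟨h1, h2⟩, h3⟩; exact ⟨h1, h3⟩
      · rintro ⟨h1, h2⟩; exact ⟨⟨h1, by linarith⟩, h2⟩
    rw [hI, setIntegral_const]
    simp [hx1]
  rw [e1]
  have hint : Integrable (fun p : ℝ × ℝ =>
      {p : ℝ × ℝ | p.2 < q' p.1 - q L}.indicator (fun p => f' p.1) p)
      ((volume.restrict (Ioc 0 L)).prod (volume.restrict (Ioc 0 K))) := by
    refine Integrable.indicator ?_ hset
    have : IntegrableOn f' (Ioc 0 L) := (hf'.integrableOn_Icc).mono_set Ioc_subset_Icc_self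
    exact this.comp_fst (volume.restrict (Ioc 0 K))
  rw [integral_integral_swap (f := fun x t =>
    {p : ℝ × ℝ | p.2 < q' p.1 - q L}.indicator (fun p => f' p.1) (x, t)) hint]
  refine integral_nonneg fun t => ?_
  have hS : ∀ᵐ x ∂(volume.restrict (Ioc 0 L)),
      {p : ℝ × ℝ | p.2 < q' p.1 - q L}.indicator (fun p => f' p.1) (x, t) =
      {x | x ∈ Ioc 0 L ∧ t < q x - q L}.indicator f' x := by
    filter_upwards [hqq', ae_restrict_mem measurableSet_Ioc] with x hx hxm
    simp only [indicator, mem_ofPred_eq, ← hx, hxm, true_and]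
  obtain ⟨c, hc, hSc⟩ := ae_eq_Ioc_of_initial (L := L)
    (S := {x | x ∈ Ioc 0 L ∧ t < q x - q L}) (fun x hx => hx.1) hL (by
      rintro x ⟨hx, hxt⟩ y hy hyx
      refine ⟨⟨hy, hyx.trans hx.2⟩, hxt.trans_le (sub_le_sub_right ?_ _)⟩
      exact hq ⟨hy.le, hyx.trans hx.2⟩ ⟨hx.1.le, hx.2⟩ hyx)
  simp only [Pi.zero_apply]
  rw [integral_congr_ae hS,
    integral_congr_ae (ae_restrict_of_ae (indicator_ae_eq_of_ae_eq_set hSc)),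
    setIntegral_indicator measurableSet_Ioc,
    inter_eq_right.2 (Ioc_subset_Ioc_right hc.2), ← integral_of_le hc.1, hFTC]
  exact hpos c hc

/-! ### Logarithmic potentials and the arcsine measure -/

/-- The parametrization `θ ↦ (a+b)/2 + (b-a)/2 cos θ` of `[a,b]` by angles. -/
noncomputable def arcPoint (a b θ : ℝ) : ℝ := (a + b) / 2 + (b - a) / 2 * cos θ

lemma continuous_arcPoint (a b : ℝ) : Continuous (arcPoint a b) := by
  unfold arcPoint; fun_prop

lemma arcPoint_mem_Icc {a b : ℝ} (hab : a ≤ b) (θ : ℝ) : arcPoint a b θ ∈ Icc a b := by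
  unfold arcPoint
  constructor <;> nlinarith [neg_one_le_cos θ, cos_le_one θ]

lemma exists_arcPoint_eq {a b x : ℝ} (hab : a < b) (hx : x ∈ Icc a b) :
    ∃ θ ∈ Icc 0 π, arcPoint a b θ = x := by
  have hd : 0 < b - a := sub_pos.2 hab
  refine ⟨arccos ((x - (a + b) / 2) / ((b - a) / 2)), ⟨arccos_nonneg _, arccos_le_pi _⟩, ?_⟩
  unfold arcPoint
  rw [cos_arccos]
  · field_simp; ring
  · rw [le_div_iff₀ (by positivity)]; linarith [hx.1]
  · rw [div_le_iff₀ (by positivity)]; linarith [hx.2]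

/-- The image of Lebesgue measure on `(0,π]` under `arcPoint a b`, that is, `π` times the arcsine law
of `[a,b]`. -/
noncomputable def arcMeasure (a b : ℝ) : Measure ℝ :=
  (volume.restrict (Ioc 0 π)).map (arcPoint a b)

instance isFiniteMeasure_arcMeasure (a b : ℝ) : IsFiniteMeasure (arcMeasure a b) := by
  unfold arcMeasure; infer_instance

lemma arcMeasure_univ (a b : ℝ) : (arcMeasure a b) univ = ENNReal.ofReal π := by
  rw [arcMeasure, Measure.map_apply (continuous_arcPoint a b).measurable MeasurableSet.univ]
  simp

lemma arcMeasure_singleton {a b : ℝ} (hab : a < b) (x : ℝ) : (arcMeasure a b) {x} = 0 := by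
  rw [arcMeasure, Measure.map_apply (continuous_arcPoint a b).measurable (measurableSet_singleton x),
    Measure.restrict_apply' measurableSet_Ioc]
  refine Set.Subsingleton.measure_zero ?_ volume
  rintro θ ⟨h1, h2⟩ η ⟨h3, h4⟩
  simp only [mem_preimage, mem_singleton_iff, arcPoint] at h1 h3
  have hd : (b - a) / 2 ≠ 0 := by linarith [sub_pos.2 hab] |> ne_of_gt
  have : cos θ = cos η := mul_left_cancel₀ hd (by linarith)
  exact injOn_cos ⟨h2.1.le, h2.2⟩ ⟨h4.1.le, h4.2⟩ this

lemma arcMeasure_compl_Icc {a b : ℝ} (hab : a ≤ b) : (arcMeasure a b) (Icc a b)ᶜ = 0 := by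
  rw [arcMeasure, Measure.map_apply (continuous_arcPoint a b).measurable measurableSet_Icc.compl]
  convert measure_empty (μ := volume.restrict (Ioc 0 π))
  ext θ
  simpa using arcPoint_mem_Icc hab θ

lemma integral_log_cos_sub_cos (θ : ℝ) :
    ∫ η in (0 : ℝ)..π, log |cos θ - cos η| = -(π * log 2) := by
  have h := integral_cos_mul_log_cos_sub_cos 0 θ
  simp only [CharP.cast_eq_zero, zero_mul, cos_zero, one_mul, div_zero, mul_zero] at h
  rw [intervalIntegral.integral_add intervalIntegrable_const
    ((intervalIntegrable_log_cos_sub_cos θ).const_mul 2), intervalIntegral.integral_const,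
    intervalIntegral.integral_const_mul, show (4 : ℝ) = 2 ^ 2 by norm_num, log_pow] at h
  simp only [sub_zero, smul_eq_mul] at h
  push_cast at h
  linarith

lemma intervalIntegrable_log_sub_arcPoint (a b x : ℝ) :
    IntervalIntegrable (fun η => log |x - arcPoint a b η|) volume 0 π := by
  simp_rw [log_abs]
  unfold arcPoint
  exact MeromorphicOn.intervalIntegrable_log
    (AnalyticOnNhd.meromorphicOn fun x _ => by fun_prop)

lemma ae_log_arcPoint_sub (a b θ : ℝ) (hab : a < b) : ∀ᵐ η : ℝ,
    log |arcPoint a b θ - arcPoint a b η| = log ((b - a) / 2) + log |cos θ - cos η| := by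
  have hd : 0 < (b - a) / 2 := by linarith
  filter_upwards [ae_cos_ne θ] with η hη
  have e : arcPoint a b θ - arcPoint a b η = (b - a) / 2 * (cos θ - cos η) := by
    unfold arcPoint; ring
  rw [e, abs_mul, abs_of_pos hd, log_mul hd.ne' (abs_ne_zero.2 hη)]

lemma integral_log_arcPoint_sub {a b : ℝ} (hab : a < b) (θ : ℝ) :
    ∫ η in (0 : ℝ)..π, log |arcPoint a b θ - arcPoint a b η| = π * log ((b - a) / 4) := by
  have hd : 0 < (b - a) / 2 := by linarith
  rw [intervalIntegral.integral_congr_ae ((ae_log_arcPoint_sub a b θ hab).mono fun η h _ => h),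
    intervalIntegral.integral_add intervalIntegrable_const (intervalIntegrable_log_cos_sub_cos θ),
    integral_log_cos_sub_cos, intervalIntegral.integral_const,
    show (b - a) / 4 = (b - a) / 2 / 2 by ring, log_div hd.ne' two_ne_zero]
  simp only [sub_zero, smul_eq_mul]; ring

lemma integral_cos_mul_log_arcPoint_sub {a b : ℝ} (hab : a < b) {n : ℕ} (hn : n ≠ 0) (θ : ℝ) :
    ∫ η in (0 : ℝ)..π, cos (n * η) * log |arcPoint a b θ - arcPoint a b η| =
      -(π / n) * cos (n * θ) := by
  have h := integral_cos_mul_log_cos_sub_cos n θ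
  have hc : Continuous fun η : ℝ => cos (n * η) := by fun_prop
  have hcI : ∫ η in (0 : ℝ)..π, cos (n * η) = 0 := by
    have := integral_cos_int_mul n
    push_cast at this
    rw [this, if_neg (by exact_mod_cast hn)]
  have hI := (intervalIntegrable_log_cos_sub_cos θ).continuousOn_mul (g := fun η : ℝ => cos (n * η))
    hc.continuousOn
  have key : ∀ᵐ η : ℝ, cos (n * η) * log |arcPoint a b θ - arcPoint a b η| =
      (1 / 2) * (cos (n * η) * (log 4 + 2 * log |cos θ - cos η|)) +
        (log ((b - a) / 2) - log 4 / 2) * cos (n * η) := by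
    filter_upwards [ae_log_arcPoint_sub a b θ hab] with η hη
    rw [hη]; ring
  have hI2 : IntervalIntegrable (fun η => cos (n * η) * (log 4 + 2 * log |cos θ - cos η|))
      volume 0 π := by
    have := ((hc.intervalIntegrable (μ := volume) 0 π).mul_const (log 4)).add (hI.const_mul 2)
    refine this.congr_ae (Eventually.of_forall fun η => ?_)
    simp only; ring
  rw [intervalIntegral.integral_congr_ae (key.mono fun η h _ => h),
    intervalIntegral.integral_add (hI2.const_mul _) ((hc.intervalIntegrable _ _).const_mul _),
    intervalIntegral.integral_const_mul, intervalIntegral.integral_const_mul, h, hcI]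
  field_simp; ring

/-- The logarithmic potential of the arcsine law is minimal, and constant, on `[a,b]`. -/
lemma le_integral_log_sub_arcPoint {a b : ℝ} (hab : a < b) (x : ℝ) :
    π * log ((b - a) / 4) ≤ ∫ η in (0 : ℝ)..π, log |x - arcPoint a b η| := by
  by_cases hx : x ∈ Icc a b
  · obtain ⟨θ, -, rfl⟩ := exists_arcPoint_eq hab hx
    rw [integral_log_arcPoint_sub hab]
  · have hd : 0 < (b - a) / 2 := by linarith
    have key : ∃ θ, ∀ η, |arcPoint a b θ - arcPoint a b η| ≤ |x - arcPoint a b η| := by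
      rw [mem_Icc, not_and_or, not_le, not_le] at hx
      rcases hx with hx | hx
      · refine ⟨π, fun η => ?_⟩
        have h1 := (arcPoint_mem_Icc hab.le η).1
        have h2 : arcPoint a b π = a := by simp [arcPoint]; ring
        rw [h2, abs_of_nonpos (by linarith), abs_of_nonpos (by linarith)]; linarith
      · refine ⟨0, fun η => ?_⟩
        have h1 := (arcPoint_mem_Icc hab.le η).2
        have h2 : arcPoint a b 0 = b := by simp [arcPoint]; ring
        rw [h2, abs_of_nonneg (by linarith), abs_of_nonneg (by linarith)]; linarith
    obtain ⟨θ, hθ⟩ := key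
    rw [← integral_log_arcPoint_sub hab θ]
    refine intervalIntegral.integral_mono_ae pi_pos.le (intervalIntegrable_log_sub_arcPoint _ _ _)
      (intervalIntegrable_log_sub_arcPoint _ _ _) ?_
    filter_upwards [ae_cos_ne θ] with η hη
    refine log_le_log (abs_pos.2 ?_) (hθ η)
    have : arcPoint a b θ - arcPoint a b η = (b - a) / 2 * (cos θ - cos η) := by
      unfold arcPoint; ring
    rw [this]
    exact mul_ne_zero hd.ne' hη

lemma measurable_log_abs_sub : Measurable fun p : ℝ × ℝ => log |p.1 - p.2| := by fun_prop

lemma abs_log_le_of_le {x C : ℝ} (hx : x ≤ C) (hC : 0 ≤ C) : |x| ≤ 2 * C - x := by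
  rcases abs_cases x with ⟨h, _⟩ | ⟨h, _⟩ <;> linarith

lemma log_abs_sub_le {A B x y : ℝ} (hx : x ∈ Icc A B) (hy : y ∈ Icc A B) :
    log |x - y| ≤ B - A := by
  have h1 : |x - y| ≤ B - A := abs_le.2 ⟨by linarith [hx.1, hy.2], by linarith [hx.2, hy.1]⟩
  exact (log_le_self (abs_nonneg _)).trans h1

/-- The mixed logarithmic energy of the arcsine law and any compactly supported measure is finite,
since the potential of the arcsine law is bounded below. -/
lemma integrable_log_prod_angle {ρ : Measure ℝ} [IsFiniteMeasure ρ] {A B : ℝ}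
    (hρ : ∀ᵐ x ∂ρ, x ∈ Icc A B) {a b : ℝ} (hab : a < b) :
    Integrable (fun p : ℝ × ℝ => log |p.1 - arcPoint a b p.2|)
      (ρ.prod (volume.restrict (Ioc 0 π))) := by
  have hm : Measurable (fun p : ℝ × ℝ => log |p.1 - arcPoint a b p.2|) := by
    have := (continuous_arcPoint a b).measurable
    fun_prop
  rw [integrable_prod_iff hm.aestronglyMeasurable]
  have hi := fun x => (intervalIntegrable_iff_integrableOn_Ioc_of_le pi_pos.le).1
    (intervalIntegrable_log_sub_arcPoint a b x)
  refine ⟨Eventually.of_forall fun x => hi x, ?_⟩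
  set A' := min A a
  set B' := max B b
  have hC : 0 ≤ B' - A' := by
    have h1 : A' ≤ a := min_le_right _ _
    have h2 : b ≤ B' := le_max_right _ _
    linarith
  refine Integrable.mono' (integrable_const (2 * (B' - A') * π - π * log ((b - a) / 4)))
    (hm.norm.stronglyMeasurable.integral_prod_right).aestronglyMeasurable ?_
  filter_upwards [hρ] with x hx
  rw [norm_of_nonneg (integral_nonneg fun _ => norm_nonneg _)]
  have hle : ∫ η in Ioc 0 π, ‖log |x - arcPoint a b η|‖ ≤
      ∫ η in Ioc 0 π, (2 * (B' - A') - log |x - arcPoint a b η|) := by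
    refine integral_mono (hi x).norm ((integrable_const _).sub (hi x)) fun η => ?_
    refine abs_log_le_of_le (log_abs_sub_le ?_ ?_) hC
    · exact ⟨(min_le_left _ _).trans hx.1, hx.2.trans (le_max_left _ _)⟩
    · have := arcPoint_mem_Icc hab.le η
      exact ⟨(min_le_right _ _).trans this.1, this.2.trans (le_max_right _ _)⟩
  refine hle.trans ?_
  rw [integral_sub (integrable_const _) (hi x), setIntegral_const, ← integral_of_le pi_pos.le]
  have := le_integral_log_sub_arcPoint hab x
  simp only [measureReal_def, volume_Ioc, sub_zero, ENNReal.toReal_ofReal pi_pos.le, smul_eq_mul]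
  linarith

lemma integrable_log_prod_arcMeasure {ρ : Measure ℝ} [IsFiniteMeasure ρ] {A B : ℝ}
    (hρ : ∀ᵐ x ∂ρ, x ∈ Icc A B) {a b : ℝ} (hab : a < b) :
    Integrable (fun p : ℝ × ℝ => log |p.1 - p.2|) (ρ.prod (arcMeasure a b)) := by
  have h : ρ.prod (arcMeasure a b) =
      (ρ.prod (volume.restrict (Ioc 0 π))).map (Prod.map id (arcPoint a b)) := by
    rw [← Measure.map_prod_map _ _ measurable_id (continuous_arcPoint a b).measurable,
      Measure.map_id]
    rfl
  rw [h, integrable_map_measure measurable_log_abs_sub.aestronglyMeasurable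
    (measurable_id.prodMap (continuous_arcPoint a b).measurable).aemeasurable]
  exact integrable_log_prod_angle hρ hab

lemma integrable_log_swap {μ ν : Measure ℝ} [SFinite μ] [SFinite ν]
    (h : Integrable (fun p : ℝ × ℝ => log |p.1 - p.2|) (μ.prod ν)) :
    Integrable (fun p : ℝ × ℝ => log |p.1 - p.2|) (ν.prod μ) := by
  refine h.swap.congr (Eventually.of_forall fun p => ?_)
  simp only [Function.comp_apply, Prod.fst_swap, Prod.snd_swap, abs_sub_comm]

lemma integral_log_swap {μ ν : Measure ℝ} [SFinite μ] [SFinite ν] :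
    ∫ p : ℝ × ℝ, log |p.1 - p.2| ∂(μ.prod ν) = ∫ p : ℝ × ℝ, log |p.1 - p.2| ∂(ν.prod μ) := by
  rw [← integral_prod_swap]
  simp only [Prod.fst_swap, Prod.snd_swap, abs_sub_comm]

lemma prod_diagonal_eq_zero {μ ν : Measure ℝ} [SFinite ν] (h : ∀ x, ν {x} = 0) :
    (μ.prod ν) (diagonal ℝ) = 0 := by
  rw [Measure.prod_apply measurableSet_diagonal]
  have : ∀ x : ℝ, Prod.mk x ⁻¹' diagonal ℝ = {x} := by
    intro x; ext y; simp [eq_comm]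
  simp [this, h]

lemma singleton_eq_zero_of_prod_diagonal {μ : Measure ℝ} [SFinite μ]
    (h : (μ.prod μ) (diagonal ℝ) = 0) (x : ℝ) : μ {x} = 0 := by
  have h1 : ({x} : Set ℝ) ×ˢ ({x} : Set ℝ) ⊆ diagonal ℝ := by
    rintro ⟨y, z⟩ ⟨hy, hz⟩
    simp only [mem_singleton_iff] at hy hz
    simp [hy, hz]
  have h2 := measure_mono_null h1 h
  rw [Measure.prod_prod] at h2
  simpa using h2

/-- The logarithmic potential `x ↦ ∫ log |x - y| dμ(y)`. -/
noncomputable def logPotential (μ : Measure ℝ) (x : ℝ) : ℝ := ∫ y, log |x - y| ∂μ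

/-- The constant in the Euler–Lagrange conditions of the weighted energy problem. -/
noncomputable def robinConstant (V : ℝ → ℝ) (μ : Measure ℝ) : ℝ :=
  (∫ x, V x ∂μ) - 2 * ∫ p : ℝ × ℝ, log |p.1 - p.2| ∂(μ.prod μ)

/-! ### The Euler–Lagrange conditions -/

/-- First variation of the energy in the direction of a probability measure: the energies of `μ`
and of `(1 - t)μ + tν` are compared as `t → 0`. -/
lemma robinConstant_le_of_isProbabilityMeasure {V : ℝ → ℝ} {μ ν : Measure ℝ}
    (hμ : IsEquilibriumMeasure V μ) (hfin : HasFiniteLogEnergy V μ) [IsProbabilityMeasure ν]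
    (hν0 : ν (Iio 0) = 0) (hVν : Integrable V ν) (hat : ∀ x, ν {x} = 0)
    (hνν : Integrable (fun p : ℝ × ℝ => log |p.1 - p.2|) (ν.prod ν))
    (hνμ : Integrable (fun p : ℝ × ℝ => log |p.1 - p.2|) (ν.prod μ)) :
    robinConstant V μ ≤ (∫ x, V x ∂ν) - 2 * ∫ p : ℝ × ℝ, log |p.1 - p.2| ∂(ν.prod μ) := by
  have hμp : IsProbabilityMeasure μ := hμ.1.1
  have hμat := singleton_eq_zero_of_prod_diagonal hfin.2.1
  have hμν := integrable_log_swap hνμ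
  have hsw := integral_log_swap (μ := μ) (ν := ν)
  set I11 := ∫ p : ℝ × ℝ, log |p.1 - p.2| ∂(μ.prod μ) with hI11
  set I12 := ∫ p : ℝ × ℝ, log |p.1 - p.2| ∂(ν.prod μ) with hI12
  set I22 := ∫ p : ℝ × ℝ, log |p.1 - p.2| ∂(ν.prod ν) with hI22
  have key : ∀ t ∈ Ioo (0 : ℝ) 1, 0 ≤ ((∫ x, V x ∂ν) - (∫ x, V x ∂μ) + 2 * I11 - 2 * I12) +
      t * (2 * I12 - I11 - I22) := by
    intro t ht
    have h1t : 0 < 1 - t := by linarith [ht.2]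
    set νt : Measure ℝ := ENNReal.ofReal (1 - t) • μ + ENNReal.ofReal t • ν with hνt
    have hprob : IsProbabilityMeasure νt := ⟨by
      simp only [hνt, Measure.coe_add, Measure.coe_smul, Pi.add_apply, Pi.smul_apply, measure_univ,
        smul_eq_mul, mul_one]
      rw [← ENNReal.ofReal_add h1t.le ht.1.le]; simp⟩
    have hhalf : IsProbOnHalfLine νt := ⟨hprob, by
      simp [hνt, hμ.1.2, hν0]⟩
    have hexp : νt.prod νt =
        (ENNReal.ofReal (1 - t) • ENNReal.ofReal (1 - t) • (μ.prod μ) +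
          ENNReal.ofReal (1 - t) • ENNReal.ofReal t • (ν.prod μ)) +
        (ENNReal.ofReal t • ENNReal.ofReal (1 - t) • (μ.prod ν) +
          ENNReal.ofReal t • ENNReal.ofReal t • (ν.prod ν)) := by
      simp only [hνt, Measure.add_prod, Measure.prod_add, Measure.prod_smul_left,
        Measure.prod_smul_right, smul_add]
    have hVμ' : Integrable V (ENNReal.ofReal (1 - t) • μ) := hfin.1.smul_measure ENNReal.ofReal_ne_top
    have hVν' : Integrable V (ENNReal.ofReal t • ν) := hVν.smul_measure ENNReal.ofReal_ne_top
    have i11 : Integrable (fun p : ℝ × ℝ => log |p.1 - p.2|)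
      (ENNReal.ofReal (1 - t) • ENNReal.ofReal (1 - t) • (μ.prod μ)) :=
      (hfin.2.2.smul_measure ENNReal.ofReal_ne_top).smul_measure ENNReal.ofReal_ne_top
    have i12 : Integrable (fun p : ℝ × ℝ => log |p.1 - p.2|)
      (ENNReal.ofReal (1 - t) • ENNReal.ofReal t • (ν.prod μ)) :=
      (hνμ.smul_measure ENNReal.ofReal_ne_top).smul_measure ENNReal.ofReal_ne_top
    have i21 : Integrable (fun p : ℝ × ℝ => log |p.1 - p.2|)
      (ENNReal.ofReal t • ENNReal.ofReal (1 - t) • (μ.prod ν)) :=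
      (hμν.smul_measure ENNReal.ofReal_ne_top).smul_measure ENNReal.ofReal_ne_top
    have i22 : Integrable (fun p : ℝ × ℝ => log |p.1 - p.2|)
      (ENNReal.ofReal t • ENNReal.ofReal t • (ν.prod ν)) :=
      (hνν.smul_measure ENNReal.ofReal_ne_top).smul_measure ENNReal.ofReal_ne_top
    have hfint : HasFiniteLogEnergy V νt := by
      refine ⟨hVμ'.add_measure hVν', ?_, ?_⟩
      · exact prod_diagonal_eq_zero fun x => by simp [hνt, hat x, hμat x]
      · rw [hexp]
        exact (i11.add_measure i12).add_measure (i21.add_measure i22)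
    have hE := hμ.2 νt hhalf
    rw [logEnergy, logEnergy, if_pos hfin, if_pos hfint, EReal.coe_le_coe_iff, hexp,
      integral_add_measure (i11.add_measure i12) (i21.add_measure i22),
      integral_add_measure i11 i12, integral_add_measure i21 i22,
      integral_add_measure hVμ' hVν'] at hE
    simp only [MeasureTheory.integral_smul_measure, ENNReal.toReal_ofReal h1t.le, ENNReal.toReal_ofReal ht.1.le,
      smul_eq_mul, hsw, ← hI11, ← hI12, ← hI22] at hE
    have : 0 ≤ t * (((∫ x, V x ∂ν) - (∫ x, V x ∂μ) + 2 * I11 - 2 * I12) +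
      t * (2 * I12 - I11 - I22)) := by nlinarith
    exact nonneg_of_mul_nonneg_right this ht.1
  have hlim : Tendsto (fun t : ℝ => ((∫ x, V x ∂ν) - (∫ x, V x ∂μ) + 2 * I11 - 2 * I12) +
      t * (2 * I12 - I11 - I22)) (𝓝[>] 0)
      (𝓝 ((∫ x, V x ∂ν) - (∫ x, V x ∂μ) + 2 * I11 - 2 * I12)) := by
    have hc : Continuous fun t : ℝ => ((∫ x, V x ∂ν) - (∫ x, V x ∂μ) + 2 * I11 - 2 * I12) +
      t * (2 * I12 - I11 - I22) := by fun_prop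
    have := (hc.tendsto 0).mono_left (nhdsWithin_le_nhds (s := Ioi 0))
    simpa using this
  have h0 := ge_of_tendsto hlim (by
    filter_upwards [Ioo_mem_nhdsGT (show (0 : ℝ) < 1 by norm_num)] with t ht using key t ht)
  unfold robinConstant
  linarith

/-- First variation of the energy in the direction of a finite measure. -/
lemma robinConstant_mul_le {V : ℝ → ℝ} {μ ν : Measure ℝ}
    (hμ : IsEquilibriumMeasure V μ) (hfin : HasFiniteLogEnergy V μ) [IsFiniteMeasure ν]
    (hν0 : ν (Iio 0) = 0) (hVν : Integrable V ν) (hat : ∀ x, ν {x} = 0)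
    (hνν : Integrable (fun p : ℝ × ℝ => log |p.1 - p.2|) (ν.prod ν))
    (hνμ : Integrable (fun p : ℝ × ℝ => log |p.1 - p.2|) (ν.prod μ)) :
    robinConstant V μ * ν.real univ ≤ (∫ x, V x ∂ν) - 2 * ∫ x, logPotential μ x ∂ν := by
  have hμp : IsProbabilityMeasure μ := hμ.1.1
  rcases eq_or_ne ν 0 with rfl | hne
  · simp
  have hu : ν univ ≠ 0 := by simpa using hne
  have hut : ν univ ≠ ⊤ := measure_ne_top _ _
  have hinv : (ν univ)⁻¹ ≠ ⊤ := ENNReal.inv_ne_top.2 hu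
  have : IsProbabilityMeasure ((ν univ)⁻¹ • ν) := ⟨by
    simp [ENNReal.inv_mul_cancel hu hut]⟩
  have h := robinConstant_le_of_isProbabilityMeasure (ν := (ν univ)⁻¹ • ν) hμ hfin
    (by simp [hν0]) (hVν.smul_measure hinv) (by simp [hat])
    (by
      rw [Measure.prod_smul_left, Measure.prod_smul_right]
      exact (hνν.smul_measure hinv).smul_measure hinv)
    (by
      rw [Measure.prod_smul_left]
      exact hνμ.smul_measure hinv)
  rw [Measure.prod_smul_left, MeasureTheory.integral_smul_measure, MeasureTheory.integral_smul_measure,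
    integral_prod _ hνμ] at h
  have hr : 0 < ν.real univ := ENNReal.toReal_pos hu hut
  simp only [ENNReal.toReal_inv, smul_eq_mul, ← measureReal_def] at h
  unfold logPotential
  have h2 := mul_le_mul_of_nonneg_right h hr.le
  refine h2.trans (le_of_eq ?_)
  field_simp

/-- The Euler–Lagrange inequality holds almost everywhere for each measure `ν` without atoms that
has finite energy, since the first variation applies to every restriction of `ν`. -/
lemma ae_robinConstant_le {V : ℝ → ℝ} {μ ν : Measure ℝ}
    (hμ : IsEquilibriumMeasure V μ) (hfin : HasFiniteLogEnergy V μ) [IsFiniteMeasure ν]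
    (hν0 : ν (Iio 0) = 0) (hVν : Integrable V ν) (hat : ∀ x, ν {x} = 0)
    (hνν : Integrable (fun p : ℝ × ℝ => log |p.1 - p.2|) (ν.prod ν))
    (hνμ : Integrable (fun p : ℝ × ℝ => log |p.1 - p.2|) (ν.prod μ)) :
    ∀ᵐ x ∂ν, robinConstant V μ ≤ V x - 2 * logPotential μ x := by
  have hμp : IsProbabilityMeasure μ := hμ.1.1
  have hU : Integrable (logPotential μ) ν := hνμ.integral_prod_left
  have hi : Integrable (fun x => V x - 2 * logPotential μ x - robinConstant V μ) ν :=
    (hVν.sub (hU.const_mul 2)).sub (integrable_const _)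
  have := ae_nonneg_of_forall_setIntegral_nonneg hi fun s hs _ => by
    have h := robinConstant_mul_le (ν := ν.restrict s) hμ hfin
      (by exact Measure.restrict_le_self.absolutelyContinuous hν0) hVν.integrableOn
      (fun x => Measure.restrict_le_self.absolutelyContinuous (hat x))
      (by rw [Measure.prod_restrict]; exact hνν.integrableOn)
      (by
        have : (ν.restrict s).prod μ = (ν.prod μ).restrict (s ×ˢ univ) := by
          rw [← Measure.prod_restrict, Measure.restrict_univ]
        rw [this]; exact hνμ.integrableOn)
    rw [integral_sub (f := fun x => V x - 2 * logPotential μ x)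
        ((hVν.sub (hU.const_mul 2)).integrableOn) (integrable_const _).integrableOn,
      integral_sub hVν.integrableOn (hU.const_mul 2).integrableOn, MeasureTheory.integral_const_mul,
      MeasureTheory.integral_const, smul_eq_mul]
    linarith
  filter_upwards [this] with x hx
  simp only [Pi.zero_apply] at hx
  linarith

/-- On the equilibrium measure itself the Euler–Lagrange inequality is an equality. -/
lemma ae_eq_robinConstant {V : ℝ → ℝ} {μ : Measure ℝ}
    (hμ : IsEquilibriumMeasure V μ) (hfin : HasFiniteLogEnergy V μ) :
    ∀ᵐ x ∂μ, V x - 2 * logPotential μ x = robinConstant V μ := by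
  have hμp : IsProbabilityMeasure μ := hμ.1.1
  have hU : Integrable (logPotential μ) μ := hfin.2.2.integral_prod_left
  have hle := ae_robinConstant_le hμ hfin hμ.1.2 hfin.1
    (singleton_eq_zero_of_prod_diagonal hfin.2.1) hfin.2.2 hfin.2.2
  have hi : Integrable (fun x => V x - 2 * logPotential μ x - robinConstant V μ) μ :=
    (hfin.1.sub (hU.const_mul 2)).sub (integrable_const _)
  have h0 : ∫ x, (V x - 2 * logPotential μ x - robinConstant V μ) ∂μ = 0 := by
    rw [integral_sub (f := fun x => V x - 2 * logPotential μ x)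
        (hfin.1.sub (hU.const_mul 2)) (integrable_const _),
      integral_sub hfin.1 (hU.const_mul 2), MeasureTheory.integral_const_mul,
      MeasureTheory.integral_const, robinConstant, integral_prod _ hfin.2.2]
    simp [logPotential]
  rw [integral_eq_zero_iff_of_nonneg_ae (hle.mono fun x hx => by
    simp only [Pi.zero_apply]; linarith) hi] at h0
  filter_upwards [h0] with x hx
  simp only [Pi.zero_apply] at hx
  linarith

/-! ### Arcsine laws as test measures -/

/-- The affine map from `[a,b]` onto `[-1,1]`. -/
noncomputable def arcCoord (a b y : ℝ) : ℝ := (y - (a + b) / 2) / ((b - a) / 2)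

lemma arcCoord_arcPoint {a b : ℝ} (hab : a < b) (θ : ℝ) :
    arcCoord a b (arcPoint a b θ) = cos θ := by
  have : b - a ≠ 0 := (sub_pos.2 hab).ne'
  unfold arcCoord arcPoint
  rw [add_sub_cancel_left, mul_div_cancel_left₀]
  positivity

lemma ae_arcMeasure_mem_Ioi {a b : ℝ} (ha : 0 ≤ a) (hab : a < b) :
    ∀ᵐ x ∂(arcMeasure a b), x ∈ Ioi (0 : ℝ) := by
  have h : (arcMeasure a b) ((Icc a b)ᶜ ∪ {0}) = 0 :=
    measure_union_null (arcMeasure_compl_Icc hab.le) (arcMeasure_singleton hab 0)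
  refine measure_mono_null (fun x hx => ?_) h
  by_cases hx0 : x = 0
  · exact Or.inr hx0
  · refine Or.inl fun hx' => hx ?_
    exact lt_of_le_of_ne (ha.trans hx'.1) (Ne.symm hx0)

lemma integrable_arcMeasure_of_continuousOn {V : ℝ → ℝ} (hV : ContinuousOn V (Ioi 0)) {a b : ℝ}
    (ha : 0 ≤ a) (hab : a < b) (hi : IntervalIntegrable (fun θ => V (arcPoint a b θ)) volume 0 π) :
    Integrable V (arcMeasure a b) := by
  have hm : AEStronglyMeasurable V (arcMeasure a b) := by
    rw [← Measure.restrict_eq_self_of_ae_mem (ae_arcMeasure_mem_Ioi ha hab)]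
    exact hV.aestronglyMeasurable measurableSet_Ioi
  rw [arcMeasure] at hm ⊢
  rw [integrable_map_measure hm (continuous_arcPoint a b).aemeasurable]
  exact (intervalIntegrable_iff_integrableOn_Ioc_of_le pi_pos.le).1 hi

lemma intervalIntegrable_comp_arcPoint {V : ℝ → ℝ} (hV : ContinuousOn V (Ioi 0)) {a b : ℝ}
    (ha : 0 < a) (hab : a ≤ b) : IntervalIntegrable (fun θ => V (arcPoint a b θ)) volume 0 π := by
  refine Continuous.intervalIntegrable ?_ _ _
  exact hV.comp_continuous (continuous_arcPoint a b)
    fun θ => ha.trans_le (arcPoint_mem_Icc hab θ).1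

lemma arcMeasure_Iio_zero {a b : ℝ} (ha : 0 ≤ a) (hab : a ≤ b) : (arcMeasure a b) (Iio 0) = 0 :=
  measure_mono_null (t := (Icc a b)ᶜ) (fun _ hx hx' => absurd (ha.trans hx'.1) (not_le.2 hx))
    (arcMeasure_compl_Icc hab)

lemma ae_arcMeasure_mem_Icc {a b : ℝ} (hab : a ≤ b) : ∀ᵐ x ∂(arcMeasure a b), x ∈ Icc a b :=
  arcMeasure_compl_Icc hab

/-- An arcsine law on `[1,2]` has finite energy, hence so has the equilibrium measure. -/
lemma IsEquilibriumMeasure.hasFiniteLogEnergy {V : ℝ → ℝ} {μ : Measure ℝ}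
    (hμ : IsEquilibriumMeasure V μ) (hV : ContinuousOn V (Ioi 0)) : HasFiniteLogEnergy V μ := by
  have h12 : (1 : ℝ) < 2 := by norm_num
  set ν : Measure ℝ := (ENNReal.ofReal π)⁻¹ • arcMeasure 1 2 with hν
  have hpi : ENNReal.ofReal π ≠ 0 := by simp [pi_pos]
  have hinv : (ENNReal.ofReal π)⁻¹ ≠ ⊤ := ENNReal.inv_ne_top.2 hpi
  have hprob : IsProbabilityMeasure ν := ⟨by
    simp [hν, arcMeasure_univ, ENNReal.inv_mul_cancel hpi]⟩
  have hI := integrable_arcMeasure_of_continuousOn hV zero_le_one h12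
    (intervalIntegrable_comp_arcPoint hV one_pos h12.le)
  have hfν : HasFiniteLogEnergy V ν := by
    refine ⟨hI.smul_measure hinv, ?_, ?_⟩
    · exact prod_diagonal_eq_zero fun x => by simp [hν, arcMeasure_singleton h12]
    · rw [hν, Measure.prod_smul_left, Measure.prod_smul_right]
      exact ((integrable_log_prod_arcMeasure (ae_arcMeasure_mem_Icc h12.le) h12).smul_measure
        hinv).smul_measure hinv
  have h := hμ.2 ν ⟨hprob, by simp [hν, arcMeasure_Iio_zero]⟩
  by_contra hcon
  rw [logEnergy, logEnergy, if_neg hcon, if_pos hfν] at h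
  exact absurd h (not_le.2 (EReal.coe_lt_top _))

lemma ae_mem_of_support_eq {μ : Measure ℝ} {a b : ℝ} (hs : μ.support = Icc a b) :
    ∀ᵐ x ∂μ, x ∈ Icc a b := by
  rw [← hs]; exact Measure.support_mem_ae

lemma IsEquilibriumMeasure.nonneg_and_lt {V : ℝ → ℝ} {μ : Measure ℝ}
    (hμ : IsEquilibriumMeasure V μ) (hV : ContinuousOn V (Ioi 0)) {a b : ℝ}
    (hs : μ.support = Icc a b) : 0 ≤ a ∧ a < b := by
  have hμp : IsProbabilityMeasure μ := hμ.1.1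
  have hat := singleton_eq_zero_of_prod_diagonal (hμ.hasFiniteLogEnergy hV).2.1
  have hae := ae_mem_of_support_eq hs
  have hab : a < b := by
    by_contra hab
    have hsub : Icc a b ⊆ {a} := by
      intro x hx
      rw [mem_singleton_iff]
      linarith [hx.1, hx.2, not_lt.1 hab]
    have h1 : ∀ᵐ x ∂μ, x ∈ ({a} : Set ℝ) := hae.mono hsub
    have h2 : μ univ = 0 := by
      rw [← union_compl_self ({a} : Set ℝ)]
      exact measure_union_null (hat a) h1
    simp at h2
  refine ⟨?_, hab⟩
  by_contra ha
  have hmem : a ∈ μ.support := by rw [hs]; exact ⟨le_rfl, hab.le⟩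
  have := (Measure.mem_support_iff_forall a).1 hmem (Iio 0) (Iio_mem_nhds (not_le.1 ha))
  rw [hμ.1.2] at this
  exact lt_irrefl _ this

/-! ### Upper semicontinuity of the potential -/

/-- The truncated potentials are continuous and decrease to the potential as `δ → 0`. -/
lemma continuous_integral_log_max {μ : Measure ℝ} [IsFiniteMeasure μ] {a b : ℝ}
    (hs : ∀ᵐ x ∂μ, x ∈ Icc a b) {δ : ℝ} (hδ : 0 < δ) :
    Continuous fun z => ∫ y, log (max |z - y| δ) ∂μ := by
  have hpos : ∀ z y : ℝ, 0 < max |z - y| δ := fun z y => lt_max_of_lt_right hδ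
  have hlip : ∀ z w y : ℝ, log (max |z - y| δ) ≤ log (max |w - y| δ) + |z - w| / δ := by
    intro z w y
    have h1 : max |z - y| δ ≤ max |w - y| δ + |z - w| := by
      refine max_le ?_ (by linarith [le_max_right |w - y| δ, abs_nonneg (z - w)])
      have := abs_add_le (w - y) (z - w)
      rw [show w - y + (z - w) = z - y by ring] at this
      linarith [le_max_left |w - y| δ]
    have h2 : max |z - y| δ / max |w - y| δ ≤ 1 + |z - w| / δ := by
      rw [div_le_iff₀ (hpos _ _)]
      have : |z - w| ≤ |z - w| / δ * max |w - y| δ := by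
        rw [div_mul_eq_mul_div, le_div_iff₀ hδ]
        exact mul_le_mul_of_nonneg_left (le_max_right _ _) (abs_nonneg _)
      linarith
    have h3 : log (max |z - y| δ) - log (max |w - y| δ) ≤ |z - w| / δ := by
      rw [← log_div (hpos _ _).ne' (hpos _ _).ne']
      have := log_le_sub_one_of_pos (div_pos (hpos z y) (hpos w y))
      linarith
    linarith
  have hm : ∀ z, AEStronglyMeasurable (fun y => log (max |z - y| δ)) μ := fun z =>
    (Measurable.aestronglyMeasurable (by fun_prop))
  have hint : ∀ z, Integrable (fun y => log (max |z - y| δ)) μ := by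
    intro z
    refine Integrable.mono' (integrable_const (|log (max |z - a| δ)| + (b - a) / δ)) (hm z) ?_
    filter_upwards [hs] with y hy
    have e1 := hlip (z - y) (z - a) 0
    have e2 := hlip (z - a) (z - y) 0
    simp only [sub_zero] at e1 e2
    have e3 : |z - y - (z - a)| = y - a := by
      rw [show z - y - (z - a) = -(y - a) by ring, abs_neg, abs_of_nonneg (by linarith [hy.1])]
    have e4 : |z - a - (z - y)| = y - a := by
      rw [show z - a - (z - y) = (y - a) by ring, abs_of_nonneg (by linarith [hy.1])]
    rw [e3] at e1; rw [e4] at e2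
    have e5 : (y - a) / δ ≤ (b - a) / δ := by
      have := hy.2
      gcongr
    rw [norm_eq_abs, abs_le]
    constructor
    · linarith [neg_abs_le (log (max |z - a| δ))]
    · linarith [le_abs_self (log (max |z - a| δ))]
  refine (LipschitzWith.of_le_add_mul (Real.toNNReal (μ.real univ / δ)) fun z w => ?_).continuous
  rw [Real.coe_toNNReal _ (by positivity), dist_eq]
  calc ∫ y, log (max |z - y| δ) ∂μ ≤ ∫ y, (log (max |w - y| δ) + |z - w| / δ) ∂μ :=
        integral_mono (hint z) ((hint w).add (integrable_const _)) fun y => hlip z w y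
    _ = (∫ y, log (max |w - y| δ) ∂μ) + μ.real univ / δ * |z - w| := by
        rw [integral_add (hint w) (integrable_const _), MeasureTheory.integral_const, smul_eq_mul]
        ring

/-- By upper semicontinuity of the potential, the Euler–Lagrange inequality `V - 2U ≤ const` extends
from almost every point to every point of the support where the potential is finite. -/
lemma le_robinConstant_of_mem_support {V : ℝ → ℝ} {μ : Measure ℝ}
    (hμ : IsEquilibriumMeasure V μ) (hV : ContinuousOn V (Ioi 0)) {a b x : ℝ}
    (hs : μ.support = Icc a b) (hx : x ∈ Icc a b) (hx0 : 0 < x)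
    (hxi : Integrable (fun y => log |x - y|) μ) :
    V x - 2 * logPotential μ x ≤ robinConstant V μ := by
  have hμp : IsProbabilityMeasure μ := hμ.1.1
  have hfin := hμ.hasFiniteLogEnergy hV
  have hat := singleton_eq_zero_of_prod_diagonal hfin.2.1
  have hne : ∀ z : ℝ, ∀ᵐ y ∂μ, y ≠ z := fun z => by
    rw [ae_iff]
    simpa using hat z
  by_contra! hcon
  have hlim : Tendsto (fun δ : ℝ => ∫ y, log (max |x - y| δ) ∂μ) (𝓝[>] 0)
      (𝓝 (logPotential μ x)) := by
    refine tendsto_integral_filter_of_dominated_convergence (fun y => |log (|x - y|)|) ?_ ?_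
      hxi.abs ?_
    · exact Eventually.of_forall fun δ => (Measurable.aestronglyMeasurable (by fun_prop))
    · filter_upwards [Ioo_mem_nhdsGT (show (0 : ℝ) < 1 by norm_num)] with δ hδ
      filter_upwards [hne x] with y hy
      have hp : 0 < |x - y| := abs_pos.2 (sub_ne_zero.2 hy.symm)
      rcases le_total δ |x - y| with h | h
      · rw [max_eq_left h, norm_eq_abs]
      · rw [max_eq_right h, norm_eq_abs, abs_of_nonpos (log_nonpos hδ.1.le hδ.2.le),
          abs_of_nonpos (log_nonpos hp.le (h.trans hδ.2.le))]
        exact neg_le_neg (log_le_log hp h)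
    · filter_upwards [hne x] with y hy
      have hp : 0 < |x - y| := abs_pos.2 (sub_ne_zero.2 hy.symm)
      refine tendsto_const_nhds.congr' ?_
      filter_upwards [Ioo_mem_nhdsGT hp] with δ hδ
      rw [max_eq_left hδ.2.le]
  have hev : ∀ᶠ δ in 𝓝[>] (0 : ℝ),
      robinConstant V μ < V x - 2 * ∫ y, log (max |x - y| δ) ∂μ :=
    ((hlim.const_mul 2).const_sub (V x)).eventually (lt_mem_nhds hcon)
  obtain ⟨δ, hδ, hδ0⟩ := (hev.and self_mem_nhdsWithin).exists
  have hδ0 : 0 < δ := hδ0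
  have hcont : ContinuousAt (fun z => V z - 2 * ∫ y, log (max |z - y| δ) ∂μ) x :=
    (hV.continuousAt (Ioi_mem_nhds hx0)).sub
      ((continuous_integral_log_max (ae_mem_of_support_eq hs) hδ0).continuousAt.const_mul 2)
  have hnhds := hcont.eventually (lt_mem_nhds hδ)
  have hpos := (Measure.mem_support_iff_forall x).1 (by rw [hs]; exact hx) _ hnhds
  have hUi : ∀ᵐ z ∂μ, Integrable (fun y => log |z - y|) μ := hfin.2.2.prod_right_ae
  have hall := (ae_eq_robinConstant hμ hfin).and hUi
  obtain ⟨z, hz1, hz2, hz3⟩ : ∃ z, robinConstant V μ < V z - 2 * ∫ y, log (max |z - y| δ) ∂μ ∧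
      V z - 2 * logPotential μ z = robinConstant V μ ∧ Integrable (fun y => log |z - y|) μ := by
    by_contra! hno
    have : ∀ᵐ z ∂μ, ¬ robinConstant V μ < V z - 2 * ∫ y, log (max |z - y| δ) ∂μ := by
      filter_upwards [hall] with z hz h
      exact hno z h hz.1 hz.2
    rw [ae_iff] at this
    simp only [not_not] at this
    exact hpos.ne' this
  have hmaxi : Integrable (fun y => log (max |z - y| δ)) μ := by
    refine Integrable.mono' (hz3.abs.add (integrable_const |log δ|))
      (Measurable.aestronglyMeasurable (by fun_prop)) (Eventually.of_forall fun y => ?_)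
    simp only [Pi.add_apply]
    rcases le_total δ |z - y| with h | h
    · rw [max_eq_left h, norm_eq_abs]; linarith [abs_nonneg (log δ)]
    · rw [max_eq_right h, norm_eq_abs]; linarith [abs_nonneg (log |z - y|)]
  have hle : logPotential μ z ≤ ∫ y, log (max |z - y| δ) ∂μ := by
    refine integral_mono_ae hz3 hmaxi ?_
    filter_upwards [hne z] with y hy
    exact log_le_log (abs_pos.2 (sub_ne_zero.2 hy.symm)) (le_max_left _ _)
  linarith

/-! ### Consequences on the interval -/

lemma ae_integrable_log_arcPoint_sub {μ : Measure ℝ} [IsFiniteMeasure μ] {A B : ℝ}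
    (hs : ∀ᵐ x ∂μ, x ∈ Icc A B) {a b : ℝ} (hab : a < b) :
    ∀ᵐ θ ∂(volume.restrict (Ioc 0 π)), Integrable (fun y => log |arcPoint a b θ - y|) μ := by
  filter_upwards [(integrable_log_prod_angle hs hab).prod_left_ae] with θ hθ
  simpa only [abs_sub_comm] using hθ

lemma integral_mul_logPotential {μ : Measure ℝ} [IsFiniteMeasure μ] {A B : ℝ}
    (hs : ∀ᵐ x ∂μ, x ∈ Icc A B) {a b : ℝ} (hab : a < b) {w : ℝ → ℝ} (hw : Continuous w)
    (hw1 : ∀ θ, |w θ| ≤ 1) :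
    IntervalIntegrable (fun θ => w θ * logPotential μ (arcPoint a b θ)) volume 0 π ∧
    ∫ θ in (0 : ℝ)..π, w θ * logPotential μ (arcPoint a b θ) =
      ∫ y, (∫ θ in (0 : ℝ)..π, w θ * log |y - arcPoint a b θ|) ∂μ := by
  have h1 : Integrable (fun p : ℝ × ℝ => w p.2 * log |p.1 - arcPoint a b p.2|)
      (μ.prod (volume.restrict (Ioc 0 π))) :=
    (integrable_log_prod_angle hs hab).bdd_mul (c := 1)
      (hw.comp continuous_snd).aestronglyMeasurable (Eventually.of_forall fun p => hw1 p.2)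
  have h2 : ∀ θ, w θ * logPotential μ (arcPoint a b θ) =
      ∫ y, w θ * log |y - arcPoint a b θ| ∂μ := by
    intro θ
    rw [MeasureTheory.integral_const_mul, logPotential]
    simp only [abs_sub_comm]
  simp_rw [h2, integral_of_le pi_pos.le]
  refine ⟨?_, ?_⟩
  · rw [intervalIntegrable_iff_integrableOn_Ioc_of_le pi_pos.le]
    exact h1.integral_prod_right
  · exact (integral_integral_swap h1).symm

lemma intervalIntegrable_logPotential {μ : Measure ℝ} [IsFiniteMeasure μ] {A B : ℝ}
    (hs : ∀ᵐ x ∂μ, x ∈ Icc A B) {a b : ℝ} (hab : a < b) :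
    IntervalIntegrable (fun θ => logPotential μ (arcPoint a b θ)) volume 0 π := by
  simpa using (integral_mul_logPotential hs hab (w := fun _ => 1) continuous_const (by simp)).1

section equilibrium
variable {V : ℝ → ℝ} {μ : Measure ℝ} {a b : ℝ}

lemma ae_robinConstant_le_arcPoint (hμ : IsEquilibriumMeasure V μ) (hV : ContinuousOn V (Ioi 0))
    (hs : μ.support = Icc a b) {α β : ℝ} (hα : 0 ≤ α) (hαβ : α < β)
    (hi : IntervalIntegrable (fun θ => V (arcPoint α β θ)) volume 0 π) :
    ∀ᵐ θ ∂(volume.restrict (Ioc 0 π)),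
      robinConstant V μ ≤ V (arcPoint α β θ) - 2 * logPotential μ (arcPoint α β θ) := by
  have hμp : IsProbabilityMeasure μ := hμ.1.1
  have h := ae_robinConstant_le (ν := arcMeasure α β) hμ (hμ.hasFiniteLogEnergy hV)
    (arcMeasure_Iio_zero hα hαβ.le) (integrable_arcMeasure_of_continuousOn hV hα hαβ hi)
    (arcMeasure_singleton hαβ)
    (integrable_log_prod_arcMeasure (ae_arcMeasure_mem_Icc hαβ.le) hαβ)
    (integrable_log_swap (integrable_log_prod_arcMeasure (ae_mem_of_support_eq hs) hαβ))
  exact ae_of_ae_map (continuous_arcPoint α β).aemeasurable h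

/-- The Euler–Lagrange equality on the support, in the angular variable. -/
lemma ae_arcPoint_eq_robinConstant (hμ : IsEquilibriumMeasure V μ) (hV : ContinuousOn V (Ioi 0))
    (hs : μ.support = Icc a b)
    (hi : IntervalIntegrable (fun θ => V (arcPoint a b θ)) volume 0 π) :
    ∀ᵐ θ ∂(volume.restrict (Ioc 0 π)),
      V (arcPoint a b θ) = 2 * logPotential μ (arcPoint a b θ) + robinConstant V μ := by
  have hμp : IsProbabilityMeasure μ := hμ.1.1
  obtain ⟨ha, hab⟩ := hμ.nonneg_and_lt hV hs
  have h0 : ∀ᵐ θ ∂(volume.restrict (Ioc 0 π)), arcPoint a b θ ∈ Ioi (0 : ℝ) :=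
    ae_of_ae_map (continuous_arcPoint a b).aemeasurable (ae_arcMeasure_mem_Ioi ha hab)
  filter_upwards [ae_robinConstant_le_arcPoint hμ hV hs ha hab hi, h0,
    ae_integrable_log_arcPoint_sub (ae_mem_of_support_eq hs) hab] with θ h1 h2 h3
  have := le_robinConstant_of_mem_support hμ hV hs (arcPoint_mem_Icc hab.le θ) h2 h3
  linarith

lemma integral_arcPoint_eq (hμ : IsEquilibriumMeasure V μ) (hV : ContinuousOn V (Ioi 0))
    (hs : μ.support = Icc a b)
    (hi : IntervalIntegrable (fun θ => V (arcPoint a b θ)) volume 0 π) :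
    ∫ θ in (0 : ℝ)..π, V (arcPoint a b θ) =
      2 * π * log ((b - a) / 4) + π * robinConstant V μ := by
  have hμp : IsProbabilityMeasure μ := hμ.1.1
  obtain ⟨ha, hab⟩ := hμ.nonneg_and_lt hV hs
  have hae := ae_mem_of_support_eq hs
  have h1 : ∫ θ in (0 : ℝ)..π, V (arcPoint a b θ) =
      ∫ θ in (0 : ℝ)..π, (2 * logPotential μ (arcPoint a b θ) + robinConstant V μ) := by
    rw [integral_of_le pi_pos.le, integral_of_le pi_pos.le]
    exact integral_congr_ae (ae_arcPoint_eq_robinConstant hμ hV hs hi)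
  have h2 := (integral_mul_logPotential hae hab (w := fun _ => 1) continuous_const (by simp)).2
  simp only [one_mul] at h2
  rw [h1, intervalIntegral.integral_add ((intervalIntegrable_logPotential hae hab).const_mul 2)
    intervalIntegrable_const, intervalIntegral.integral_const_mul, h2]
  have h3 : ∫ y, (∫ θ in (0 : ℝ)..π, log |y - arcPoint a b θ|) ∂μ =
      ∫ y, π * log ((b - a) / 4) ∂μ := by
    refine integral_congr_ae ?_
    filter_upwards [hae] with y hy
    obtain ⟨θ, -, rfl⟩ := exists_arcPoint_eq hab hy
    exact integral_log_arcPoint_sub hab θ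
  rw [h3]
  simp; ring

/-- Integrating the Euler–Lagrange inequality against the arcsine law of an arbitrary interval. -/
lemma le_integral_arcPoint (hμ : IsEquilibriumMeasure V μ) (hV : ContinuousOn V (Ioi 0))
    (hs : μ.support = Icc a b) {α β : ℝ} (hα : 0 ≤ α) (hαβ : α < β)
    (hi : IntervalIntegrable (fun θ => V (arcPoint α β θ)) volume 0 π) :
    2 * π * log ((β - α) / 4) + π * robinConstant V μ ≤
      ∫ θ in (0 : ℝ)..π, V (arcPoint α β θ) := by
  have hμp : IsProbabilityMeasure μ := hμ.1.1
  have hae := ae_mem_of_support_eq hs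
  have hU := intervalIntegrable_logPotential hae hαβ
  have h1 : ∫ θ in (0 : ℝ)..π, (2 * logPotential μ (arcPoint α β θ) + robinConstant V μ) ≤
      ∫ θ in (0 : ℝ)..π, V (arcPoint α β θ) := by
    rw [integral_of_le pi_pos.le, integral_of_le pi_pos.le]
    refine integral_mono_ae ?_ ?_ ?_
    · exact (intervalIntegrable_iff_integrableOn_Ioc_of_le pi_pos.le).1
        ((hU.const_mul 2).add intervalIntegrable_const)
    · exact (intervalIntegrable_iff_integrableOn_Ioc_of_le pi_pos.le).1 hi
    · filter_upwards [ae_robinConstant_le_arcPoint hμ hV hs hα hαβ hi] with θ h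
      linarith
  have h2 := (integral_mul_logPotential hae hαβ (w := fun _ => 1) continuous_const (by simp)).2
  simp only [one_mul] at h2
  rw [intervalIntegral.integral_add (hU.const_mul 2)
    intervalIntegrable_const, intervalIntegral.integral_const_mul, h2] at h1
  have h3 : π * log ((β - α) / 4) ≤ ∫ y, (∫ θ in (0 : ℝ)..π, log |y - arcPoint α β θ|) ∂μ := by
    have hint : Integrable (fun y => ∫ θ in (0 : ℝ)..π, log |y - arcPoint α β θ|) μ := by
      simp_rw [integral_of_le pi_pos.le]
      exact (integrable_log_prod_angle hae hαβ).integral_prod_left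
    calc π * log ((β - α) / 4) = ∫ _, π * log ((β - α) / 4) ∂μ := by simp
      _ ≤ _ := integral_mono (integrable_const _) hint fun y => le_integral_log_sub_arcPoint hαβ y
  simp only [intervalIntegral.integral_const, sub_zero, smul_eq_mul] at h1
  linarith

/-- The endpoints of the support minimize the Mhaskar–Saff functional. -/
lemma mhaskarSaff_le (hμ : IsEquilibriumMeasure V μ) (hV : ContinuousOn V (Ioi 0))
    (hs : μ.support = Icc a b)
    (hi : IntervalIntegrable (fun θ => V (arcPoint a b θ)) volume 0 π)
    {α β : ℝ} (hα : 0 ≤ α) (hαβ : α < β)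
    (hi' : IntervalIntegrable (fun θ => V (arcPoint α β θ)) volume 0 π) :
    (∫ θ in (0 : ℝ)..π, V (arcPoint a b θ)) - 2 * π * log ((b - a) / 4) ≤
      (∫ θ in (0 : ℝ)..π, V (arcPoint α β θ)) - 2 * π * log ((β - α) / 4) := by
  have h1 := integral_arcPoint_eq hμ hV hs hi
  have h2 := le_integral_arcPoint hμ hV hs hα hαβ hi'
  linarith

/-- The Chebyshev moments of the equilibrium measure: the Euler–Lagrange equality is integrated
against `cos nθ`, an eigenfunction of the logarithmic kernel. -/
lemma integral_chebyshev_T (hμ : IsEquilibriumMeasure V μ) (hV : ContinuousOn V (Ioi 0))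
    (hs : μ.support = Icc a b)
    (hi : IntervalIntegrable (fun θ => V (arcPoint a b θ)) volume 0 π) {n : ℕ} (hn : n ≠ 0) :
    ∫ y, (Chebyshev.T ℝ n).eval (arcCoord a b y) ∂μ =
      -(n / (2 * π)) * ∫ θ in (0 : ℝ)..π, cos (n * θ) * V (arcPoint a b θ) := by
  have hμp : IsProbabilityMeasure μ := hμ.1.1
  obtain ⟨ha, hab⟩ := hμ.nonneg_and_lt hV hs
  have hae := ae_mem_of_support_eq hs
  have hc : Continuous fun θ : ℝ => cos (n * θ) := by fun_prop
  obtain ⟨hU, hUeq⟩ := integral_mul_logPotential hae hab hc (fun θ => abs_cos_le_one _)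
  have hcI : ∫ θ in (0 : ℝ)..π, cos (n * θ) = 0 := by
    have := integral_cos_int_mul n
    push_cast at this
    rw [this, if_neg (by exact_mod_cast hn)]
  have h1 : ∫ θ in (0 : ℝ)..π, cos (n * θ) * V (arcPoint a b θ) =
      2 * ∫ θ in (0 : ℝ)..π, cos (n * θ) * logPotential μ (arcPoint a b θ) := by
    have e : ∫ θ in (0 : ℝ)..π, cos (n * θ) * V (arcPoint a b θ) = ∫ θ in (0 : ℝ)..π,
        (2 * (cos (n * θ) * logPotential μ (arcPoint a b θ)) +
          robinConstant V μ * cos (n * θ)) := by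
      rw [integral_of_le pi_pos.le, integral_of_le pi_pos.le]
      refine integral_congr_ae ?_
      filter_upwards [ae_arcPoint_eq_robinConstant hμ hV hs hi] with θ hθ
      rw [hθ]; ring
    rw [e, intervalIntegral.integral_add (hU.const_mul 2)
      ((hc.intervalIntegrable _ _).const_mul _), intervalIntegral.integral_const_mul,
      intervalIntegral.integral_const_mul, hcI, mul_zero, add_zero]
  have h2 : ∫ y, (∫ θ in (0 : ℝ)..π, cos (n * θ) * log |y - arcPoint a b θ|) ∂μ =
      ∫ y, -(π / n) * (Chebyshev.T ℝ n).eval (arcCoord a b y) ∂μ := by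
    refine integral_congr_ae ?_
    filter_upwards [hae] with y hy
    obtain ⟨θ, -, rfl⟩ := exists_arcPoint_eq hab hy
    rw [integral_cos_mul_log_arcPoint_sub hab hn, arcCoord_arcPoint hab, Chebyshev.T_real_cos]
    push_cast; ring
  rw [h1, hUeq, h2, MeasureTheory.integral_const_mul]
  have : (n : ℝ) ≠ 0 := by exact_mod_cast hn
  field_simp
end equilibrium

/-! ### Convex functions on the half line -/

section convex
variable {Q : ℝ → ℝ}

lemma ConvexOn.monotoneOn_rightDeriv_Ioi (hQ : ConvexOn ℝ (Ici 0) Q) :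
    MonotoneOn (fun x => derivWithin Q (Ioi x) x) (Ioi 0) := by
  simpa only [interior_Ici] using hQ.monotoneOn_rightDeriv

lemma ConvexOn.slope_mem_Icc_rightDeriv (hQ : ConvexOn ℝ (Ici 0) Q) {x y : ℝ} (hx : 0 < x)
    (hxy : x < y) :
    slope Q x y ∈ Icc (derivWithin Q (Ioi x) x) (derivWithin Q (Ioi y) y) := by
  have hxi : x ∈ interior (Ici (0 : ℝ)) := by simpa using hx
  have hyi : y ∈ interior (Ici (0 : ℝ)) := by simpa using hx.trans hxy
  refine ⟨hQ.rightDeriv_le_slope_of_mem_interior hxi (interior_subset hyi) hxy, ?_⟩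
  exact (hQ.slope_le_leftDeriv_of_mem_interior (interior_subset hxi) hyi hxy).trans
    (hQ.leftDeriv_le_rightDeriv_of_mem_interior hyi)

lemma ConvexOn.exists_lipschitzOnWith_Icc (hQ : ConvexOn ℝ (Ici 0) Q) {c e : ℝ} (hc : 0 < c) :
    ∃ K, LipschitzOnWith K Q (Icc c e) := by
  set p := fun x => derivWithin Q (Ioi x) x with hp
  have hmono := hQ.monotoneOn_rightDeriv_Ioi
  have key : ∀ x ∈ Icc c e, ∀ y ∈ Icc c e, x < y → |Q y - Q x| ≤ (|p c| + |p e|) * |y - x| := by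
    intro x hx y hy hxy
    have h1 := hQ.slope_mem_Icc_rightDeriv (hc.trans_le hx.1) hxy
    have hx0 : x ∈ Ioi (0 : ℝ) := hc.trans_le hx.1
    have hy0 : y ∈ Ioi (0 : ℝ) := hc.trans_le hy.1
    have he0 : e ∈ Ioi (0 : ℝ) := hc.trans_le (hy.1.trans hy.2)
    have h2 : p c ≤ slope Q x y := (hmono hc hx0 hx.1).trans h1.1
    have h3 : slope Q x y ≤ p e := h1.2.trans (hmono hy0 he0 hy.2)
    have h4 : |slope Q x y| ≤ |p c| + |p e| := abs_le.2
      ⟨by linarith [neg_abs_le (p c), abs_nonneg (p e)],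
        by linarith [le_abs_self (p e), abs_nonneg (p c)]⟩
    have h5 : Q y - Q x = slope Q x y * (y - x) := by
      rw [slope_def_field, div_mul_cancel₀ _ (sub_pos.2 hxy).ne']
    rw [h5, abs_mul]
    exact mul_le_mul_of_nonneg_right h4 (abs_nonneg _)
  refine ⟨Real.toNNReal (|p c| + |p e|), LipschitzOnWith.of_dist_le_mul fun x hx y hy => ?_⟩
  rw [dist_eq, dist_eq, Real.coe_toNNReal _ (by positivity)]
  rcases lt_trichotomy x y with h | h | h
  · rw [abs_sub_comm (Q x), abs_sub_comm x]; exact key x hx y hy h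
  · simp [h]
  · exact key y hy x hx h

/-- A convex function is differentiable where its right derivative is continuous. -/
lemma ConvexOn.exists_countable_hasDerivAt (hQ : ConvexOn ℝ (Ici 0) Q) :
    ∃ N : Set ℝ, N.Countable ∧ ∀ x ∈ Ioi (0 : ℝ) \ N,
      HasDerivAt Q (derivWithin Q (Ioi x) x) x := by
  have hmono := hQ.monotoneOn_rightDeriv_Ioi
  refine ⟨_, hmono.countable_not_continuousWithinAt, fun x hx => ?_⟩
  have hx0 : 0 < x := hx.1
  have hxi : x ∈ interior (Ici (0 : ℝ)) := by simpa using hx0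
  have hcont : ContinuousAt (fun x => derivWithin Q (Ioi x) x) x := by
    have : ContinuousWithinAt (fun x => derivWithin Q (Ioi x) x) (Ioi 0) x := by
      by_contra h
      exact hx.2 ⟨hx0, h⟩
    exact this.continuousAt (Ioi_mem_nhds hx0)
  have hR := hQ.hasDerivWithinAt_rightDeriv_of_mem_interior hxi
  have hL := hQ.hasDerivWithinAt_leftDeriv_of_mem_interior hxi
  have hle : derivWithin Q (Ioi x) x ≤ derivWithin Q (Iio x) x := by
    have ht : Tendsto (fun x => derivWithin Q (Ioi x) x) (𝓝[<] x)
        (𝓝 (derivWithin Q (Ioi x) x)) := hcont.tendsto.mono_left nhdsWithin_le_nhds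
    refine le_of_tendsto ht ?_
    filter_upwards [Ioo_mem_nhdsLT hx0] with y hy
    have hyi : y ∈ interior (Ici (0 : ℝ)) := by simpa using hy.1
    exact (hQ.rightDeriv_le_slope_of_mem_interior hyi (interior_subset hxi) hy.2).trans
      (hQ.slope_le_leftDeriv_of_mem_interior (interior_subset hyi) hxi hy.2)
  have heq := le_antisymm (hQ.leftDeriv_le_rightDeriv_of_mem_interior hxi) hle
  rw [heq] at hL
  rw [← hasDerivWithinAt_univ, ← Iic_union_Ici]
  exact (hasDerivWithinAt_Iio_iff_Iic.1 hL).union (hasDerivWithinAt_Ioi_iff_Ici.1 hR)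

lemma ConvexOn.continuousOn_sub_mul_log (hQ : ConvexOn ℝ (Ici 0) Q) (s : ℝ) :
    ContinuousOn (fun x => Q x - s * log x) (Ioi 0) := by
  have h1 : ContinuousOn Q (Ioi 0) := by
    simpa only [interior_Ici] using hQ.continuousOn_interior
  exact h1.sub (continuousOn_const.mul
    (continuousOn_log.mono fun x (hx : 0 < x) => hx.ne'))

end convex

/-! ### Conditions at the endpoints and moments -/

section equilibrium
variable {V : ℝ → ℝ} {μ : Measure ℝ} {a b : ℝ}

/-- The singular external field repels the support from the origin: near `0` the field is unbounded
while the potential is bounded above. -/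
lemma pos_of_support_eq {Q : ℝ → ℝ} {s : ℝ} (hQ : ConvexOn ℝ (Ici 0) Q) (hs0 : 0 < s)
    (hμ : IsEquilibriumMeasure (fun x => Q x - s * log x) μ) (hs : μ.support = Icc a b) :
    0 < a := by
  have hμp : IsProbabilityMeasure μ := hμ.1.1
  have hV := hQ.continuousOn_sub_mul_log s
  obtain ⟨ha, hab⟩ := hμ.nonneg_and_lt hV hs
  by_contra hcon
  have ha0 : a = 0 := le_antisymm (not_lt.1 hcon) ha
  subst ha0
  have hae := ae_mem_of_support_eq hs
  set p := derivWithin Q (Ioi b) b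
  have hlow : ∀ x, 0 < x → x < b → Q b - |p| * b ≤ Q x := by
    intro x hx hxb
    have h := (hQ.slope_mem_Icc_rightDeriv hx hxb).2
    rw [slope_def_field, div_le_iff₀ (sub_pos.2 hxb)] at h
    have h2 : p * (b - x) ≤ |p| * b :=
      (mul_le_mul_of_nonneg_right (le_abs_self p) (sub_pos.2 hxb).le).trans
        (mul_le_mul_of_nonneg_left (by linarith) (abs_nonneg p))
    linarith
  set T := (robinConstant (fun x => Q x - s * log x) μ + 2 * b + 1 - (Q b - |p| * b)) / s with hT
  set β := min (b / 2) (exp (-T)) with hβ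
  have hβ0 : 0 < β := lt_min (by linarith) (exp_pos _)
  have hβb : β < b := (min_le_left _ _).trans_lt (by linarith)
  have hαβ : β / 2 < β := by linarith
  have hne : NeBot (ae (volume.restrict (Ioc (0 : ℝ) π))) := by
    rw [ae_neBot, Ne, Measure.restrict_eq_zero, Real.volume_Ioc]
    simp [pi_pos]
  obtain ⟨θ, hθ⟩ := (ae_integrable_log_arcPoint_sub hae hαβ).exists
  set x := arcPoint (β / 2) β θ
  have hxm : x ∈ Icc (β / 2) β := arcPoint_mem_Icc hαβ.le θ
  have hx0 : 0 < x := by linarith [hxm.1]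
  have hxb : x < b := hxm.2.trans_lt hβb
  have h1 := le_robinConstant_of_mem_support hμ hV hs ⟨hx0.le, hxb.le⟩ hx0 hθ
  have h2 : logPotential μ x ≤ b := by
    calc logPotential μ x ≤ ∫ _, b ∂μ := by
          refine integral_mono_ae hθ (integrable_const _) ?_
          filter_upwards [hae] with y hy
          have := log_abs_sub_le (A := 0) (B := b) ⟨hx0.le, hxb.le⟩ hy
          linarith
      _ = b := by simp
  have h3 : log x ≤ -T := by
    rw [← log_exp (-T)]
    exact log_le_log hx0 (hxm.2.trans (min_le_right _ _))
  have h4 : s * log x ≤ -(robinConstant (fun x => Q x - s * log x) μ + 2 * b + 1 -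
      (Q b - |p| * b)) := by
    have := mul_le_mul_of_nonneg_left h3 hs0.le
    rwa [mul_neg, hT, mul_div_cancel₀ _ hs0.ne'] at this
  have h5 := hlow x hx0 hxb
  linarith

lemma ae_arcPoint_notMem (hab : a < b) {N : Set ℝ} (hN : N.Countable) :
    ∀ᵐ θ : ℝ, θ ∈ Ioc 0 π → arcPoint a b θ ∉ N := by
  have hc : {θ | θ ∈ Icc 0 π ∧ arcPoint a b θ ∈ N}.Countable := by
    refine MapsTo.countable_of_injOn (f := arcPoint a b) (t := N) (fun θ hθ => hθ.2) ?_ hN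
    intro θ hθ η hη h
    have := congrArg (arcCoord a b) h
    rw [arcCoord_arcPoint hab, arcCoord_arcPoint hab] at this
    exact injOn_cos hθ.1 hη.1 this
  filter_upwards [hc.ae_notMem volume] with θ hθ hθ1 hθ2
  exact hθ ⟨⟨hθ1.1.le, hθ1.2⟩, hθ2⟩

lemma arcPoint_sub_add (m d θ : ℝ) : arcPoint (m - d) (m + d) θ = m + d * cos θ := by
  unfold arcPoint; ring

/-- Vanishing of the derivative of the Mhaskar–Saff functional under translations and dilations of
the interval. -/
lemma integral_deriv_arcPoint (hμ : IsEquilibriumMeasure V μ) (hV : ContinuousOn V (Ioi 0))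
    (hs : μ.support = Icc a b) (ha : 0 < a) {K : NNReal}
    (hK : LipschitzOnWith K V (Icc (a / 2) (b + a / 2))) {N : Set ℝ} (hN : N.Countable) {v : ℝ → ℝ}
    (hv : ∀ x ∈ Ioi (0 : ℝ) \ N, HasDerivAt V (v x) x)
    (hvi : IntervalIntegrable (fun θ => v (arcPoint a b θ)) volume 0 π) :
    ∫ θ in (0 : ℝ)..π, v (arcPoint a b θ) = 0 ∧
      (b - a) / 2 * ∫ θ in (0 : ℝ)..π, v (arcPoint a b θ) * cos θ = 2 * π := by
  have hab := (hμ.nonneg_and_lt hV hs).2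
  set m := (a + b) / 2 with hm
  set d := (b - a) / 2 with hd
  have hd0 : 0 < d := by rw [hd]; linarith
  have hamd : a = m - d := by rw [hm, hd]; ring
  have hbmd : b = m + d := by rw [hm, hd]; ring
  have harc : ∀ θ, arcPoint a b θ = m + d * cos θ := fun θ => rfl
  have hi := intervalIntegrable_comp_arcPoint hV ha hab.le
  -- the functional along the family of intervals with centre `m'` and half-width `d'`
  have hG : ∀ m' d', 0 < d' → d' < m' →
      (∫ θ in (0 : ℝ)..π, V (m + d * cos θ)) - 2 * π * log (d / 2) ≤
      (∫ θ in (0 : ℝ)..π, V (m' + d' * cos θ)) - 2 * π * log (d' / 2) := by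
    intro m' d' h1 h2
    have h := mhaskarSaff_le hμ hV hs hi (α := m' - d') (β := m' + d') (by linarith) (by linarith)
      (intervalIntegrable_comp_arcPoint hV (by linarith) (by linarith))
    simp only [arcPoint_sub_add, harc] at h
    rw [show (b - a) / 4 = d / 2 by rw [hd]; ring,
      show (m' + d' - (m' - d')) / 4 = d' / 2 by ring] at h
    exact h
  have hnot : ∀ᵐ θ : ℝ, θ ∈ Ioc 0 π → HasDerivAt V (v (m + d * cos θ)) (m + d * cos θ) := by
    filter_upwards [ae_arcPoint_notMem hab hN] with θ hθ hθ1
    exact hv _ ⟨ha.trans_le (arcPoint_mem_Icc hab.le θ).1, hθ hθ1⟩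
  have hcosle := fun θ => abs_cos_le_one θ
  have hball : ∀ r t θ : ℝ, |r| < a / 2 → |t| ≤ 1 → m + d * cos θ + r * t ∈
      Icc (a / 2) (b + a / 2) := by
    intro r t θ hr ht
    have h1 := arcPoint_mem_Icc hab.le θ
    rw [harc] at h1
    have h2 : |r * t| ≤ a / 2 := by
      rw [abs_mul]
      calc |r| * |t| ≤ (a / 2) * 1 := mul_le_mul hr.le ht (abs_nonneg _) (by linarith)
        _ = a / 2 := mul_one _
    have h3 := abs_le.1 h2
    exact ⟨by linarith [h1.1, h3.1], by linarith [h1.2, h3.2]⟩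
  have hVcont : ∀ m' d' : ℝ, |d'| < m' → Continuous fun θ => V (m' + d' * cos θ) := by
    intro m' d' h
    exact hV.comp_continuous (by fun_prop) fun θ => add_mul_cos_pos h θ
  have hs2 : Metric.ball (0 : ℝ) (a / 2) ∈ 𝓝 (0 : ℝ) := Metric.ball_mem_nhds _ (by linarith)
  -- differentiation along the family `m + d cos θ + r t(θ)` at `r = 0`
  have hder : ∀ t : ℝ → ℝ, Continuous t → (∀ θ, |t θ| ≤ 1) →
      HasDerivAt (fun r => ∫ θ in (0 : ℝ)..π, V (m + d * cos θ + r * t θ))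
        (∫ θ in (0 : ℝ)..π, v (m + d * cos θ) * t θ) 0 := by
    intro t htc ht
    refine (intervalIntegral.hasDerivAt_integral_of_dominated_loc_of_lip
      (F := fun r θ => V (m + d * cos θ + r * t θ)) (F' := fun θ => v (m + d * cos θ) * t θ)
      (bound := fun _ => (K : ℝ)) hs2 ?_ ?_ ?_ ?_ intervalIntegrable_const ?_).2
    · filter_upwards [hs2] with r hr
      refine Continuous.aestronglyMeasurable (hV.comp_continuous (by fun_prop) fun θ => ?_)
      rw [mem_ball_zero_iff] at hr
      exact lt_of_lt_of_le (by linarith) (hball r (t θ) θ hr (ht θ)).1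
    · have hi' : IntervalIntegrable (fun θ => V (m + d * cos θ)) volume 0 π := hi
      simpa only [zero_mul, add_zero] using hi'
    · rw [uIoc_of_le pi_pos.le]
      exact (((intervalIntegrable_iff_integrableOn_Ioc_of_le pi_pos.le).1
        hvi).aestronglyMeasurable).mul htc.aestronglyMeasurable
    · refine Eventually.of_forall fun θ _ => ?_
      refine LipschitzOnWith.of_dist_le_mul fun r hr r' hr' => ?_
      rw [mem_ball_zero_iff] at hr hr'
      refine (hK.dist_le_mul _ (hball r (t θ) θ hr (ht θ)) _ (hball r' (t θ) θ hr' (ht θ))).trans ?_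
      simp only [coe_nnabs, NNReal.abs_eq]
      refine mul_le_mul_of_nonneg_left ?_ K.2
      rw [dist_eq, dist_eq, add_sub_add_left_eq_sub, ← sub_mul, abs_mul]
      exact mul_le_of_le_one_right (abs_nonneg _) (ht θ)
    · filter_upwards [hnot] with θ hθ hθ1
      rw [uIoc_of_le pi_pos.le] at hθ1
      have h1 : HasDerivAt (fun r : ℝ => m + d * cos θ + r * t θ) (t θ) 0 := by
        simpa using ((hasDerivAt_id (0 : ℝ)).mul_const (t θ)).const_add (m + d * cos θ)
      have h2 := hθ hθ1
      have h3 : HasDerivAt V (v (m + d * cos θ)) (m + d * cos θ + 0 * t θ) := by simpa using h2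
      exact h3.comp (0 : ℝ) h1
  simp only [harc]
  have hdm : d < m := by linarith
  constructor
  · have h := hder (fun _ => 1) continuous_const (by simp)
    simp only [mul_one] at h
    refine IsLocalMin.hasDerivAt_eq_zero ?_ h
    filter_upwards [hs2] with r hr
    rw [mem_ball_zero_iff, norm_eq_abs, abs_lt] at hr
    have := hG (m + r) d hd0 (by linarith [hr.1])
    simp only [add_zero]
    have e : ∀ θ, m + r + d * cos θ = m + d * cos θ + r := fun θ => by ring
    simp only [e] at this
    linarith
  · have h := hder cos continuous_cos hcosle
    have hlog : HasDerivAt (fun r : ℝ => 2 * π * log ((d + r) / 2)) (2 * π * (1 / d)) 0 := by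
      have h1 : HasDerivAt (fun r : ℝ => (d + r) / 2) (1 / 2) 0 :=
        ((hasDerivAt_id (0 : ℝ)).const_add d).div_const 2
      have h2 := (h1.log (by simpa using hd0.ne')).const_mul (2 * π)
      refine h2.congr_deriv ?_
      rw [add_zero]; field_simp
    have h0 := IsLocalMin.hasDerivAt_eq_zero (f := fun r =>
      (∫ θ in (0 : ℝ)..π, V (m + d * cos θ + r * cos θ)) - 2 * π * log ((d + r) / 2)) (a := 0) ?_
      (h.sub hlog)
    · have : ∫ θ in (0 : ℝ)..π, v (m + d * cos θ) * cos θ = 2 * π * (1 / d) := by linarith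
      rw [this]; field_simp
    · have hmem : Ioo (-(min d (m - d))) (min d (m - d)) ∈ 𝓝 (0 : ℝ) :=
        Ioo_mem_nhds (by have := lt_min hd0 (sub_pos.2 hdm); linarith)
          (lt_min hd0 (sub_pos.2 hdm))
      filter_upwards [hmem] with r hr
      have h1 := min_le_left d (m - d)
      have h2 := min_le_right d (m - d)
      have := hG m (d + r) (by linarith [hr.1]) (by linarith [hr.2])
      simp only [zero_mul, add_zero]
      have e : ∀ θ, m + (d + r) * cos θ = m + d * cos θ + r * cos θ := fun θ => by ring
      simp only [e] at this
      linarith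

lemma integral_cos_mul_comp_arcPoint (hV : ContinuousOn V (Ioi 0)) (ha : 0 < a) (hab : a < b)
    {N : Set ℝ} (hN : N.Countable) {v : ℝ → ℝ}
    (hv : ∀ x ∈ Ioi (0 : ℝ) \ N, HasDerivAt V (v x) x)
    (hvi : IntervalIntegrable (fun θ => v (arcPoint a b θ)) volume 0 π) (n : ℕ) :
    n * ∫ θ in (0 : ℝ)..π, cos (n * θ) * V (arcPoint a b θ) =
      (b - a) / 2 * ∫ θ in (0 : ℝ)..π, v (arcPoint a b θ) * (sin θ * sin (n * θ)) := by
  have hVc : Continuous fun θ => V (arcPoint a b θ) :=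
    hV.comp_continuous (continuous_arcPoint a b)
      fun θ => ha.trans_le (arcPoint_mem_Icc hab.le θ).1
  have hi1 : IntervalIntegrable (fun θ => cos (n * θ) * V (arcPoint a b θ)) volume 0 π :=
    ((by fun_prop : Continuous fun θ : ℝ => cos (n * θ)).mul hVc).intervalIntegrable _ _
  have hi2 : IntervalIntegrable (fun θ => v (arcPoint a b θ) * (sin θ * sin (n * θ))) volume 0 π :=
    hvi.mul_continuousOn (Continuous.continuousOn (by fun_prop))
  have hc : {θ | θ ∈ Icc 0 π ∧ arcPoint a b θ ∈ N}.Countable := by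
    refine MapsTo.countable_of_injOn (f := arcPoint a b) (t := N) (fun θ hθ => hθ.2) ?_ hN
    intro θ hθ η hη h
    have := congrArg (arcCoord a b) h
    rw [arcCoord_arcPoint hab, arcCoord_arcPoint hab] at this
    exact injOn_cos hθ.1 hη.1 this
  have h := MeasureTheory.integral_eq_of_hasDerivAt_off_countable_of_le
    (fun θ => V (arcPoint a b θ) * sin (n * θ))
    (fun θ => n * (cos (n * θ) * V (arcPoint a b θ)) -
      (b - a) / 2 * (v (arcPoint a b θ) * (sin θ * sin (n * θ)))) pi_pos.le hc
    (hVc.mul (by fun_prop)).continuousOn (fun θ hθ => ?_)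
    ((hi1.const_mul _).sub (hi2.const_mul _))
  · rw [intervalIntegral.integral_sub (hi1.const_mul _) (hi2.const_mul _),
      intervalIntegral.integral_const_mul, intervalIntegral.integral_const_mul] at h
    simp only [mul_zero, sin_zero, sin_nat_mul_pi, sub_zero] at h
    linarith
  · have hx : arcPoint a b θ ∈ Ioi (0 : ℝ) \ N :=
      ⟨ha.trans_le (arcPoint_mem_Icc hab.le θ).1, fun hmem =>
        hθ.2 ⟨⟨hθ.1.1.le, hθ.1.2.le⟩, hmem⟩⟩
    have h1 : HasDerivAt (arcPoint a b) ((b - a) / 2 * (-sin θ)) θ :=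
      ((hasDerivAt_cos θ).const_mul _).const_add _
    have h2 : HasDerivAt (fun θ => V (arcPoint a b θ))
      (v (arcPoint a b θ) * ((b - a) / 2 * (-sin θ))) θ := (hv _ hx).comp θ h1
    have h3 : HasDerivAt (fun θ : ℝ => sin (n * θ)) (cos (n * θ) * n) θ := by
      simpa using ((hasDerivAt_id θ).const_mul (n : ℝ)).sin
    refine (h2.mul h3).congr_deriv ?_
    ring

/-- The moments of the equilibrium measure against Chebyshev polynomials of the second kind. The
endpoint conditions say that the formula also holds for the indices `-1` and `0`, where it starts
the recursion `U_{k+2} = U_k + 2 T_{k+2}`. -/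
lemma integral_chebyshev_U (hμ : IsEquilibriumMeasure V μ) (hV : ContinuousOn V (Ioi 0))
    (hs : μ.support = Icc a b) (ha : 0 < a) {K : NNReal}
    (hK : LipschitzOnWith K V (Icc (a / 2) (b + a / 2))) {N : Set ℝ} (hN : N.Countable) {v : ℝ → ℝ}
    (hv : ∀ x ∈ Ioi (0 : ℝ) \ N, HasDerivAt V (v x) x)
    (hvi : IntervalIntegrable (fun θ => v (arcPoint a b θ)) volume 0 π) (k : ℕ) :
    ∫ y, (Chebyshev.U ℝ k).eval (arcCoord a b y) ∂μ =
      (b - a) / (4 * π) * ∫ θ in (0 : ℝ)..π, v (arcPoint a b θ) * cos ((k + 1 : ℝ) * θ) := by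
  have hμp : IsProbabilityMeasure μ := hμ.1.1
  have hab := (hμ.nonneg_and_lt hV hs).2
  have hae := ae_mem_of_support_eq hs
  have hi := intervalIntegrable_comp_arcPoint hV ha hab.le
  obtain ⟨h0, h1⟩ := integral_deriv_arcPoint hμ hV hs ha hK hN hv hvi
  have hvc : ∀ g : ℝ → ℝ, Continuous g →
      IntervalIntegrable (fun θ => v (arcPoint a b θ) * g θ) volume 0 π := fun g hg =>
    hvi.mul_continuousOn hg.continuousOn
  have hpoly : ∀ p : ℝ[X], Integrable (fun y => p.eval (arcCoord a b y)) μ := by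
    intro p
    have hc : Continuous fun y => p.eval (arcCoord a b y) := by
      unfold arcCoord
      exact p.continuous.comp (by fun_prop)
    have := hc.continuousOn.integrableOn_compact (μ := μ) (isCompact_Icc (a := a) (b := b))
    rwa [IntegrableOn, Measure.restrict_eq_self_of_ae_mem hae] at this
  have hT : ∀ n : ℕ, n ≠ 0 → ∫ y, (Chebyshev.T ℝ n).eval (arcCoord a b y) ∂μ =
      -((b - a) / (4 * π)) * ∫ θ in (0 : ℝ)..π, v (arcPoint a b θ) * (sin θ * sin (n * θ)) := by
    intro n hn
    rw [integral_chebyshev_T hμ hV hs hi hn, neg_mul, neg_mul, div_mul_eq_mul_div,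
      integral_cos_mul_comp_arcPoint hV ha hab hN hv hvi n]
    field_simp; ring
  induction k using Nat.twoStepInduction with
  | zero =>
    simp only [CharP.cast_eq_zero, Chebyshev.U_zero, eval_one, zero_add, one_mul]
    rw [MeasureTheory.integral_const, probReal_univ, one_smul,
      show (b - a) / (4 * π) = ((b - a) / 2) / (2 * π) by ring, div_mul_eq_mul_div, h1]
    field_simp
  | one =>
    have h2 := hT 1 one_ne_zero
    simp only [Nat.cast_one, Chebyshev.T_one, eval_X, one_mul] at h2
    have e : ∀ y, (Chebyshev.U ℝ ((1 : ℕ) : ℤ)).eval (arcCoord a b y) = 2 * arcCoord a b y := by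
      intro y; simp [Chebyshev.U_one]
    simp_rw [e]
    rw [MeasureTheory.integral_const_mul, h2]
    have e2 : ∫ θ in (0 : ℝ)..π, v (arcPoint a b θ) * cos (((1 : ℕ) + 1 : ℝ) * θ) =
        (∫ θ in (0 : ℝ)..π, v (arcPoint a b θ)) -
        2 * ∫ θ in (0 : ℝ)..π, v (arcPoint a b θ) * (sin θ * sin θ) := by
      rw [← intervalIntegral.integral_const_mul,
        ← intervalIntegral.integral_sub hvi ((hvc _ (by fun_prop)).const_mul _)]
      refine intervalIntegral.integral_congr fun θ _ => ?_
      rw [show ((1 : ℕ) + 1 : ℝ) * θ = 2 * θ by push_cast; ring, cos_two_mul']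
      linear_combination (v (arcPoint a b θ)) * sin_sq_add_cos_sq θ
    rw [e2, h0]; ring
  | more k ih _ =>
    have h2 := hT (k + 2) (by omega)
    have e : ∀ y, (Chebyshev.U ℝ ((k + 2 : ℕ) : ℤ)).eval (arcCoord a b y) =
        2 * (Chebyshev.T ℝ ((k + 2 : ℕ) : ℤ)).eval (arcCoord a b y) +
        (Chebyshev.U ℝ (k : ℤ)).eval (arcCoord a b y) := by
      intro y
      push_cast
      rw [Chebyshev.U_eq_two_mul_T_add_U]
      simp
    simp_rw [e]
    rw [integral_add ((hpoly _).const_mul 2) (hpoly _), MeasureTheory.integral_const_mul, h2, ih]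
    have e2 : ∫ θ in (0 : ℝ)..π, v (arcPoint a b θ) * cos (((k + 2 : ℕ) + 1 : ℝ) * θ) =
        (∫ θ in (0 : ℝ)..π, v (arcPoint a b θ) * cos ((k + 1 : ℝ) * θ)) -
        2 * ∫ θ in (0 : ℝ)..π, v (arcPoint a b θ) * (sin θ * sin ((k + 2 : ℕ) * θ)) := by
      rw [← intervalIntegral.integral_const_mul,
        ← intervalIntegral.integral_sub (hvc _ (by fun_prop)) ((hvc _ (by fun_prop)).const_mul _)]
      refine intervalIntegral.integral_congr fun θ _ => ?_
      push_cast
      rw [show ((k : ℝ) + 2 + 1) * θ = (k + 2) * θ + θ by ring,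
        show ((k : ℝ) + 1) * θ = (k + 2) * θ - θ by ring, cos_add, cos_sub]
      ring
    rw [e2]; ring
end equilibrium

/-! ### Comparison of the equilibrium measure with a Marchenko–Pastur law -/

section moments
variable {m d D : ℝ}

lemma continuous_div_add_mul_cos (hd : |d| < m) {f : ℝ → ℝ} (hf : Continuous f) :
    Continuous fun θ => f θ / (m + d * cos θ) :=
  hf.div (by fun_prop) fun θ => (add_mul_cos_pos hd θ).ne'

/-- The integrals of `cos kθ / (m + d cos θ)` form a geometric sequence of ratio `(D - m)/d`. -/
lemma mul_integral_cos_succ_div (hd : |d| < m) (hD : 0 < D) (hDm : D ^ 2 = m ^ 2 - d ^ 2) (k : ℕ) :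
    d * ∫ θ in (0 : ℝ)..π, cos ((k + 1 : ℝ) * θ) / (m + d * cos θ) =
      (D - m) * ∫ θ in (0 : ℝ)..π, cos (k * θ) / (m + d * cos θ) := by
  have hi : ∀ f : ℝ → ℝ, Continuous f →
      IntervalIntegrable (fun θ => f θ / (m + d * cos θ)) volume 0 π := fun f hf =>
    (continuous_div_add_mul_cos hd hf).intervalIntegrable _ _
  have hne := fun θ => (add_mul_cos_pos hd θ).ne'
  induction k with
  | zero =>
    have h1 : (∫ θ in (0 : ℝ)..π, (m * (1 / (m + d * cos θ)) + d * (cos θ / (m + d * cos θ)))) =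
        π := by
      rw [intervalIntegral.integral_congr (g := fun _ => (1 : ℝ)) fun θ _ => ?_]
      · simp
      · have := hne θ
        field_simp
    rw [intervalIntegral.integral_add ((hi _ continuous_const).const_mul _)
      ((hi _ continuous_cos).const_mul _), intervalIntegral.integral_const_mul,
      intervalIntegral.integral_const_mul, integral_inv_add_mul_cos hd hD hDm] at h1
    simp only [CharP.cast_eq_zero, zero_add, one_mul, zero_mul, cos_zero]
    rw [integral_inv_add_mul_cos hd hD hDm]
    have : D * (π / D) = π := mul_div_cancel₀ _ hD.ne'
    linarith
  | succ k ih =>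
    have h0 : ∫ θ in (0 : ℝ)..π, cos (((k + 1 : ℕ) : ℤ) * θ) = 0 := by
      rw [integral_cos_int_mul, if_neg (by omega)]
    have h1 : (∫ θ in (0 : ℝ)..π, ((2 * m) * (cos ((k + 1 : ℝ) * θ) / (m + d * cos θ)) +
        d * (cos ((((k + 1 : ℕ) : ℝ) + 1) * θ) / (m + d * cos θ)) +
        d * (cos (k * θ) / (m + d * cos θ)))) = 0 := by
      rw [intervalIntegral.integral_congr (g := fun θ => 2 * cos (((k + 1 : ℕ) : ℤ) * θ))
        fun θ _ => ?_, intervalIntegral.integral_const_mul, h0, mul_zero]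
      have := hne θ
      have e1 : cos ((((k + 1 : ℕ) : ℝ) + 1) * θ) + cos (k * θ) =
          2 * cos ((k + 1 : ℝ) * θ) * cos θ := by
        push_cast
        rw [show ((k : ℝ) + 1 + 1) * θ = (k + 1) * θ + θ by ring,
          show (k : ℝ) * θ = (k + 1) * θ - θ by ring, cos_add, cos_sub]
        ring
      push_cast at e1 ⊢
      generalize cos (((k : ℝ) + 1 + 1) * θ) = A at e1 ⊢
      field_simp
      linear_combination d * e1
    rw [intervalIntegral.integral_add (((hi _ (by fun_prop)).const_mul _).add
      ((hi _ (by fun_prop)).const_mul _)) ((hi _ (by fun_prop)).const_mul _),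
      intervalIntegral.integral_add ((hi _ (by fun_prop)).const_mul _)
      ((hi _ (by fun_prop)).const_mul _), intervalIntegral.integral_const_mul,
      intervalIntegral.integral_const_mul, intervalIntegral.integral_const_mul] at h1
    rcases eq_or_ne d 0 with rfl | hd0
    · have : D = m := by
        have hm : 0 < m := by simpa using hd
        nlinarith
      simp [this]
    · have h2 : d * (∫ θ in (0 : ℝ)..π, cos (k * θ) / (m + d * cos θ)) =
          -(D + m) * ∫ θ in (0 : ℝ)..π, cos ((k + 1 : ℝ) * θ) / (m + d * cos θ) := by
        refine mul_left_cancel₀ hd0 ?_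
        linear_combination (D + m) * ih +
          (∫ θ in (0 : ℝ)..π, cos (k * θ) / (m + d * cos θ)) * hDm
      push_cast at h1 ⊢
      linarith

lemma integral_sin_succ_mul_sin_div (hd : |d| < m) (hD : 0 < D) (hDm : D ^ 2 = m ^ 2 - d ^ 2)
    (k : ℕ) :
    d * ∫ θ in (0 : ℝ)..π, sin ((k + 1 : ℝ) * θ) * sin θ / (m + d * cos θ) =
      -D * ∫ θ in (0 : ℝ)..π, cos ((k + 1 : ℝ) * θ) / (m + d * cos θ) := by
  have hi : ∀ f : ℝ → ℝ, Continuous f →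
      IntervalIntegrable (fun θ => f θ / (m + d * cos θ)) volume 0 π := fun f hf =>
    (continuous_div_add_mul_cos hd hf).intervalIntegrable _ _
  have h1 := mul_integral_cos_succ_div hd hD hDm k
  have h2 := mul_integral_cos_succ_div hd hD hDm (k + 1)
  rcases eq_or_ne d 0 with rfl | hd0
  · have hm : 0 < m := by simpa using hd
    have h0 : ∫ θ in (0 : ℝ)..π, cos (((k + 1 : ℕ) : ℤ) * θ) = 0 := by
      rw [integral_cos_int_mul, if_neg (by omega)]
    push_cast at h0
    simp [intervalIntegral.integral_div, h0]
  · have e : ∫ θ in (0 : ℝ)..π, sin ((k + 1 : ℝ) * θ) * sin θ / (m + d * cos θ) =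
        1 / 2 * (∫ θ in (0 : ℝ)..π, cos (k * θ) / (m + d * cos θ)) -
        1 / 2 * ∫ θ in (0 : ℝ)..π, cos ((((k + 1 : ℕ) : ℝ) + 1) * θ) / (m + d * cos θ) := by
      rw [← intervalIntegral.integral_const_mul, ← intervalIntegral.integral_const_mul,
        ← intervalIntegral.integral_sub ((hi _ (by fun_prop)).const_mul _)
          ((hi _ (by fun_prop)).const_mul _)]
      refine intervalIntegral.integral_congr fun θ _ => ?_
      push_cast
      rw [show ((k : ℝ) + 1 + 1) * θ = (k + 1) * θ + θ by ring,
          show (k : ℝ) * θ = (k + 1) * θ - θ by ring, cos_add, cos_sub]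
      ring
    have h3 : d * (∫ θ in (0 : ℝ)..π, cos (k * θ) / (m + d * cos θ)) =
        -(D + m) * ∫ θ in (0 : ℝ)..π, cos ((k + 1 : ℝ) * θ) / (m + d * cos θ) := by
      refine mul_left_cancel₀ hd0 ?_
      linear_combination (D + m) * h1 +
        (∫ θ in (0 : ℝ)..π, cos (k * θ) / (m + d * cos θ)) * hDm
    rw [e]
    push_cast at h2 ⊢
    linear_combination (1 / 2 : ℝ) * h3 - (1 / 2 : ℝ) * h2

end moments

section weierstrass
variable {μ : Measure ℝ} {a b : ℝ} {ρ : ℝ → ℝ}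

lemma integrable_of_continuousOn_Icc [IsFiniteMeasure μ] (hae : ∀ᵐ x ∂μ, x ∈ Icc a b)
    {g : ℝ → ℝ} (hg : ContinuousOn g (Icc a b)) : Integrable g μ := by
  have := hg.integrableOn_compact (μ := μ) isCompact_Icc
  rwa [IntegrableOn, Measure.restrict_eq_self_of_ae_mem hae] at this

lemma ContinuousOn.continuous_comp_arcPoint {g : ℝ → ℝ} (hg : ContinuousOn g (Icc a b))
    (hab : a ≤ b) : Continuous fun θ => g (arcPoint a b θ) :=
  hg.comp_continuous (continuous_arcPoint a b) (arcPoint_mem_Icc hab)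

/-- By the Weierstrass theorem, an inequality between two positive functionals need only be checked
on nonnegative polynomials. -/
lemma integral_arcPoint_mul_le_of_polynomial [IsProbabilityMeasure μ] (hab : a ≤ b)
    (hae : ∀ᵐ x ∂μ, x ∈ Icc a b) (hρ : Continuous ρ) (hρ0 : ∀ θ, 0 ≤ ρ θ)
    (hp : ∀ p : ℝ[X], (∀ x ∈ Icc a b, 0 ≤ p.eval x) →
      ∫ θ in (0 : ℝ)..π, p.eval (arcPoint a b θ) * ρ θ ≤ ∫ x, p.eval x ∂μ)
    {g : ℝ → ℝ} (hg : ContinuousOn g (Icc a b)) (hg0 : ∀ x ∈ Icc a b, 0 ≤ g x) :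
    ∫ θ in (0 : ℝ)..π, g (arcPoint a b θ) * ρ θ ≤ ∫ x, g x ∂μ := by
  refine le_of_forall_pos_le_add fun ε hε => ?_
  obtain ⟨p, hpe⟩ := exists_polynomial_near_of_continuousOn a b g hg (ε / 2) (by linarith)
  set q := p + C (ε / 2) with hq
  have hqe : ∀ x, q.eval x = p.eval x + ε / 2 := fun x => by simp [hq]
  have hqg : ∀ x ∈ Icc a b, g x ≤ q.eval x ∧ q.eval x ≤ g x + ε := by
    intro x hx
    have := abs_lt.1 (hpe x hx)
    rw [hqe]
    constructor <;> linarith [this.1, this.2]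
  have hgi := integrable_of_continuousOn_Icc hae hg
  calc ∫ θ in (0 : ℝ)..π, g (arcPoint a b θ) * ρ θ
      ≤ ∫ θ in (0 : ℝ)..π, q.eval (arcPoint a b θ) * ρ θ := by
        refine intervalIntegral.integral_mono_on pi_pos.le
          (((hg.continuous_comp_arcPoint hab).mul hρ).intervalIntegrable _ _)
          (((q.continuous.comp (continuous_arcPoint a b)).mul hρ).intervalIntegrable _ _)
          fun θ _ => mul_le_mul_of_nonneg_right (hqg _ (arcPoint_mem_Icc hab θ)).1 (hρ0 θ)
    _ ≤ ∫ x, q.eval x ∂μ := hp q fun x hx => (hg0 x hx).trans (hqg x hx).1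
    _ ≤ ∫ x, (g x + ε) ∂μ := by
        refine integral_mono_ae (integrable_of_continuousOn_Icc hae q.continuousOn)
          (hgi.add (integrable_const _)) ?_
        filter_upwards [hae] with x hx using (hqg x hx).2
    _ = ∫ x, g x ∂μ + ε := by
        rw [integral_add hgi (integrable_const _)]; simp

lemma integral_le_arcPoint_mul_of_polynomial [IsProbabilityMeasure μ] (hab : a ≤ b)
    (hae : ∀ᵐ x ∂μ, x ∈ Icc a b) (hρ : Continuous ρ) (hρ0 : ∀ θ, 0 ≤ ρ θ)
    (hp : ∀ p : ℝ[X], ∫ θ in (0 : ℝ)..π, p.eval (arcPoint a b θ) * ρ θ = ∫ x, p.eval x ∂μ)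
    {g : ℝ → ℝ} (hg : ContinuousOn g (Icc a b)) :
    ∫ x, g x ∂μ ≤ ∫ θ in (0 : ℝ)..π, g (arcPoint a b θ) * ρ θ := by
  have h1 : ∫ θ in (0 : ℝ)..π, ρ θ = 1 := by simpa using hp 1
  refine le_of_forall_pos_le_add fun ε hε => ?_
  obtain ⟨p, hpe⟩ := exists_polynomial_near_of_continuousOn a b g hg (ε / 2) (by linarith)
  set q := p + C (ε / 2) with hq
  have hqe : ∀ x, q.eval x = p.eval x + ε / 2 := fun x => by simp [hq]
  have hqg : ∀ x ∈ Icc a b, g x ≤ q.eval x ∧ q.eval x ≤ g x + ε := by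
    intro x hx
    have := abs_lt.1 (hpe x hx)
    rw [hqe]
    constructor <;> linarith [this.1, this.2]
  have hgc : Continuous fun θ => g (arcPoint a b θ) * ρ θ :=
    (hg.continuous_comp_arcPoint hab).mul hρ
  have hρε : Continuous fun θ => ε * ρ θ := continuous_const.mul hρ
  calc ∫ x, g x ∂μ ≤ ∫ x, q.eval x ∂μ := by
        refine integral_mono_ae (integrable_of_continuousOn_Icc hae hg)
          (integrable_of_continuousOn_Icc hae q.continuousOn) ?_
        filter_upwards [hae] with x hx using (hqg x hx).1
    _ = ∫ θ in (0 : ℝ)..π, q.eval (arcPoint a b θ) * ρ θ := (hp q).symm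
    _ ≤ ∫ θ in (0 : ℝ)..π, (g (arcPoint a b θ) * ρ θ + ε * ρ θ) := by
        refine intervalIntegral.integral_mono_on pi_pos.le
          (((q.continuous.comp (continuous_arcPoint a b)).mul hρ).intervalIntegrable _ _)
          ((hgc.add hρε).intervalIntegrable _ _)
          fun θ _ => ?_
        rw [← add_mul]
        exact mul_le_mul_of_nonneg_right (hqg _ (arcPoint_mem_Icc hab θ)).2 (hρ0 θ)
    _ = (∫ θ in (0 : ℝ)..π, g (arcPoint a b θ) * ρ θ) + ε := by
        rw [intervalIntegral.integral_add (hgc.intervalIntegrable _ _)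
          (hρε.intervalIntegrable _ _),
          intervalIntegral.integral_const_mul, h1, mul_one]

lemma integral_eq_arcPoint_mul_of_polynomial [IsProbabilityMeasure μ] (hab : a ≤ b)
    (hae : ∀ᵐ x ∂μ, x ∈ Icc a b) (hρ : Continuous ρ) (hρ0 : ∀ θ, 0 ≤ ρ θ)
    (hp : ∀ p : ℝ[X], ∫ θ in (0 : ℝ)..π, p.eval (arcPoint a b θ) * ρ θ = ∫ x, p.eval x ∂μ)
    {g : ℝ → ℝ} (hg : ContinuousOn g (Icc a b)) :
    ∫ x, g x ∂μ = ∫ θ in (0 : ℝ)..π, g (arcPoint a b θ) * ρ θ := by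
  refine le_antisymm (integral_le_arcPoint_mul_of_polynomial hab hae hρ hρ0 hp hg) ?_
  have h := integral_le_arcPoint_mul_of_polynomial hab hae hρ hρ0 hp hg.neg
  simp only [Pi.neg_apply, neg_mul] at h
  rw [MeasureTheory.integral_neg, intervalIntegral.integral_neg] at h
  linarith

/-- A functional of polynomials in the variable `x` as a functional of polynomials in the
normalized variable `arcCoord a b x`. -/
lemma exists_polynomial_arcCoord (hab : a < b) (p : ℝ[X]) :
    ∃ P : ℝ[X], (∀ x, P.eval (arcCoord a b x) = p.eval x) ∧
      ∀ θ, P.eval (cos θ) = p.eval (arcPoint a b θ) := by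
  have h1 : ∀ x, (p.comp (C ((a + b) / 2) + C ((b - a) / 2) * X)).eval (arcCoord a b x) =
      p.eval x := by
    intro x
    have : (b - a) / 2 ≠ 0 := by linarith
    simp only [eval_comp, eval_add, eval_mul, eval_C, eval_X, arcCoord, mul_div_cancel₀ _ this]
    congr 1; ring
  refine ⟨_, h1, fun θ => ?_⟩
  rw [← arcCoord_arcPoint hab θ, h1]

end weierstrass

section comparison
variable {Q : ℝ → ℝ} {s : ℝ} {μ : Measure ℝ} {a b : ℝ}

/-- The density in `θ` of the Marchenko–Pastur type law
`s / (2π √(ab)) · √((x - a) (b - x)) / x dx` under the parametrization `x = arcPoint a b θ`. -/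
noncomputable def marchenkoPasturWeight (s a b θ : ℝ) : ℝ :=
  s / (2 * π * √(a * b)) * (((b - a) / 2 * sin θ) ^ 2 / arcPoint a b θ)

lemma arcPoint_pos (ha : 0 < a) (hab : a ≤ b) (θ : ℝ) : 0 < arcPoint a b θ :=
  ha.trans_le (arcPoint_mem_Icc hab θ).1

lemma continuous_marchenkoPasturWeight (ha : 0 < a) (hab : a ≤ b) :
    Continuous (marchenkoPasturWeight s a b) := by
  unfold marchenkoPasturWeight
  exact continuous_const.mul ((by fun_prop : Continuous fun θ => ((b - a) / 2 * sin θ) ^ 2).div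
    (continuous_arcPoint a b) fun θ => (arcPoint_pos ha hab θ).ne')

lemma marchenkoPasturWeight_nonneg (hs0 : 0 ≤ s) (ha : 0 < a) (hab : a ≤ b) (θ : ℝ) :
    0 ≤ marchenkoPasturWeight s a b θ := by
  unfold marchenkoPasturWeight
  have := arcPoint_pos ha hab θ
  positivity

lemma abs_half_sub_lt (ha : 0 < a) (hab : a < b) : |(b - a) / 2| < (a + b) / 2 := by
  rw [abs_of_pos (by linarith)]; linarith

lemma sq_sqrt_mul_eq (ha : 0 < a) (hab : a < b) :
    √(a * b) ^ 2 = ((a + b) / 2) ^ 2 - ((b - a) / 2) ^ 2 := by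
  rw [sq_sqrt (mul_pos ha (ha.trans hab)).le]; ring

lemma ConvexOn.antitoneOn_rightDeriv_arcPoint (hQ : ConvexOn ℝ (Ici 0) Q) (ha : 0 < a)
    (hab : a ≤ b) :
    AntitoneOn (fun θ => derivWithin Q (Ioi (arcPoint a b θ)) (arcPoint a b θ)) (Icc 0 π) := by
  intro θ hθ η hη h
  refine hQ.monotoneOn_rightDeriv_Ioi (arcPoint_pos ha hab η) (arcPoint_pos ha hab θ) ?_
  have := strictAntiOn_cos.antitoneOn hθ hη h
  unfold arcPoint
  nlinarith

lemma ConvexOn.intervalIntegrable_rightDeriv_arcPoint (hQ : ConvexOn ℝ (Ici 0) Q) (ha : 0 < a)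
    (hab : a ≤ b) : IntervalIntegrable
      (fun θ => derivWithin Q (Ioi (arcPoint a b θ)) (arcPoint a b θ)) volume 0 π := by
  refine AntitoneOn.intervalIntegrable ?_
  rw [uIcc_of_le pi_pos.le]
  exact hQ.antitoneOn_rightDeriv_arcPoint ha hab

lemma ConvexOn.exists_lipschitzOnWith_sub_mul_log (hQ : ConvexOn ℝ (Ici 0) Q) {c e : ℝ}
    (hc : 0 < c) : ∃ K, LipschitzOnWith K (fun x => Q x - s * log x) (Icc c e) := by
  obtain ⟨K, hK⟩ := hQ.exists_lipschitzOnWith_Icc (e := e) hc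
  have h : LipschitzOnWith (Real.toNNReal (|s| / c)) (fun x => s * log x) (Icc c e) := by
    refine (convex_Icc c e).lipschitzOnWith_of_nnnorm_hasDerivWithin_le
      (f' := fun x => s * x⁻¹) (fun x hx => ?_) fun x hx => ?_
    · exact ((hasDerivAt_log (hc.trans_le hx.1).ne').const_mul s).hasDerivWithinAt
    · rw [← NNReal.coe_le_coe, coe_nnnorm, Real.coe_toNNReal _ (by positivity), norm_eq_abs, abs_mul, abs_inv,
        abs_of_pos (hc.trans_le hx.1)]
      exact mul_le_mul_of_nonneg_left (inv_anti₀ hc hx.1) (abs_nonneg s)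
  exact ⟨_, hK.sub h⟩

/-- The part of the moments coming from `-s log x` is accounted for by the Marchenko–Pastur type
law. -/
lemma integral_chebyshev_U_eq_add (hQ : ConvexOn ℝ (Ici 0) Q) (hs0 : 0 < s)
    (hμ : IsEquilibriumMeasure (fun x => Q x - s * log x) μ) (hs : μ.support = Icc a b) (k : ℕ) :
    ∫ y, (Chebyshev.U ℝ k).eval (arcCoord a b y) ∂μ =
      (∫ θ in (0 : ℝ)..π, (Chebyshev.U ℝ k).eval (cos θ) * marchenkoPasturWeight s a b θ) +
      (b - a) / (4 * π) * ∫ θ in (0 : ℝ)..π,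
        derivWithin Q (Ioi (arcPoint a b θ)) (arcPoint a b θ) * cos ((k + 1 : ℝ) * θ) := by
  have hV := hQ.continuousOn_sub_mul_log s
  have ha := pos_of_support_eq hQ hs0 hμ hs
  have hab := (hμ.nonneg_and_lt hV hs).2
  obtain ⟨K, hK⟩ := hQ.exists_lipschitzOnWith_sub_mul_log (s := s) (e := b + a / 2) (half_pos ha)
  obtain ⟨N, hN, hder⟩ := hQ.exists_countable_hasDerivAt
  have hq := hQ.intervalIntegrable_rightDeriv_arcPoint ha hab.le
  have hinv : Continuous fun θ => (arcPoint a b θ)⁻¹ :=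
    (continuous_arcPoint a b).inv₀ fun θ => (arcPoint_pos ha hab.le θ).ne'
  have h := integral_chebyshev_U hμ hV hs ha hK hN
    (v := fun x => derivWithin Q (Ioi x) x - s * x⁻¹)
    (fun x hx => (hder x hx).sub ((hasDerivAt_log (ne_of_gt hx.1)).const_mul s))
    (hq.sub ((hinv.intervalIntegrable _ _).const_mul s)) k
  rw [h]
  have hc : Continuous fun θ : ℝ => cos ((k + 1 : ℝ) * θ) := by fun_prop
  have e1 : (∫ θ in (0 : ℝ)..π, (derivWithin Q (Ioi (arcPoint a b θ)) (arcPoint a b θ) -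
      s * (arcPoint a b θ)⁻¹) * cos ((k + 1 : ℝ) * θ)) =
      (∫ θ in (0 : ℝ)..π, derivWithin Q (Ioi (arcPoint a b θ)) (arcPoint a b θ) *
        cos ((k + 1 : ℝ) * θ)) - s * ∫ θ in (0 : ℝ)..π, cos ((k + 1 : ℝ) * θ) /
          ((a + b) / 2 + (b - a) / 2 * cos θ) := by
    rw [← intervalIntegral.integral_const_mul,
      ← intervalIntegral.integral_sub (hq.mul_continuousOn hc.continuousOn)
      (((continuous_div_add_mul_cos (abs_half_sub_lt ha hab) hc).intervalIntegrable _ _).const_mul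
        s)]
    refine intervalIntegral.integral_congr fun θ _ => ?_
    simp only [arcPoint]
    ring
  have e2 : (∫ θ in (0 : ℝ)..π, (Chebyshev.U ℝ k).eval (cos θ) * marchenkoPasturWeight s a b θ) =
      s / (2 * π * √(a * b)) * ((b - a) / 2) ^ 2 * ∫ θ in (0 : ℝ)..π,
        sin ((k + 1 : ℝ) * θ) * sin θ / ((a + b) / 2 + (b - a) / 2 * cos θ) := by
    rw [← intervalIntegral.integral_const_mul]
    refine intervalIntegral.integral_congr fun θ _ => ?_
    have h1 := Chebyshev.U_real_cos θ k
    push_cast at h1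
    simp only [marchenkoPasturWeight, arcPoint, ← h1]
    ring
  have hD : 0 < √(a * b) := sqrt_pos.2 (mul_pos ha (ha.trans hab))
  have e3 := integral_sin_succ_mul_sin_div (abs_half_sub_lt ha hab) hD (sq_sqrt_mul_eq ha hab) k
  set J := ∫ θ in (0 : ℝ)..π, cos ((k + 1 : ℝ) * θ) / ((a + b) / 2 + (b - a) / 2 * cos θ)
  rw [e1, e2, show s / (2 * π * √(a * b)) * ((b - a) / 2) ^ 2 =
    s / (2 * π * √(a * b)) * ((b - a) / 2) * ((b - a) / 2) by ring, mul_assoc _ ((b - a) / 2), e3]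
  generalize √(a * b) = D at hD ⊢
  field_simp
  ring

lemma exists_finset_sum_chebyshev_U (P : ℝ[X]) : ∃ (S : Finset ℕ) (h : ℕ → ℝ),
    ∀ t, P.eval t = ∑ k ∈ S, h k * (Chebyshev.U ℝ k).eval t := by
  obtain ⟨c, hc⟩ := Finsupp.mem_span_range_iff_exists_finsupp.1 (mem_span_chebyshev_U P)
  refine ⟨c.support, c, fun t => ?_⟩
  rw [← hc, Finsupp.sum, eval_finsetSum]
  simp [smul_eq_mul]

/-- The excess of the equilibrium measure over the Marchenko–Pastur type law, tested on a
polynomial. -/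
lemma exists_integral_polynomial_eq_add (hQ : ConvexOn ℝ (Ici 0) Q) (hs0 : 0 < s)
    (hμ : IsEquilibriumMeasure (fun x => Q x - s * log x) μ) (hs : μ.support = Icc a b)
    (p : ℝ[X]) : ∃ (S : Finset ℕ) (h : ℕ → ℝ),
    (∀ θ, p.eval (arcPoint a b θ) = ∑ k ∈ S, h k * (Chebyshev.U ℝ k).eval (cos θ)) ∧
    ∫ y, p.eval y ∂μ =
      (∫ θ in (0 : ℝ)..π, p.eval (arcPoint a b θ) * marchenkoPasturWeight s a b θ) +
      (b - a) / (4 * π) * ∫ θ in (0 : ℝ)..π,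
        derivWithin Q (Ioi (arcPoint a b θ)) (arcPoint a b θ) *
          ∑ k ∈ S, h k * cos ((k + 1 : ℝ) * θ) := by
  have hV := hQ.continuousOn_sub_mul_log s
  have hμp : IsProbabilityMeasure μ := hμ.1.1
  have ha := pos_of_support_eq hQ hs0 hμ hs
  have hab := (hμ.nonneg_and_lt hV hs).2
  have hae := ae_mem_of_support_eq hs
  have hq := hQ.intervalIntegrable_rightDeriv_arcPoint ha hab.le
  obtain ⟨P, hP1, hP2⟩ := exists_polynomial_arcCoord hab p
  obtain ⟨S, h, hS⟩ := exists_finset_sum_chebyshev_U P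
  refine ⟨S, h, fun θ => by rw [← hP2, hS], ?_⟩
  have hUi : ∀ k : ℕ, Integrable (fun y => (Chebyshev.U ℝ k).eval (arcCoord a b y)) μ := by
    intro k
    refine integrable_of_continuousOn_Icc hae (Continuous.continuousOn ?_)
    unfold arcCoord
    exact (Chebyshev.U ℝ k).continuous.comp (by fun_prop)
  have hw := continuous_marchenkoPasturWeight (s := s) ha hab.le
  have e1 : ∫ y, p.eval y ∂μ = ∑ k ∈ S, h k * ∫ y, (Chebyshev.U ℝ k).eval (arcCoord a b y) ∂μ := by
    simp_rw [← hP1, hS]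
    rw [integral_finsetSum _ fun k _ => (hUi k).const_mul _]
    simp_rw [MeasureTheory.integral_const_mul]
  have hUc : ∀ k : ℕ, Continuous fun θ =>
      (Chebyshev.U ℝ k).eval (cos θ) * marchenkoPasturWeight s a b θ := fun k =>
    ((Chebyshev.U ℝ k).continuous.comp continuous_cos).mul hw
  have e2 : (∫ θ in (0 : ℝ)..π, p.eval (arcPoint a b θ) * marchenkoPasturWeight s a b θ) =
      ∑ k ∈ S, h k * ∫ θ in (0 : ℝ)..π,
        (Chebyshev.U ℝ k).eval (cos θ) * marchenkoPasturWeight s a b θ := by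
    simp_rw [← hP2, hS, Finset.sum_mul, mul_assoc]
    rw [intervalIntegral.integral_finsetSum fun k _ =>
      ((hUc k).intervalIntegrable _ _).const_mul _]
    simp_rw [intervalIntegral.integral_const_mul]
  have e3 : (∫ θ in (0 : ℝ)..π, derivWithin Q (Ioi (arcPoint a b θ)) (arcPoint a b θ) *
      ∑ k ∈ S, h k * cos ((k + 1 : ℝ) * θ)) = ∑ k ∈ S, h k * ∫ θ in (0 : ℝ)..π,
        derivWithin Q (Ioi (arcPoint a b θ)) (arcPoint a b θ) * cos ((k + 1 : ℝ) * θ) := by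
    simp_rw [Finset.mul_sum, mul_left_comm _ (h _)]
    rw [intervalIntegral.integral_finsetSum fun k _ => (hq.mul_continuousOn
      (Continuous.continuousOn (by fun_prop))).const_mul _]
    simp_rw [intervalIntegral.integral_const_mul]
  rw [e1, e2, e3, Finset.mul_sum, ← Finset.sum_add_distrib]
  refine Finset.sum_congr rfl fun k _ => ?_
  rw [integral_chebyshev_U_eq_add hQ hs0 hμ hs k]
  ring

/-- Convexity of `Q` makes the equilibrium measure dominate the Marchenko–Pastur type law. -/
lemma integral_marchenkoPasturWeight_le (hQ : ConvexOn ℝ (Ici 0) Q) (hs0 : 0 < s)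
    (hμ : IsEquilibriumMeasure (fun x => Q x - s * log x) μ) (hs : μ.support = Icc a b)
    {g : ℝ → ℝ} (hg : ContinuousOn g (Icc a b)) (hg0 : ∀ x ∈ Icc a b, 0 ≤ g x) :
    ∫ θ in (0 : ℝ)..π, g (arcPoint a b θ) * marchenkoPasturWeight s a b θ ≤ ∫ x, g x ∂μ := by
  have hμp : IsProbabilityMeasure μ := hμ.1.1
  have ha := pos_of_support_eq hQ hs0 hμ hs
  have hab := (hμ.nonneg_and_lt (hQ.continuousOn_sub_mul_log s) hs).2
  refine integral_arcPoint_mul_le_of_polynomial hab.le (ae_mem_of_support_eq hs)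
    (continuous_marchenkoPasturWeight ha hab.le)
    (marchenkoPasturWeight_nonneg hs0.le ha hab.le) (fun p hp => ?_) hg hg0
  obtain ⟨S, h, hS, heq⟩ := exists_integral_polynomial_eq_add hQ hs0 hμ hs p
  rw [heq]
  have hk : ∀ k : ℕ, (k + 1 : ℝ) ≠ 0 := fun k => by positivity
  refine le_add_of_nonneg_right (mul_nonneg
    (div_nonneg (sub_pos.2 hab).le (by positivity)) ?_)
  refine integral_antitone_mul_deriv_nonneg pi_pos.le
    (f := fun η => ∑ k ∈ S, h k * (sin ((k + 1 : ℝ) * η) / (k + 1)))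
    (hQ.antitoneOn_rightDeriv_arcPoint ha hab.le) (fun η => ?_) (by fun_prop) (by simp) ?_
    fun η hη => sum_sin_div_nonneg_of_sum_U_nonneg S h (fun θ _ => ?_) hη
  · refine HasDerivAt.fun_sum fun k _ => ?_
    have h1 : HasDerivAt (fun η : ℝ => sin ((k + 1 : ℝ) * η)) (cos ((k + 1 : ℝ) * η) * (k + 1)) η := by
      simpa using ((hasDerivAt_id η).const_mul (k + 1 : ℝ)).sin
    refine ((h1.div_const (k + 1 : ℝ)).const_mul (h k)).congr_deriv ?_
    rw [mul_div_cancel_right₀ _ (hk k)]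
  · refine Finset.sum_eq_zero fun k _ => ?_
    have := sin_nat_mul_pi (k + 1)
    push_cast at this
    rw [this]; simp
  · rw [← hS]
    exact hp _ (arcPoint_mem_Icc hab.le θ)

lemma integral_eq_marchenkoPasturWeight (hQ : ConvexOn ℝ (Ici 0) Q) (hs0 : 0 < s)
    (hμ : IsEquilibriumMeasure (fun x => Q x - s * log x) μ) (hs : μ.support = Icc a b)
    {r t : ℝ} (hQrt : ∀ x ∈ Ici (0 : ℝ), Q x = r * x + t)
    {g : ℝ → ℝ} (hg : ContinuousOn g (Icc a b)) :
    ∫ x, g x ∂μ = ∫ θ in (0 : ℝ)..π, g (arcPoint a b θ) * marchenkoPasturWeight s a b θ := by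
  have hμp : IsProbabilityMeasure μ := hμ.1.1
  have ha := pos_of_support_eq hQ hs0 hμ hs
  have hab := (hμ.nonneg_and_lt (hQ.continuousOn_sub_mul_log s) hs).2
  refine integral_eq_arcPoint_mul_of_polynomial hab.le (ae_mem_of_support_eq hs)
    (continuous_marchenkoPasturWeight ha hab.le)
    (marchenkoPasturWeight_nonneg hs0.le ha hab.le) (fun p => ?_) hg
  obtain ⟨S, h, hS, heq⟩ := exists_integral_polynomial_eq_add hQ hs0 hμ hs p
  rw [heq]
  have hder : ∀ x, 0 < x → derivWithin Q (Ioi x) x = r := by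
    intro x hx
    have h1 : HasDerivAt (fun x => r * x + t) r x := by
      simpa using ((hasDerivAt_id x).const_mul r).add_const t
    have h2 : HasDerivAt Q r x := h1.congr_of_eventuallyEq
      (by filter_upwards [Ioi_mem_nhds hx] with y hy using hQrt y (mem_Ici.2 (le_of_lt hy)))
    exact h2.hasDerivWithinAt.derivWithin (uniqueDiffWithinAt_Ioi x)
  have h0 : ∀ k : ℕ, ∫ θ in (0 : ℝ)..π, cos ((k + 1 : ℝ) * θ) = 0 := by
    intro k
    have := integral_cos_int_mul (k + 1)
    rw [if_neg (by omega)] at this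
    push_cast at this
    exact this
  simp_rw [hder _ (arcPoint_pos ha hab.le _)]
  rw [intervalIntegral.integral_const_mul, intervalIntegral.integral_finsetSum
    fun k _ => Continuous.intervalIntegrable (by fun_prop) _ _]
  simp_rw [intervalIntegral.integral_const_mul, h0]
  simp

end comparison

section laguerre
variable {r : ℝ} {μ : Measure ℝ} {a b : ℝ}

lemma integral_mul_arcPoint (r a b : ℝ) :
    ∫ θ in (0 : ℝ)..π, r * arcPoint a b θ = π * r * (a + b) / 2 := by
  have h : ∫ θ in (0 : ℝ)..π, arcPoint a b θ = π * ((a + b) / 2) := by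
    unfold arcPoint
    rw [intervalIntegral.integral_add intervalIntegrable_const
      (Continuous.intervalIntegrable (by fun_prop) _ _)]
    simp
    ring
  rw [intervalIntegral.integral_const_mul, h]; ring

/-- For a linear field the equilibrium measure starts at the hard edge `0`, and its length minimizes
the Mhaskar–Saff functional. -/
lemma support_eq_of_linear (hr : 0 < r) (hμ : IsEquilibriumMeasure (fun x => r * x) μ)
    (hs : μ.support = Icc a b) : a = 0 ∧ b = 4 / r := by
  have hV : ContinuousOn (fun x => r * x) (Ioi 0) := by fun_prop
  obtain ⟨ha, hab⟩ := hμ.nonneg_and_lt hV hs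
  have hi : ∀ α β, IntervalIntegrable (fun θ => r * arcPoint α β θ) volume 0 π := fun α β =>
    (continuous_const.mul (continuous_arcPoint α β)).intervalIntegrable _ _
  have h1 := mhaskarSaff_le hμ hV hs (hi a b) le_rfl (sub_pos.2 hab) (hi _ _)
  rw [integral_mul_arcPoint, integral_mul_arcPoint, sub_zero] at h1
  have hπr : 0 < π * r := by positivity
  have ha0 : a = 0 := by
    refine le_antisymm ?_ ha
    by_contra hcon
    have := mul_pos hπr (not_le.1 hcon)
    linarith
  subst ha0
  refine ⟨rfl, ?_⟩
  have h2 := mhaskarSaff_le hμ hV hs (hi _ b) le_rfl (by positivity : 0 < 4 / r) (hi _ _)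
  rw [integral_mul_arcPoint, integral_mul_arcPoint, sub_zero, sub_zero] at h2
  have h3 : log (b / 4) = log (r * b / 4) - log r := by
    rw [← log_div (by positivity) hr.ne']; congr 1; field_simp
  have h4 : log (4 / r / 4) = -log r := by
    rw [← log_inv]; congr 1; field_simp
  rw [h3, h4] at h2
  have h5 : r * b / 4 = 1 := by
    by_contra hne
    have h6 := log_lt_sub_one_of_pos (by positivity : 0 < r * b / 4) hne
    have h7 := mul_lt_mul_of_pos_left h6 (by positivity : 0 < 2 * π)
    have h8 : π * r * (0 + 4 / r) / 2 = 2 * π := by field_simp; norm_num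
    rw [h8] at h2
    linarith
  field_simp
  linarith

lemma integral_eq_of_linear (hr : 0 < r) (hμ : IsEquilibriumMeasure (fun x => r * x) μ)
    (hs : μ.support = Icc a b) {g : ℝ → ℝ} (hg : ContinuousOn g (Icc a b)) :
    ∫ x, g x ∂μ = ∫ θ in (0 : ℝ)..π, g (arcPoint a b θ) * ((1 - cos θ) / π) := by
  have hμp : IsProbabilityMeasure μ := hμ.1.1
  have hV : ContinuousOn (fun x => r * x) (Ioi 0) := by fun_prop
  have hae := ae_mem_of_support_eq hs
  obtain ⟨ha, hab⟩ := hμ.nonneg_and_lt hV hs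
  refine integral_eq_arcPoint_mul_of_polynomial hab.le hae (by fun_prop)
    (fun θ => div_nonneg (sub_nonneg.2 (cos_le_one θ)) pi_pos.le) (fun p => ?_) hg
  obtain ⟨P, hP1, hP2⟩ := exists_polynomial_arcCoord hab p
  obtain ⟨c, hc⟩ := Finsupp.mem_span_range_iff_exists_finsupp.1 (mem_span_chebyshev_T P)
  have hPe : ∀ t, P.eval t = ∑ k ∈ c.support, c k * (Chebyshev.T ℝ k).eval t := by
    intro t
    rw [← hc, Finsupp.sum, eval_finsetSum]
    simp [smul_eq_mul]
  have hTi : ∀ k : ℕ, Integrable (fun y => (Chebyshev.T ℝ k).eval (arcCoord a b y)) μ := by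
    intro k
    refine integrable_of_continuousOn_Icc hae (Continuous.continuousOn ?_)
    unfold arcCoord
    exact (Chebyshev.T ℝ k).continuous.comp (by fun_prop)
  have hTc : ∀ k : ℕ, Continuous fun θ =>
      (Chebyshev.T ℝ k).eval (cos θ) * ((1 - cos θ) / π) := fun k =>
    ((Chebyshev.T ℝ k).continuous.comp continuous_cos).mul (by fun_prop)
  simp_rw [← hP2, ← hP1, hPe, Finset.sum_mul, mul_assoc]
  rw [integral_finsetSum _ fun k _ => (hTi k).const_mul _,
    intervalIntegral.integral_finsetSum fun k _ =>
      ((hTc k).intervalIntegrable _ _).const_mul _]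
  refine Finset.sum_congr rfl fun k _ => ?_
  rw [intervalIntegral.integral_const_mul, MeasureTheory.integral_const_mul]
  congr 1
  have hcc := integral_cos_mul_cos k 1
  have hc1 := integral_cos_int_mul k
  push_cast at hcc hc1
  simp only [one_mul] at hcc
  have e : ∫ θ in (0 : ℝ)..π, (Chebyshev.T ℝ k).eval (cos θ) * ((1 - cos θ) / π) =
      ((∫ θ in (0 : ℝ)..π, cos (k * θ)) - ∫ θ in (0 : ℝ)..π, cos (k * θ) * cos θ) / π := by
    rw [← intervalIntegral.integral_sub (Continuous.intervalIntegrable (by fun_prop) _ _)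
      (Continuous.intervalIntegrable (by fun_prop) _ _), ← intervalIntegral.integral_div]
    refine intervalIntegral.integral_congr fun θ _ => ?_
    have := Chebyshev.T_real_cos θ k
    push_cast at this
    simp only [this]
    ring
  rw [e, hcc, hc1]
  rcases eq_or_ne k 0 with rfl | hk
  · simp [pi_ne_zero]
  · rw [integral_chebyshev_T hμ hV hs
      ((continuous_const.mul (continuous_arcPoint a b)).intervalIntegrable _ _) hk]
    obtain ⟨ha0, hb⟩ := support_eq_of_linear hr hμ hs
    have e2 : ∫ θ in (0 : ℝ)..π, cos (k * θ) * (r * arcPoint a b θ) =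
        r * ((a + b) / 2) * (∫ θ in (0 : ℝ)..π, cos (k * θ)) +
        r * ((b - a) / 2) * ∫ θ in (0 : ℝ)..π, cos (k * θ) * cos θ := by
      rw [← intervalIntegral.integral_const_mul, ← intervalIntegral.integral_const_mul,
        ← intervalIntegral.integral_add (Continuous.intervalIntegrable (by fun_prop) _ _)
        (Continuous.intervalIntegrable (by fun_prop) _ _)]
      refine intervalIntegral.integral_congr fun θ _ => ?_
      simp only [arcPoint]
      ring
    rw [e2, hcc, hc1, ha0, hb]
    by_cases h1 : k = 1
    · subst h1
      simp
      field_simp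
      norm_num
    · simp [hk, h1]

end laguerre

/-! ### Quadratic forms of cosine polynomials -/

section trig
variable {N : ℕ} {e γ : ℕ → ℝ}

lemma sum_range_mul_ite_succ (he : e N = 0) {n : ℕ} (hn : n ∈ Finset.range N) :
    ∑ m ∈ Finset.range N, e m * (if m = n + 1 then π / 4 else 0) = e (n + 1) * (π / 4) := by
  rw [Finset.mem_range] at hn
  simp only [mul_ite, mul_zero, Finset.sum_ite_eq', Finset.mem_range]
  split_ifs with h
  · rfl
  · rw [show n + 1 = N by omega, he, zero_mul]

lemma integral_add_mul_cos_mul_sq_sum_sin (M δ : ℝ) (he : e N = 0) :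
    ∫ θ in (0 : ℝ)..π, (M + δ * cos θ) *
        (∑ n ∈ Finset.range N, e n * sin ((n + 1 : ℝ) * θ)) ^ 2 =
      π / 2 * ∑ n ∈ Finset.range N, (M * e n ^ 2 + δ * (e n * e (n + 1))) := by
  have h1 : ∀ n m : ℕ, ∫ θ in (0 : ℝ)..π, (M + δ * cos θ) *
      (e n * sin ((n + 1 : ℝ) * θ) * (e m * sin ((m + 1 : ℝ) * θ))) =
      e n * e m * (M * (if n = m then π / 2 else 0) +
        δ * ((if m = n + 1 then π / 4 else 0) + (if n = m + 1 then π / 4 else 0))) := by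
    intro n m
    rw [← integral_sin_succ_mul_sin_succ n m, ← integral_cos_mul_sin_succ_mul_sin_succ n m,
      ← intervalIntegral.integral_const_mul, ← intervalIntegral.integral_const_mul,
      ← intervalIntegral.integral_add (Continuous.intervalIntegrable (by fun_prop) _ _)
        (Continuous.intervalIntegrable (by fun_prop) _ _), ← intervalIntegral.integral_const_mul]
    refine intervalIntegral.integral_congr fun θ _ => ?_
    ring
  simp_rw [sq, Finset.sum_mul_sum, Finset.mul_sum]
  rw [intervalIntegral.integral_finsetSum fun n _ => Continuous.intervalIntegrable
    (by fun_prop) _ _]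
  have h2 : ∀ n ∈ Finset.range N, ∫ θ in (0 : ℝ)..π, ∑ m ∈ Finset.range N, (M + δ * cos θ) *
      (e n * sin ((n + 1 : ℝ) * θ) * (e m * sin ((m + 1 : ℝ) * θ))) =
      M * e n ^ 2 * (π / 2) + δ * (e n * e (n + 1)) * (π / 4) +
      δ * ∑ m ∈ Finset.range N, e n * e m * (if n = m + 1 then π / 4 else 0) := by
    intro n hn
    rw [intervalIntegral.integral_finsetSum fun m _ => Continuous.intervalIntegrable
      (by fun_prop) _ _]
    simp_rw [h1, mul_add, Finset.sum_add_distrib]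
    have e1 : ∑ m ∈ Finset.range N, e n * e m * (M * (if n = m then π / 2 else 0)) =
        M * e n ^ 2 * (π / 2) := by
      simp only [mul_ite, mul_zero, Finset.sum_ite_eq, hn, if_true]
      ring
    have e2 : ∑ m ∈ Finset.range N, e n * e m * (δ * (if m = n + 1 then π / 4 else 0)) =
        δ * (e n * e (n + 1)) * (π / 4) := by
      have := sum_range_mul_ite_succ he hn
      calc _ = ∑ m ∈ Finset.range N, δ * e n * (e m * (if m = n + 1 then π / 4 else 0)) :=
            Finset.sum_congr rfl fun m _ => by ring
        _ = _ := by rw [← Finset.mul_sum, this]; ring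
    rw [e1, e2, add_assoc, Finset.mul_sum]
    congr 2
    refine Finset.sum_congr rfl fun m _ => ?_
    ring
  rw [Finset.sum_congr rfl h2]
  simp_rw [Finset.sum_add_distrib]
  have e3 : ∑ n ∈ Finset.range N, δ * ∑ m ∈ Finset.range N,
      e n * e m * (if n = m + 1 then π / 4 else 0) =
      ∑ n ∈ Finset.range N, δ * (e n * e (n + 1)) * (π / 4) := by
    rw [← Finset.mul_sum, Finset.sum_comm, Finset.mul_sum]
    refine Finset.sum_congr rfl fun m hm => ?_
    have := sum_range_mul_ite_succ he hm
    calc _ = δ * (e m * ∑ n ∈ Finset.range N, e n * (if n = m + 1 then π / 4 else 0)) := by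
          simp_rw [Finset.mul_sum]
          exact Finset.sum_congr rfl fun n _ => by ring
      _ = _ := by rw [this]; ring
  rw [e3, ← Finset.sum_add_distrib, ← Finset.sum_add_distrib]
  refine Finset.sum_congr rfl fun n _ => ?_
  ring

lemma integral_sq_sum_sin (he : e N = 0) :
    ∫ θ in (0 : ℝ)..π, (∑ n ∈ Finset.range N, e n * sin ((n + 1 : ℝ) * θ)) ^ 2 =
      π / 2 * ∑ n ∈ Finset.range N, e n ^ 2 := by
  simpa using integral_add_mul_cos_mul_sq_sum_sin 1 0 he

lemma integral_sq_sum_cos (γ : ℕ → ℝ) (N : ℕ) :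
    ∫ θ in (0 : ℝ)..π, (∑ n ∈ Finset.range N, γ n * cos ((n + 1 : ℝ) * θ)) ^ 2 =
      π / 2 * ∑ n ∈ Finset.range N, γ n ^ 2 := by
  simp_rw [sq, Finset.sum_mul_sum]
  rw [intervalIntegral.integral_finsetSum fun n _ => Continuous.intervalIntegrable
    (by fun_prop) _ _, Finset.mul_sum]
  refine Finset.sum_congr rfl fun n hn => ?_
  rw [intervalIntegral.integral_finsetSum fun m _ => Continuous.intervalIntegrable
    (by fun_prop) _ _]
  have h1 : ∀ m : ℕ, ∫ θ in (0 : ℝ)..π, γ n * cos ((n + 1 : ℝ) * θ) * (γ m * cos ((m + 1 : ℝ) * θ)) =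
      γ n * γ m * (if n = m then π / 2 else 0) := by
    intro m
    rw [← integral_cos_succ_mul_cos_succ n m, ← intervalIntegral.integral_const_mul]
    refine intervalIntegral.integral_congr fun θ _ => ?_
    ring
  simp_rw [h1]
  simp only [mul_ite, mul_zero, Finset.sum_ite_eq, hn, if_true]
  ring

lemma integral_sum_cos (c : ℝ) (γ : ℕ → ℝ) (N : ℕ) :
    ∫ θ in (0 : ℝ)..π, (c + ∑ n ∈ Finset.range N, γ n * cos ((n + 1 : ℝ) * θ)) = π * c := by
  have h0 : ∀ k : ℕ, ∫ θ in (0 : ℝ)..π, cos ((k + 1 : ℝ) * θ) = 0 := by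
    intro k
    have := integral_cos_int_mul (k + 1)
    rw [if_neg (by omega)] at this
    push_cast at this
    exact this
  rw [intervalIntegral.integral_add intervalIntegrable_const
    (Continuous.intervalIntegrable (by fun_prop) _ _),
    intervalIntegral.integral_finsetSum fun n _ => Continuous.intervalIntegrable
    (by fun_prop) _ _]
  simp_rw [intervalIntegral.integral_const_mul, h0]
  simp

/-- The sum of squares behind the Poincaré inequality, with its boundary term. -/
lemma sum_quadratic_form_eq {M D δ α β : ℝ} (hα : α ^ 2 = M - D) (hβ : β ^ 2 = M + D)
    (hαβ : α * β = δ) (γ : ℕ → ℝ) (N : ℕ) :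
    ∑ n ∈ Finset.range N, (M * ((n + 1 : ℝ) * γ n) ^ 2 +
        δ * ((n + 1 : ℝ) * γ n * ((n + 2 : ℝ) * γ (n + 1)))) =
      D * ∑ n ∈ Finset.range N, (n + 1 : ℝ) * γ n ^ 2 +
      ∑ n ∈ Finset.range N, (n + 1 : ℝ) * (n + 2) / 2 * (α * γ n + β * γ (n + 1)) ^ 2 -
      N * (N + 1 : ℝ) / 2 * (β * γ N) ^ 2 := by
  induction N with
  | zero => simp
  | succ N ih =>
    rw [Finset.sum_range_succ, Finset.sum_range_succ, Finset.sum_range_succ, ih]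
    push_cast
    linear_combination (-((N + 1 : ℝ) * (N + 2)) / 2 * γ N ^ 2) * hα +
      (-(N * (N + 1 : ℝ)) / 2 * γ N ^ 2) * hβ
      - ((N + 1 : ℝ) * (N + 2) * γ N * γ (N + 1)) * hαβ

lemma mul_sum_le_sum_quadratic_form {M D δ : ℝ} (hD : 0 ≤ D) (hδ : 0 ≤ δ) (hDM : D ≤ M)
    (hDδ : D ^ 2 = M ^ 2 - δ ^ 2) (hγ : γ N = 0) :
    D * ∑ n ∈ Finset.range N, (n + 1 : ℝ) * γ n ^ 2 ≤
      ∑ n ∈ Finset.range N, (M * ((n + 1 : ℝ) * γ n) ^ 2 +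
        δ * ((n + 1 : ℝ) * γ n * ((n + 2 : ℝ) * γ (n + 1)))) := by
  have hαβ : √(M - D) * √(M + D) = δ := by
    rw [← sqrt_mul (sub_nonneg.2 hDM), ← sqrt_sq hδ]; congr 1; linarith
  rw [sum_quadratic_form_eq (sq_sqrt (sub_nonneg.2 hDM)) (sq_sqrt (by linarith)) hαβ, hγ]
  have : 0 ≤ ∑ n ∈ Finset.range N, (n + 1 : ℝ) * (n + 2) / 2 *
      (√(M - D) * γ n + √(M + D) * γ (n + 1)) ^ 2 := Finset.sum_nonneg fun n _ => by positivity
  simp only [mul_zero, ne_eq, OfNat.ofNat_ne_zero, not_false_eq_true, zero_pow, sub_zero]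
  linarith

/-- If `D < M`, the constant `D` can be improved when the weights `n + 1` are dropped: only
the first coefficient has weight one, and it is controlled by the second one and the first
square. -/
lemma exists_mul_sum_sq_le_sum_quadratic_form {M D δ : ℝ} (hD : 0 < D) (hδ : 0 ≤ δ) (hDM : D < M)
    (hDδ : D ^ 2 = M ^ 2 - δ ^ 2) : ∃ κ > 0, ∀ (N : ℕ) (γ : ℕ → ℝ), γ N = 0 →
    (D + κ) * ∑ n ∈ Finset.range N, γ n ^ 2 ≤
      ∑ n ∈ Finset.range N, (M * ((n + 1 : ℝ) * γ n) ^ 2 +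
        δ * ((n + 1 : ℝ) * γ n * ((n + 2 : ℝ) * γ (n + 1)))) := by
  have hMD : 0 < M - D := sub_pos.2 hDM
  have hMD' : 0 < M + D := by linarith
  refine ⟨D * (M - D) / (4 * (M + D)), by positivity, fun N γ hγ => ?_⟩
  set κ := D * (M - D) / (4 * (M + D)) with hκ
  have hκ0 : 0 < κ := by positivity
  have hαβ : √(M - D) * √(M + D) = δ := by
    rw [← sqrt_mul (sub_nonneg.2 hDM.le), ← sqrt_sq hδ]; congr 1; linarith
  have hα := sq_sqrt hMD.le
  have hβ := sq_sqrt (by linarith : 0 ≤ M + D)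
  rw [sum_quadratic_form_eq hα hβ hαβ, hγ]
  generalize √(M - D) = α at *
  generalize √(M + D) = β at *
  simp only [mul_zero, ne_eq, OfNat.ofNat_ne_zero, not_false_eq_true, zero_pow, sub_zero]
  cases N with
  | zero => simp
  | succ N =>
    have hκ1 : κ * (4 * (M + D)) = D * (M - D) := div_mul_cancel₀ _ (by linarith)
    have hκ2 : κ ≤ D / 4 := by
      rw [hκ, div_le_div_iff₀ (by linarith) (by norm_num)]; nlinarith
    have hκ3 : κ ≤ (M - D) / 4 := by
      rw [hκ, div_le_div_iff₀ (by linarith) (by norm_num)]; nlinarith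
    -- the first coefficient
    have h0 : κ * γ 0 ^ 2 ≤ (α * γ 0 + β * γ 1) ^ 2 + D / 2 * γ 1 ^ 2 := by
      have h1 : α ^ 2 * γ 0 ^ 2 ≤ 2 * (α * γ 0 + β * γ 1) ^ 2 + 2 * β ^ 2 * γ 1 ^ 2 := by
        nlinarith [sq_nonneg (α * γ 0 + 2 * β * γ 1)]
      rw [hα, hβ] at h1
      have h2 : (M - D) * (κ * γ 0 ^ 2) ≤
          (M - D) * ((α * γ 0 + β * γ 1) ^ 2 + D / 2 * γ 1 ^ 2) := by
        have h3 := mul_le_mul_of_nonneg_left h1 hκ0.le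
        have h4 : κ * (2 * (α * γ 0 + β * γ 1) ^ 2) ≤ (M - D) * (α * γ 0 + β * γ 1) ^ 2 := by
          nlinarith [sq_nonneg (α * γ 0 + β * γ 1)]
        have h5 : κ * (2 * (M + D) * γ 1 ^ 2) = (M - D) * (D / 2 * γ 1 ^ 2) := by
          linear_combination (γ 1 ^ 2 / 2) * hκ1
        linarith
      exact le_of_mul_le_mul_left h2 hMD
    have hS : (α * γ 0 + β * γ 1) ^ 2 ≤ ∑ n ∈ Finset.range (N + 1),
        (n + 1 : ℝ) * (n + 2) / 2 * (α * γ n + β * γ (n + 1)) ^ 2 := by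
      rw [Finset.sum_range_succ']
      have : 0 ≤ ∑ n ∈ Finset.range N, (((n + 1 : ℕ) : ℝ) + 1) * (((n + 1 : ℕ) : ℝ) + 2) / 2 *
          (α * γ (n + 1) + β * γ (n + 1 + 1)) ^ 2 := Finset.sum_nonneg fun n _ => by positivity
      simp only [CharP.cast_eq_zero, zero_add, one_mul]
      linarith
    have hT : 2 * ∑ n ∈ Finset.range N, γ (n + 1) ^ 2 + γ 0 ^ 2 ≤
        ∑ n ∈ Finset.range (N + 1), (n + 1 : ℝ) * γ n ^ 2 := by
      rw [Finset.sum_range_succ', Finset.mul_sum]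
      simp only [CharP.cast_eq_zero, zero_add, one_mul]
      gcongr with n hn
      push_cast
      linarith [(Nat.cast_nonneg n : (0 : ℝ) ≤ n)]
    have hU : γ 1 ^ 2 ≤ ∑ n ∈ Finset.range N, γ (n + 1) ^ 2 := by
      cases N with
      | zero => simp_all
      | succ N =>
        rw [Finset.sum_range_succ']
        have : 0 ≤ ∑ n ∈ Finset.range N, γ (n + 1 + 1) ^ 2 :=
          Finset.sum_nonneg fun n _ => by positivity
        simpa using this
    have hT' := mul_le_mul_of_nonneg_left hT hD.le
    rw [Finset.sum_range_succ' (fun n => γ n ^ 2)]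
    set R := ∑ n ∈ Finset.range N, γ (n + 1) ^ 2
    have hR : 0 ≤ R := Finset.sum_nonneg fun n _ => by positivity
    have h6 : κ * R ≤ D / 4 * R := mul_le_mul_of_nonneg_right hκ2 hR
    have h7 : D / 2 * γ 1 ^ 2 ≤ D / 2 * R := mul_le_mul_of_nonneg_left hU (by linarith)
    have h8 : 0 ≤ D * R := mul_nonneg hD.le hR
    linarith

end trig

/-! ### The Douglas formula for the energy -/

section douglas

lemma integral_neg_pi_pi_of_even {f : ℝ → ℝ} (hf : IntervalIntegrable f volume (-π) π)
    (he : ∀ x, f (-x) = f x) :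
    ∫ x in -π..π, f x = 2 * ∫ x in (0 : ℝ)..π, f x := by
  have h1 : IntervalIntegrable f volume (-π) 0 := hf.mono_set (by
    rw [uIcc_of_le (by linarith [pi_pos]), uIcc_of_le (by linarith [pi_pos])]
    exact Icc_subset_Icc_right pi_pos.le)
  have h2 : IntervalIntegrable f volume 0 π := hf.mono_set (by
    rw [uIcc_of_le (by linarith [pi_pos]), uIcc_of_le (by linarith [pi_pos])]
    exact Icc_subset_Icc_left (by linarith [pi_pos]))
  have h3 : ∫ x in -π..0, f x = ∫ x in (0 : ℝ)..π, f x := by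
    have := intervalIntegral.integral_comp_neg (a := 0) (b := π) f
    rw [neg_zero] at this
    rw [← this]
    exact intervalIntegral.integral_congr fun x _ => he x
  rw [← intervalIntegral.integral_add_adjacent_intervals h1 h2, h3]; ring

variable {F : ℝ → ℝ}

/-- The integrand of the energy in the angular variables, up to the differential. -/
noncomputable def angularKernel (F : ℝ → ℝ) (θ η : ℝ) : ℝ :=
  ((F θ - F η) / (cos θ - cos η)) ^ 2 * (1 - cos θ * cos η)

lemma angularKernel_eq (F : ℝ → ℝ) {θ η : ℝ} (h : cos θ - cos η ≠ 0) :
    angularKernel F θ η = 1 / 4 * (((F η - F θ) / sin ((η - θ) / 2)) ^ 2 +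
      ((F η - F θ) / sin ((-η - θ) / 2)) ^ 2) := by
  have h1 : cos θ - cos η = 2 * sin ((η - θ) / 2) * -sin ((-η - θ) / 2) := by
    rw [cos_sub_cos, show (-η - θ) / 2 = -((θ + η) / 2) by ring, sin_neg,
      show (η - θ) / 2 = -((θ - η) / 2) by ring, sin_neg]
    ring
  have h2 : 1 - cos θ * cos η = sin ((η - θ) / 2) ^ 2 + sin ((-η - θ) / 2) ^ 2 := by
    rw [sin_sq_eq_half_sub, sin_sq_eq_half_sub, show 2 * ((η - θ) / 2) = η - θ by ring,
      show 2 * ((-η - θ) / 2) = -(η + θ) by ring, cos_neg, cos_add, cos_sub]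
    ring
  unfold angularKernel
  rw [h1] at h ⊢
  rw [h2]
  have h3 : sin ((η - θ) / 2) ≠ 0 := fun h0 => h (by rw [h0]; ring)
  have h4 : sin ((-η - θ) / 2) ≠ 0 := fun h0 => h (by rw [h0]; ring)
  field_simp
  ring

/-- Folding the energy onto the circle: for an even periodic function the inner integral becomes
a translation invariant one. -/
lemma integral_angularKernel_eq (hF : Continuous F) (heven : ∀ θ, F (-θ) = F θ)
    (hper : Function.Periodic F (2 * π)) {L : ℝ}
    (hL : ∀ θ η, |F η - F θ| ≤ L * |sin ((η - θ) / 2)|) (θ : ℝ) :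
    ∫ η in (0 : ℝ)..π, angularKernel F θ η =
      1 / 4 * ∫ t in -π..π, ((F (θ + t) - F θ) / sin (t / 2)) ^ 2 := by
  set g : ℝ → ℝ := fun u => ((F u - F θ) / sin ((u - θ) / 2)) ^ 2 with hg
  have hgm : Measurable g := by
    have := hF.measurable
    fun_prop
  have hgb : ∀ u, ‖g u‖ ≤ L ^ 2 := by
    intro u
    rw [hg, norm_of_nonneg (sq_nonneg _), ← sq_abs, abs_div]
    have hL0 : 0 ≤ L := by
      have := hL 0 π
      rw [sub_zero, sin_pi_div_two, abs_one, mul_one] at this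
      exact (abs_nonneg _).trans this
    exact pow_le_pow_left₀ (by positivity) (div_le_of_le_mul₀ (abs_nonneg _) hL0 (hL θ u)) 2
  have hgi : ∀ x y, IntervalIntegrable g volume x y := fun x y =>
    (intervalIntegrable_const (c := L ^ 2)).mono_fun' hgm.aestronglyMeasurable
      (Eventually.of_forall hgb)
  have hgp : Function.Periodic g (2 * π) := by
    intro u
    simp only [hg]
    rw [hper u, show (u + 2 * π - θ) / 2 = (u - θ) / 2 + π by ring, sin_add_pi, div_neg, neg_sq]
  have h1 : ∫ η in (0 : ℝ)..π, angularKernel F θ η =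
      ∫ η in (0 : ℝ)..π, 1 / 4 * (g η + g (-η)) := by
    refine intervalIntegral.integral_congr_ae ?_
    filter_upwards [ae_cos_ne θ] with η hη _
    rw [angularKernel_eq F hη, hg]
    simp only [heven]
  have hgn : IntervalIntegrable (fun η => g (-η)) volume 0 π :=
    (intervalIntegrable_const (c := L ^ 2)).mono_fun'
      (hgm.comp measurable_neg).aestronglyMeasurable (Eventually.of_forall fun η => hgb (-η))
  rw [h1, intervalIntegral.integral_const_mul, intervalIntegral.integral_add (hgi _ _) hgn,
    intervalIntegral.integral_comp_neg g, neg_zero, add_comm,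
    intervalIntegral.integral_add_adjacent_intervals (hgi _ _) (hgi _ _)]
  congr 1
  have h2 := hgp.intervalIntegral_add_eq (-π) (-π + θ)
  rw [show -π + 2 * π = π by ring, show -π + θ + 2 * π = π + θ by ring] at h2
  rw [h2, ← intervalIntegral.integral_comp_add_right]
  refine intervalIntegral.integral_congr fun t _ => ?_
  simp only [hg]
  rw [add_sub_cancel_right, add_comm t θ]

lemma integral_integral_angularKernel_eq (hF : Continuous F) (heven : ∀ θ, F (-θ) = F θ)
    (hper : Function.Periodic F (2 * π)) {L : ℝ}
    (hL : ∀ θ η, |F η - F θ| ≤ L * |sin ((η - θ) / 2)|) :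
    ∫ θ in (0 : ℝ)..π, ∫ η in (0 : ℝ)..π, angularKernel F θ η =
      1 / 8 * ∫ t in -π..π, (∫ θ in -π..π, (F (θ + t) - F θ) ^ 2) / sin (t / 2) ^ 2 := by
  simp_rw [integral_angularKernel_eq hF heven hper hL]
  rw [intervalIntegral.integral_const_mul]
  set G : ℝ → ℝ → ℝ := fun θ t => ((F (θ + t) - F θ) / sin (t / 2)) ^ 2 with hG
  have hpi : -π ≤ π := by linarith [pi_pos]
  have hGm : Measurable (Function.uncurry G) := by
    have := hF.measurable
    unfold Function.uncurry
    simp only [hG]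
    fun_prop
  have hL0 : 0 ≤ L := by
    have := hL 0 π
    rw [sub_zero, sin_pi_div_two, abs_one, mul_one] at this
    exact (abs_nonneg _).trans this
  have hGb : ∀ z, ‖Function.uncurry G z‖ ≤ L ^ 2 := by
    rintro ⟨θ, t⟩
    simp only [Function.uncurry, hG]
    rw [norm_of_nonneg (sq_nonneg _), ← sq_abs, abs_div]
    have := hL θ (θ + t)
    rw [add_sub_cancel_left] at this
    exact pow_le_pow_left₀ (by positivity) (div_le_of_le_mul₀ (abs_nonneg _) hL0 this) 2
  have hGi : Integrable (Function.uncurry G)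
      ((volume.restrict (Ioc (-π) π)).prod (volume.restrict (Ioc (-π) π))) :=
    Integrable.of_bound hGm.aestronglyMeasurable (L ^ 2) (Eventually.of_forall hGb)
  have h1 : ∫ θ in -π..π, ∫ t in -π..π, G θ t = ∫ t in -π..π, ∫ θ in -π..π, G θ t := by
    simp only [intervalIntegral.integral_of_le hpi]
    exact integral_integral_swap hGi
  have h2 : IntervalIntegrable (fun θ => ∫ t in -π..π, G θ t) volume (-π) π := by
    simp only [intervalIntegral.integral_of_le hpi]
    exact (intervalIntegrable_iff_integrableOn_Ioc_of_le hpi).2 hGi.integral_prod_left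
  have h3 := integral_neg_pi_pi_of_even h2 (fun θ => by
    rw [← neg_neg π, ← intervalIntegral.integral_comp_neg, neg_neg]
    refine intervalIntegral.integral_congr fun t _ => ?_
    simp only [hG]
    rw [show -θ + -t = -(θ + t) by ring, heven, heven, neg_div, sin_neg, div_neg, neg_sq])
  have h4 : ∫ t in -π..π, (∫ θ in -π..π, (F (θ + t) - F θ) ^ 2) / sin (t / 2) ^ 2 =
      ∫ t in -π..π, ∫ θ in -π..π, G θ t := by
    refine intervalIntegral.integral_congr fun t _ => ?_
    simp only [hG, div_pow]
    rw [intervalIntegral.integral_div]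
  rw [h4, ← h1, h3]
  ring

lemma sum_cos_add_sub (γ : ℕ → ℝ) (N : ℕ) (θ t : ℝ) :
    ∑ n ∈ Finset.range N, γ n * cos ((n + 1 : ℝ) * (θ + t)) -
      ∑ n ∈ Finset.range N, γ n * cos ((n + 1 : ℝ) * θ) =
    ∑ n ∈ Finset.range N, (-2 * γ n * sin ((n + 1 : ℝ) * (t / 2))) *
      sin ((n + 1 : ℝ) * (θ + t / 2)) := by
  rw [← Finset.sum_sub_distrib]
  refine Finset.sum_congr rfl fun n _ => ?_
  rw [← mul_sub, cos_sub_cos, show ((n + 1 : ℝ) * (θ + t) + (n + 1) * θ) / 2 =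
    (n + 1) * (θ + t / 2) by ring, show ((n + 1 : ℝ) * (θ + t) - (n + 1) * θ) / 2 =
    (n + 1) * (t / 2) by ring]
  ring

/-- The energy of a cosine polynomial. -/
lemma integral_angularKernel_sum_cos (c : ℝ) {γ : ℕ → ℝ} {N : ℕ} (hγ : γ N = 0) :
    ∫ θ in (0 : ℝ)..π, ∫ η in (0 : ℝ)..π,
        angularKernel (fun θ => c + ∑ n ∈ Finset.range N, γ n * cos ((n + 1 : ℝ) * θ)) θ η =
      π ^ 2 * ∑ n ∈ Finset.range N, (n + 1 : ℝ) * γ n ^ 2 := by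
  set F : ℝ → ℝ := fun θ => c + ∑ n ∈ Finset.range N, γ n * cos ((n + 1 : ℝ) * θ) with hFdef
  have hF : Continuous F := by fun_prop
  have heven : ∀ θ, F (-θ) = F θ := by
    intro θ; simp only [hFdef, mul_neg, cos_neg]
  have hper : Function.Periodic F (2 * π) := by
    intro θ
    simp only [hFdef]
    congr 1
    refine Finset.sum_congr rfl fun n _ => ?_
    have := cos_add_nat_mul_two_pi ((n + 1 : ℝ) * θ) (n + 1)
    push_cast at this
    rw [mul_add, this]
  have hsub : ∀ θ t, F (θ + t) - F θ = ∑ n ∈ Finset.range N,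
      (-2 * γ n * sin ((n + 1 : ℝ) * (t / 2))) * sin ((n + 1 : ℝ) * (θ + t / 2)) := by
    intro θ t
    rw [← sum_cos_add_sub]
    simp only [hFdef]
    ring
  have hL : ∀ θ η, |F η - F θ| ≤
      (∑ n ∈ Finset.range N, 2 * |γ n| * (n + 1 : ℝ)) * |sin ((η - θ) / 2)| := by
    intro θ η
    have h := hsub θ (η - θ)
    rw [add_sub_cancel] at h
    rw [h, Finset.sum_mul]
    refine (Finset.abs_sum_le_sum_abs _ _).trans (Finset.sum_le_sum fun n _ => ?_)
    have h1 := abs_sin_nat_mul_le (n + 1) ((η - θ) / 2)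
    push_cast at h1
    rw [abs_mul, abs_mul, abs_mul, abs_neg, abs_two, mul_assoc (2 * |γ n|) _ |sin ((η - θ) / 2)|]
    refine (mul_le_of_le_one_right (by positivity) (abs_sin_le_one _)).trans ?_
    exact mul_le_mul_of_nonneg_left h1 (by positivity)
  rw [integral_integral_angularKernel_eq hF heven hper hL]
  have hin : ∀ t, ∫ θ in -π..π, (F (θ + t) - F θ) ^ 2 =
      ∑ n ∈ Finset.range N, 4 * π * γ n ^ 2 * sin ((n + 1 : ℝ) * (t / 2)) ^ 2 := by
    intro t
    set e : ℕ → ℝ := fun n => -2 * γ n * sin ((n + 1 : ℝ) * (t / 2)) with he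
    have heN : e N = 0 := by simp [he, hγ]
    set f : ℝ → ℝ := fun θ => (∑ n ∈ Finset.range N, e n * sin ((n + 1 : ℝ) * θ)) ^ 2 with hf
    have hfc : Continuous f := by fun_prop
    have hfp : Function.Periodic f (2 * π) := by
      intro θ
      simp only [hf]
      congr 1
      refine Finset.sum_congr rfl fun n _ => ?_
      have := sin_add_nat_mul_two_pi ((n + 1 : ℝ) * θ) (n + 1)
      push_cast at this
      rw [mul_add, this]
    have h1 : ∫ θ in -π..π, (F (θ + t) - F θ) ^ 2 = ∫ θ in -π..π, f (θ + t / 2) := by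
      refine intervalIntegral.integral_congr fun θ _ => ?_
      simp only [hsub, hf, he]
    have h2 := hfp.intervalIntegral_add_eq (-π) (-π + t / 2)
    rw [show -π + 2 * π = π by ring, show -π + t / 2 + 2 * π = π + t / 2 by ring] at h2
    rw [h1, intervalIntegral.integral_comp_add_right, ← h2,
      integral_neg_pi_pi_of_even (hfc.intervalIntegrable _ _) (fun θ => by
        simp only [hf, mul_neg, sin_neg, Finset.sum_neg_distrib, neg_sq]),
      integral_sq_sum_sin heN, Finset.mul_sum, Finset.mul_sum]
    refine Finset.sum_congr rfl fun n _ => ?_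
    simp only [he]
    ring
  have hfin : ∫ t in -π..π, (∫ θ in -π..π, (F (θ + t) - F θ) ^ 2) / sin (t / 2) ^ 2 =
      ∑ n ∈ Finset.range N, 4 * π * γ n ^ 2 * (2 * π * (n + 1)) := by
    simp_rw [hin, Finset.sum_div, mul_div_assoc]
    have hfi : ∀ n : ℕ, IntervalIntegrable
        (fun t => sin ((n + 1 : ℝ) * (t / 2)) ^ 2 / sin (t / 2) ^ 2) volume (-π) π := fun n => by
      have := intervalIntegrable_fejer (n + 1) (-π) π
      push_cast at this
      exact this
    rw [intervalIntegral.integral_finsetSum fun n _ => (hfi n).const_mul _]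
    refine Finset.sum_congr rfl fun n _ => ?_
    have := integral_fejer_kernel (n + 1)
    push_cast at this
    rw [intervalIntegral.integral_const_mul, this]
  rw [hfin, Finset.mul_sum, Finset.mul_sum]
  refine Finset.sum_congr rfl fun n _ => ?_
  ring

end douglas

/-! ### Angular variables -/

section angular
variable {a b : ℝ}

lemma sqrt_arcPoint_sub_mul (hab : a ≤ b) {θ : ℝ} (hθ : θ ∈ Icc 0 π) :
    √((arcPoint a b θ - a) * (b - arcPoint a b θ)) = (b - a) / 2 * sin θ := by
  rw [← sqrt_sq (mul_nonneg (by linarith : 0 ≤ (b - a) / 2) (sin_nonneg_of_mem_Icc hθ))]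
  congr 1
  unfold arcPoint
  rw [mul_pow, sin_sq]
  ring

lemma image_arcPoint_Icc (hab : a < b) : arcPoint a b '' Icc 0 π = Icc a b := by
  refine Subset.antisymm (image_subset_iff.2 fun θ _ => arcPoint_mem_Icc hab.le θ) fun x hx => ?_
  obtain ⟨θ, hθ, h⟩ := exists_arcPoint_eq hab hx
  exact ⟨θ, hθ, h⟩

lemma hasDerivAt_arcPoint (a b θ : ℝ) :
    HasDerivAt (arcPoint a b) ((b - a) / 2 * (-sin θ)) θ :=
  ((hasDerivAt_cos θ).const_mul _).const_add _

lemma injOn_arcPoint (hab : a < b) : InjOn (arcPoint a b) (Icc 0 π) := fun θ hθ η hη h => by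
  have := congrArg (arcCoord a b) h
  rw [arcCoord_arcPoint hab, arcCoord_arcPoint hab] at this
  exact injOn_cos hθ hη this

lemma setIntegral_div_sqrt (hab : a < b) (h : ℝ → ℝ) :
    ∫ x in Icc a b, h x / √((x - a) * (b - x)) = ∫ θ in (0 : ℝ)..π, h (arcPoint a b θ) := by
  rw [← image_arcPoint_Icc hab, integral_image_eq_integral_abs_deriv_smul measurableSet_Icc
    (fun θ _ => (hasDerivAt_arcPoint a b θ).hasDerivWithinAt) (injOn_arcPoint hab),
    integral_of_le pi_pos.le, integral_Ioc_eq_integral_Ioo, integral_Icc_eq_integral_Ioo]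
  refine setIntegral_congr_fun measurableSet_Ioo fun θ hθ => ?_
  have hs := sin_pos_of_pos_of_lt_pi hθ.1 hθ.2
  have hd : 0 < (b - a) / 2 := by linarith
  simp only [smul_eq_mul]
  rw [sqrt_arcPoint_sub_mul hab.le (Ioo_subset_Icc_self hθ), mul_neg, abs_neg,
    abs_of_pos (mul_pos hd hs), mul_div_cancel₀ _ (mul_pos hd hs).ne']

lemma arcsineEnergy_eq (hab : a < b) (φ : ℝ → ℝ) :
    arcsineEnergy a b φ = ∫ θ in (0 : ℝ)..π, ∫ η in (0 : ℝ)..π,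
      angularKernel (fun θ => φ (arcPoint a b θ)) θ η := by
  unfold arcsineEnergy
  have h1 : ∀ x, ∫ y in Icc a b, ((φ x - φ y) / (x - y)) ^ 2 *
      ((-2 * a * b + (a + b) * (x + y) - 2 * x * y) /
        (2 * √((x - a) * (b - x)) * √((y - a) * (b - y)))) =
      (∫ η in (0 : ℝ)..π, ((φ x - φ (arcPoint a b η)) / (x - arcPoint a b η)) ^ 2 *
        ((-2 * a * b + (a + b) * (x + arcPoint a b η) - 2 * x * arcPoint a b η) / 2)) /
        √((x - a) * (b - x)) := by
    intro x
    rw [← intervalIntegral.integral_div, ← setIntegral_div_sqrt hab (fun y =>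
      ((φ x - φ y) / (x - y)) ^ 2 * ((-2 * a * b + (a + b) * (x + y) - 2 * x * y) / 2) /
        √((x - a) * (b - x)))]
    congr 1
    funext y
    simp only [div_eq_mul_inv, mul_inv]
    ring
  simp_rw [h1]
  rw [setIntegral_div_sqrt hab]
  refine intervalIntegral.integral_congr fun θ _ => intervalIntegral.integral_congr fun η _ => ?_
  have hd : (b - a) / 2 ≠ 0 := by linarith
  unfold angularKernel
  have e1 : arcPoint a b θ - arcPoint a b η = (b - a) / 2 * (cos θ - cos η) := by
    unfold arcPoint; ring
  have e2 : (-2 * a * b + (a + b) * (arcPoint a b θ + arcPoint a b η) -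
      2 * arcPoint a b θ * arcPoint a b η) / 2 =
      ((b - a) / 2) ^ 2 * (1 - cos θ * cos η) := by
    unfold arcPoint; ring
  simp only [e1, e2]
  rw [mul_comm ((b - a) / 2), ← div_div, div_pow _ ((b - a) / 2), ← mul_assoc,
    div_mul_cancel₀ _ (pow_ne_zero 2 hd)]

lemma integral_arcsineLaw (hab : a < b) (g : ℝ → ℝ) :
    ∫ x, g x ∂(arcsineLaw a b) = (∫ θ in (0 : ℝ)..π, g (arcPoint a b θ)) / π := by
  unfold arcsineLaw
  rw [integral_withDensity_eq_integral_toReal_smul (by fun_prop)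
    (Eventually.of_forall fun x => ENNReal.ofReal_lt_top), ← intervalIntegral.integral_div,
    ← setIntegral_div_sqrt hab fun x => g x / π]
  congr 1
  funext x
  rw [ENNReal.toReal_ofReal (by positivity), smul_eq_mul, div_div, div_mul_eq_mul_div, one_mul]

lemma variance_arcsineLaw (hab : a < b) {φ : ℝ → ℝ} (hφ : ContinuousOn φ (Icc a b)) :
    variance φ (arcsineLaw a b) = (∫ θ in (0 : ℝ)..π, (φ (arcPoint a b θ) -
      (∫ η in (0 : ℝ)..π, φ (arcPoint a b η)) / π) ^ 2) / π := by
  have hm : AEMeasurable φ (arcsineLaw a b) :=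
    (hφ.aemeasurable measurableSet_Icc).mono_ac (withDensity_absolutelyContinuous _ _)
  rw [variance_eq_integral hm, integral_arcsineLaw hab, integral_arcsineLaw hab]

end angular

section kernel
variable {F : ℝ → ℝ} {L : ℝ}

lemma measurable_angularKernel (hF : Measurable F) :
    Measurable fun z : ℝ × ℝ => angularKernel F z.1 z.2 := by
  unfold angularKernel
  fun_prop

lemma abs_angularKernel_le {θ η : ℝ} (hL : |F θ - F η| ≤ L * |cos θ - cos η|) :
    |angularKernel F θ η| ≤ L ^ 2 * 2 := by
  unfold angularKernel
  rw [abs_mul, abs_of_nonneg (sq_nonneg _), ← sq_abs, abs_div]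
  rcases eq_or_ne (cos θ - cos η) 0 with h | h
  · rw [h]; simp; positivity
  · have h0 : 0 < |cos θ - cos η| := abs_pos.2 h
    refine mul_le_mul ?_ ?_ (abs_nonneg _) (sq_nonneg _)
    · exact pow_le_pow_left₀ (by positivity) ((div_le_iff₀ h0).2 hL) 2
    · have h1 := abs_le.1 (abs_cos_le_one θ)
      have h2 := abs_le.1 (abs_cos_le_one η)
      rw [abs_le]; constructor <;> nlinarith

/-- The square `(0,π]²` of angles with Lebesgue measure. -/
noncomputable def angleSquare : Measure (ℝ × ℝ) :=
  (volume.restrict (Ioc 0 π)).prod (volume.restrict (Ioc 0 π))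

instance : IsFiniteMeasure angleSquare := by
  unfold angleSquare; infer_instance

lemma integral_integral_angularKernel (hF : Measurable F)
    (hL : ∀ θ η, |F θ - F η| ≤ L * |cos θ - cos η|) :
    ∫ θ in (0 : ℝ)..π, ∫ η in (0 : ℝ)..π, angularKernel F θ η =
      ∫ z, angularKernel F z.1 z.2 ∂angleSquare := by
  have hi : Integrable (fun z : ℝ × ℝ => angularKernel F z.1 z.2) angleSquare :=
    Integrable.of_bound (measurable_angularKernel hF).aestronglyMeasurable (L ^ 2 * 2)
      (Eventually.of_forall fun z => abs_angularKernel_le (hL _ _))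
  simp only [integral_of_le pi_pos.le]
  exact (integral_prod _ hi).symm

end kernel

/-! ### The functional inequalities -/

section poincare
variable {a b : ℝ}

lemma Polynomial.exists_derivative_eq (q : ℝ[X]) : ∃ p : ℝ[X], derivative p = q := by
  induction q using Polynomial.induction_on' with
  | add p q hp hq =>
    obtain ⟨p', rfl⟩ := hp
    obtain ⟨q', rfl⟩ := hq
    exact ⟨p' + q', derivative_add⟩
  | monomial n c =>
    refine ⟨monomial (n + 1) (c / (n + 1)), ?_⟩
    rw [derivative_monomial]
    push_cast
    rw [div_mul_cancel₀ _ (by positivity)]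

/-- Polynomial approximation in `C¹`. -/
lemma exists_seq_polynomial_tendsto (hab : a < b) {φ : ℝ → ℝ} (hφ : ContDiffOn ℝ 1 φ (Icc a b)) :
    ∃ (p : ℕ → ℝ[X]) (K : ℝ),
      (∀ x ∈ Icc a b, Tendsto (fun n => (p n).eval x) atTop (𝓝 (φ x))) ∧
      (∀ x ∈ Icc a b, Tendsto (fun n => (p n).derivative.eval x) atTop
        (𝓝 (derivWithin φ (Icc a b) x))) ∧
      (∀ n, ∀ x ∈ Icc a b, |(p n).eval x| ≤ K) ∧
      (∀ n, ∀ x ∈ Icc a b, |(p n).derivative.eval x| ≤ K) := by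
  have hud : UniqueDiffOn ℝ (Icc a b) := uniqueDiffOn_Icc hab
  have hc : ContinuousOn (derivWithin φ (Icc a b)) (Icc a b) :=
    hφ.continuousOn_derivWithin hud (by norm_num)
  have hdiff : DifferentiableOn ℝ φ (Icc a b) := hφ.differentiableOn (by norm_num)
  have haI : a ∈ Icc a b := left_mem_Icc.2 hab.le
  have key : ∀ n : ℕ, ∃ p : ℝ[X], ∀ x ∈ Icc a b,
      |p.derivative.eval x - derivWithin φ (Icc a b) x| ≤ 1 / (n + 1 : ℝ) ∧
      |p.eval x - φ x| ≤ 1 / (n + 1 : ℝ) * (b - a) := by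
    intro n
    obtain ⟨q, hq⟩ := exists_polynomial_near_of_continuousOn a b _ hc (1 / (n + 1 : ℝ))
      (by positivity)
    obtain ⟨p, rfl⟩ := Polynomial.exists_derivative_eq q
    refine ⟨p + C (φ a - p.eval a), fun x hx => ⟨?_, ?_⟩⟩
    · simpa using (hq x hx).le
    · have h := (convex_Icc a b).norm_image_sub_le_of_norm_hasDerivWithin_le
        (f := fun x => p.eval x - φ x)
        (f' := fun x => p.derivative.eval x - derivWithin φ (Icc a b) x)
        (fun x hx => (p.hasDerivAt x).hasDerivWithinAt.sub (hdiff x hx).hasDerivWithinAt)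
        (fun x hx => (hq x hx).le) haI hx
      simp only [eval_add, eval_C]
      rw [norm_eq_abs, norm_eq_abs, abs_of_nonneg (sub_nonneg.2 hx.1)] at h
      rw [show p.eval x + (φ a - p.eval a) - φ x = p.eval x - φ x - (p.eval a - φ a) by ring]
      exact h.trans (mul_le_mul_of_nonneg_left (by linarith [hx.2]) (by positivity))
  choose p hp using key
  obtain ⟨K₁, hK₁⟩ := isCompact_Icc.exists_bound_of_continuousOn hc
  obtain ⟨K₂, hK₂⟩ := isCompact_Icc.exists_bound_of_continuousOn hφ.continuousOn
  have hlim : Tendsto (fun n : ℕ => 1 / (n + 1 : ℝ)) atTop (𝓝 0) :=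
    tendsto_one_div_add_atTop_nhds_zero_nat
  have hle : ∀ n : ℕ, 1 / (n + 1 : ℝ) ≤ 1 := fun n => by
    rw [div_le_one (by positivity)]; linarith [(Nat.cast_nonneg n : (0 : ℝ) ≤ n)]
  refine ⟨p, max (K₂ + (b - a)) (K₁ + 1), fun x hx => ?_, fun x hx => ?_, fun n x hx => ?_,
    fun n x hx => ?_⟩
  · rw [tendsto_iff_norm_sub_tendsto_zero]
    refine squeeze_zero (fun n => norm_nonneg _) (fun n => (hp n x hx).2) ?_
    simpa using hlim.mul_const (b - a)
  · rw [tendsto_iff_norm_sub_tendsto_zero]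
    exact squeeze_zero (fun n => norm_nonneg _) (fun n => (hp n x hx).1) hlim
  · refine le_max_of_le_left ?_
    have h1 := hK₂ x hx
    have h2 := (hp n x hx).2
    have h3 : 1 / (n + 1 : ℝ) * (b - a) ≤ b - a :=
      mul_le_of_le_one_left (sub_pos.2 hab).le (hle n)
    rw [norm_eq_abs] at h1
    have := abs_sub_abs_le_abs_sub ((p n).eval x) (φ x)
    linarith
  · refine le_max_of_le_right ?_
    have h1 := hK₁ x hx
    have h2 := (hp n x hx).1
    rw [norm_eq_abs] at h1
    have := abs_sub_abs_le_abs_sub ((p n).derivative.eval x) (derivWithin φ (Icc a b) x)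
    linarith [hle n]

/-- A polynomial in `x` is a cosine polynomial in the angle. -/
lemma exists_cos_expansion (hab : a < b) (p : ℝ[X]) : ∃ (N : ℕ) (c : ℝ) (γ : ℕ → ℝ), γ N = 0 ∧
    (∀ θ, p.eval (arcPoint a b θ) = c + ∑ n ∈ Finset.range N, γ n * cos ((n + 1 : ℝ) * θ)) ∧
    ∀ θ, p.derivative.eval (arcPoint a b θ) * ((b - a) / 2 * sin θ) =
      ∑ n ∈ Finset.range N, (n + 1 : ℝ) * γ n * sin ((n + 1 : ℝ) * θ) := by
  obtain ⟨P, -, hP⟩ := exists_polynomial_arcCoord hab p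
  obtain ⟨c, hc⟩ := Finsupp.mem_span_range_iff_exists_finsupp.1 (mem_span_chebyshev_T P)
  set N := c.support.sup id with hN
  have hsub : c.support ⊆ Finset.range (N + 1) := by
    intro k hk
    rw [Finset.mem_range, Nat.lt_succ_iff]
    exact Finset.le_sup (f := id) hk
  have hexp : ∀ θ, p.eval (arcPoint a b θ) =
      c 0 + ∑ n ∈ Finset.range N, c (n + 1) * cos ((n + 1 : ℝ) * θ) := by
    intro θ
    rw [← hP, ← hc, Finsupp.sum_of_support_subset _ hsub _ (by simp), eval_finsetSum,
      Finset.sum_range_succ', add_comm]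
    simp only [eval_smul, smul_eq_mul, Chebyshev.T_real_cos]
    push_cast
    simp
  refine ⟨N, c 0, fun n => c (n + 1), ?_, hexp, fun θ => ?_⟩
  · by_contra h
    have := Finset.mem_range.1 (hsub (Finsupp.mem_support_iff.2 h))
    omega
  · have h1 : HasDerivAt (fun θ => p.eval (arcPoint a b θ))
        (p.derivative.eval (arcPoint a b θ) * ((b - a) / 2 * (-sin θ))) θ :=
      (p.hasDerivAt _).comp θ (hasDerivAt_arcPoint a b θ)
    have h2 : HasDerivAt (fun θ => p.eval (arcPoint a b θ))
        (∑ n ∈ Finset.range N, c (n + 1) * (-sin ((n + 1 : ℝ) * θ) * (n + 1))) θ := by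
      simp only [hexp]
      refine HasDerivAt.const_add _ (HasDerivAt.fun_sum fun n _ => HasDerivAt.const_mul _ ?_)
      simpa using ((hasDerivAt_id θ).const_mul (n + 1 : ℝ)).cos
    have h3 := h1.unique h2
    rw [← neg_inj, show -(p.derivative.eval (arcPoint a b θ) * ((b - a) / 2 * sin θ)) =
      p.derivative.eval (arcPoint a b θ) * ((b - a) / 2 * (-sin θ)) by ring, h3,
      ← Finset.sum_neg_distrib]
    refine Finset.sum_congr rfl fun n _ => ?_
    ring

lemma integral_add_mul_cos_eq_of_expansion {f : ℝ → ℝ} {N : ℕ} {γ : ℕ → ℝ} (hγ : γ N = 0)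
    (hf : ∀ θ, f θ = ∑ n ∈ Finset.range N, (n + 1 : ℝ) * γ n * sin ((n + 1 : ℝ) * θ)) (M δ : ℝ) :
    ∫ θ in (0 : ℝ)..π, (M + δ * cos θ) * f θ ^ 2 =
      π / 2 * ∑ n ∈ Finset.range N, (M * ((n + 1 : ℝ) * γ n) ^ 2 +
        δ * ((n + 1 : ℝ) * γ n * ((n + 2 : ℝ) * γ (n + 1)))) := by
  simp_rw [hf]
  rw [integral_add_mul_cos_mul_sq_sum_sin (e := fun n => (n + 1 : ℝ) * γ n) M δ (by simp [hγ])]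
  congr 1
  refine Finset.sum_congr rfl fun n _ => ?_
  push_cast
  ring

variable {M D δ : ℝ} {φ : ℝ → ℝ}

lemma tendsto_integral_add_mul_cos (hab : a < b) {p : ℕ → ℝ[X]} {K : ℝ} {f : ℝ → ℝ}
    (hp : ∀ x ∈ Icc a b, Tendsto (fun n => (p n).eval x) atTop (𝓝 (f x)))
    (hK : ∀ n, ∀ x ∈ Icc a b, |(p n).eval x| ≤ K) (w u : ℝ → ℝ) (hw : Continuous w)
    (hu : Continuous u) :
    Tendsto (fun n => ∫ θ in (0 : ℝ)..π, w θ * ((p n).eval (arcPoint a b θ) * u θ) ^ 2) atTop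
      (𝓝 (∫ θ in (0 : ℝ)..π, w θ * (f (arcPoint a b θ) * u θ) ^ 2)) := by
  refine intervalIntegral.tendsto_integral_filter_of_dominated_convergence
    (fun θ => |w θ| * (K * |u θ|) ^ 2) (Eventually.of_forall fun n => ?_)
    (Eventually.of_forall fun n => Eventually.of_forall fun θ _ => ?_)
    (Continuous.intervalIntegrable (by fun_prop) _ _) (Eventually.of_forall fun θ _ => ?_)
  · have := (p n).continuous.comp (continuous_arcPoint a b)
    exact (hw.mul ((this.mul hu).pow 2)).aestronglyMeasurable
  · rw [norm_eq_abs, abs_mul, abs_pow, abs_mul]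
    have := hK n _ (arcPoint_mem_Icc hab.le θ)
    gcongr
  · exact (((hp _ (arcPoint_mem_Icc hab.le θ)).mul_const _).pow 2).const_mul _

lemma abs_eval_arcPoint_sub_le (hab : a < b) {p : ℝ[X]} {K : ℝ}
    (hK : ∀ x ∈ Icc a b, |p.derivative.eval x| ≤ K) (θ η : ℝ) :
    |p.eval (arcPoint a b θ) - p.eval (arcPoint a b η)| ≤
      K * ((b - a) / 2) * |cos θ - cos η| := by
  have h := (convex_Icc a b).norm_image_sub_le_of_norm_hasDerivWithin_le
    (f := fun x => p.eval x) (fun x hx => (p.hasDerivAt x).hasDerivWithinAt)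
    (fun x hx => hK x hx) (arcPoint_mem_Icc hab.le η) (arcPoint_mem_Icc hab.le θ)
  rw [norm_eq_abs, norm_eq_abs, show arcPoint a b θ - arcPoint a b η =
    (b - a) / 2 * (cos θ - cos η) by unfold arcPoint; ring, abs_mul,
    abs_of_pos (by linarith : 0 < (b - a) / 2), ← mul_assoc] at h
  exact h

lemma tendsto_arcsineEnergy (hab : a < b) {p : ℕ → ℝ[X]} {K : ℝ}
    (hφ : ContinuousOn φ (Icc a b))
    (hp : ∀ x ∈ Icc a b, Tendsto (fun n => (p n).eval x) atTop (𝓝 (φ x)))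
    (hK : ∀ n, ∀ x ∈ Icc a b, |(p n).derivative.eval x| ≤ K) :
    Tendsto (fun n => arcsineEnergy a b fun x => (p n).eval x) atTop
      (𝓝 (arcsineEnergy a b φ)) := by
  have hpm : ∀ n, Measurable fun θ => (p n).eval (arcPoint a b θ) := fun n =>
    ((p n).continuous.comp (continuous_arcPoint a b)).measurable
  have hφm : Measurable fun θ => φ (arcPoint a b θ) :=
    (hφ.continuous_comp_arcPoint hab.le).measurable
  have hpL := fun n => abs_eval_arcPoint_sub_le hab (hK n)
  have hlim := fun θ => hp _ (arcPoint_mem_Icc hab.le θ)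
  have hφL : ∀ θ η, |φ (arcPoint a b θ) - φ (arcPoint a b η)| ≤
      K * ((b - a) / 2) * |cos θ - cos η| := fun θ η =>
    le_of_tendsto ((hlim θ).sub (hlim η)).abs (Eventually.of_forall fun n => hpL n θ η)
  simp_rw [arcsineEnergy_eq hab]
  rw [integral_integral_angularKernel hφm hφL]
  simp_rw [fun n => integral_integral_angularKernel (hpm n) (hpL n)]
  refine tendsto_integral_of_dominated_convergence (fun _ => (K * ((b - a) / 2)) ^ 2 * 2)
    (fun n => (measurable_angularKernel (hpm n)).aestronglyMeasurable) (integrable_const _)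
    (fun n => Eventually.of_forall fun z => abs_angularKernel_le (hpL n _ _))
    (Eventually.of_forall fun z => ?_)
  exact ((((hlim z.1).sub (hlim z.2)).div_const _).pow 2).mul_const _

/-- The Poincaré inequality for the weight `M + δ cos θ`. -/
theorem mul_arcsineEnergy_le (hab : a < b) (hφ : ContDiffOn ℝ 1 φ (Icc a b)) (hD : 0 ≤ D)
    (hδ : 0 ≤ δ) (hDM : D ≤ M) (hDδ : D ^ 2 = M ^ 2 - δ ^ 2) :
    D / (2 * π) * arcsineEnergy a b φ ≤ ∫ θ in (0 : ℝ)..π, (M + δ * cos θ) *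
      (derivWithin φ (Icc a b) (arcPoint a b θ) * ((b - a) / 2 * sin θ)) ^ 2 := by
  obtain ⟨p, K, hp, hp', -, hK'⟩ := exists_seq_polynomial_tendsto hab hφ
  refine le_of_tendsto_of_tendsto'
    ((tendsto_arcsineEnergy hab hφ.continuousOn hp hK').const_mul (D / (2 * π)))
    (tendsto_integral_add_mul_cos hab (p := fun n => (p n).derivative) hp' hK'
      (fun θ => M + δ * cos θ) (fun θ => (b - a) / 2 * sin θ) (by fun_prop) (by fun_prop))
    fun n => ?_
  obtain ⟨N, c, γ, hγ, h1, h2⟩ := exists_cos_expansion hab (p n)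
  rw [integral_add_mul_cos_eq_of_expansion hγ h2, arcsineEnergy_eq hab]
  simp_rw [h1]
  rw [integral_angularKernel_sum_cos c hγ]
  have h3 := mul_sum_le_sum_quadratic_form hD hδ hDM hDδ hγ
  have h4 := mul_le_mul_of_nonneg_left h3 (by positivity : 0 ≤ π / 2)
  refine le_trans (le_of_eq ?_) h4
  field_simp

lemma variance_arcsineLaw_eq_sub (hab : a < b) (hφ : ContinuousOn φ (Icc a b)) :
    variance φ (arcsineLaw a b) = ((∫ θ in (0 : ℝ)..π, 1 * (φ (arcPoint a b θ) * 1) ^ 2) -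
      (∫ θ in (0 : ℝ)..π, φ (arcPoint a b θ)) ^ 2 / π) / π := by
  have hc := hφ.continuous_comp_arcPoint hab.le
  rw [variance_arcsineLaw hab hφ]
  set A := ∫ θ in (0 : ℝ)..π, φ (arcPoint a b θ) with hA
  congr 1
  have e : ∫ θ in (0 : ℝ)..π, (φ (arcPoint a b θ) - A / π) ^ 2 =
      ∫ θ in (0 : ℝ)..π, ((1 * (φ (arcPoint a b θ) * 1) ^ 2 - 2 * (A / π) * φ (arcPoint a b θ)) +
        (A / π) ^ 2) := by
    refine intervalIntegral.integral_congr fun θ _ => ?_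
    ring
  have hi1 : IntervalIntegrable (fun θ => 1 * (φ (arcPoint a b θ) * 1) ^ 2) volume 0 π :=
    (continuous_const.mul ((hc.mul continuous_const).pow 2)).intervalIntegrable _ _
  have hi2 : IntervalIntegrable (fun θ => 2 * (A / π) * φ (arcPoint a b θ)) volume 0 π :=
    (continuous_const.mul hc).intervalIntegrable _ _
  rw [e, intervalIntegral.integral_add (hi1.sub hi2) intervalIntegrable_const,
    intervalIntegral.integral_sub hi1 hi2, intervalIntegral.integral_const_mul (2 * (A / π)), ← hA,
    intervalIntegral.integral_const, smul_eq_mul]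
  field_simp
  ring

lemma tendsto_variance_arcsineLaw (hab : a < b) {p : ℕ → ℝ[X]} {K : ℝ}
    (hφ : ContinuousOn φ (Icc a b))
    (hp : ∀ x ∈ Icc a b, Tendsto (fun n => (p n).eval x) atTop (𝓝 (φ x)))
    (hK : ∀ n, ∀ x ∈ Icc a b, |(p n).eval x| ≤ K) :
    Tendsto (fun n => variance (fun x => (p n).eval x) (arcsineLaw a b)) atTop
      (𝓝 (variance φ (arcsineLaw a b))) := by
  rw [variance_arcsineLaw_eq_sub hab hφ]
  simp_rw [fun n => variance_arcsineLaw_eq_sub hab (p n).continuousOn]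
  have h1 := tendsto_integral_add_mul_cos hab hp hK (fun _ => 1) (fun _ => 1) continuous_const
    continuous_const
  have h2 : Tendsto (fun n => ∫ θ in (0 : ℝ)..π, (p n).eval (arcPoint a b θ)) atTop
      (𝓝 (∫ θ in (0 : ℝ)..π, φ (arcPoint a b θ))) := by
    refine intervalIntegral.tendsto_integral_filter_of_dominated_convergence
      (fun _ => K) (Eventually.of_forall fun n => ?_)
      (Eventually.of_forall fun n => Eventually.of_forall fun θ _ =>
        hK n _ (arcPoint_mem_Icc hab.le θ))
      intervalIntegrable_const (Eventually.of_forall fun θ _ => hp _ (arcPoint_mem_Icc hab.le θ))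
    exact ((p n).continuous.comp (continuous_arcPoint a b)).aestronglyMeasurable
  exact (h1.sub ((h2.pow 2).div_const π)).div_const π

/-- The variance is controlled with a constant strictly better than the one that follows from
`mul_arcsineEnergy_le`. -/
theorem exists_mul_variance_le (hab : a < b) (hD : 0 < D) (hδ : 0 ≤ δ) (hDM : D < M)
    (hDδ : D ^ 2 = M ^ 2 - δ ^ 2) : ∃ κ > 0, ∀ φ : ℝ → ℝ, ContDiffOn ℝ 1 φ (Icc a b) →
    (D + κ) * π * variance φ (arcsineLaw a b) ≤ ∫ θ in (0 : ℝ)..π, (M + δ * cos θ) *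
      (derivWithin φ (Icc a b) (arcPoint a b θ) * ((b - a) / 2 * sin θ)) ^ 2 := by
  obtain ⟨κ, hκ, hquad⟩ := exists_mul_sum_sq_le_sum_quadratic_form hD hδ hDM hDδ
  refine ⟨κ, hκ, fun φ hφ => ?_⟩
  obtain ⟨p, K, hp, hp', hK, hK'⟩ := exists_seq_polynomial_tendsto hab hφ
  refine le_of_tendsto_of_tendsto'
    ((tendsto_variance_arcsineLaw hab hφ.continuousOn hp hK).const_mul ((D + κ) * π))
    (tendsto_integral_add_mul_cos hab (p := fun n => (p n).derivative) hp' hK'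
      (fun θ => M + δ * cos θ) (fun θ => (b - a) / 2 * sin θ) (by fun_prop) (by fun_prop))
    fun n => ?_
  obtain ⟨N, c, γ, hγ, h1, h2⟩ := exists_cos_expansion hab (p n)
  rw [integral_add_mul_cos_eq_of_expansion hγ h2, variance_arcsineLaw hab (p n).continuousOn]
  simp_rw [h1]
  rw [integral_sum_cos]
  simp_rw [mul_div_cancel_left₀ c pi_ne_zero, add_sub_cancel_left]
  rw [integral_sq_sum_cos]
  have h4 := mul_le_mul_of_nonneg_left (hquad N γ hγ) (by positivity : 0 ≤ π / 2)
  refine le_trans (le_of_eq ?_) h4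
  field_simp

end poincare

/-! ### Extremal functions -/

section extremal
variable {a b e c₁ c₂ : ℝ}

lemma add_arcPoint_pos (hab : a < b) (he : 0 < a + e) (θ : ℝ) : 0 < arcPoint a b θ + e := by
  linarith [(arcPoint_mem_Icc hab.le θ).1]

lemma abs_half_sub_lt_add (hab : a < b) (he : 0 < a + e) :
    |(b - a) / 2| < (a + b) / 2 + e := by
  rw [abs_of_pos (by linarith)]; linarith

lemma sq_sqrt_add_mul_add (hab : a < b) (he : 0 < a + e) :
    √((a + e) * (b + e)) ^ 2 = ((a + b) / 2 + e) ^ 2 - ((b - a) / 2) ^ 2 := by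
  rw [sq_sqrt (mul_pos he (by linarith)).le]; ring

lemma sqrt_add_mul_add_pos (hab : a < b) (he : 0 < a + e) : 0 < √((a + e) * (b + e)) :=
  sqrt_pos.2 (mul_pos he (by linarith))

lemma contDiffOn_add_div_add (he : 0 < a + e) (n : WithTop ℕ∞) :
    ContDiffOn ℝ n (fun x => c₁ + c₂ / (x + e)) (Icc a b) :=
  contDiffOn_const.add (contDiffOn_const.div (contDiffOn_id.add contDiffOn_const)
    fun x hx => (show (0 : ℝ) < x + e by linarith [hx.1]).ne')

lemma derivWithin_add_div_add (hab : a < b) (he : 0 < a + e) {x : ℝ} (hx : x ∈ Icc a b) :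
    derivWithin (fun x => c₁ + c₂ / (x + e)) (Icc a b) x = -c₂ / (x + e) ^ 2 := by
  have hne : x + e ≠ 0 := by have := hx.1; linarith
  have h : HasDerivAt (fun x => c₁ + c₂ / (x + e)) (-c₂ / (x + e) ^ 2) x := by
    have h1 : HasDerivAt (fun x => x + e) 1 x := (hasDerivAt_id x).add_const e
    refine (((hasDerivAt_const x c₂).div h1 hne).const_add c₁).congr_deriv ?_
    ring
  exact h.hasDerivWithinAt.derivWithin (uniqueDiffOn_Icc hab x hx)

lemma arcsineEnergy_add_div_add (hab : a < b) (he : 0 < a + e) :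
    arcsineEnergy a b (fun x => c₁ + c₂ / (x + e)) =
      c₂ ^ 2 * π ^ 2 * ((b - a) / 2) ^ 2 / √((a + e) * (b + e)) ^ 4 := by
  have hpos := add_arcPoint_pos hab he
  have hX : ∀ θ, arcPoint a b θ + e = (a + b) / 2 + e + (b - a) / 2 * cos θ := fun θ => by
    unfold arcPoint; ring
  obtain ⟨hA, hB⟩ := integral_inv_sq_add_mul_cos (abs_half_sub_lt_add hab he)
    (sqrt_add_mul_add_pos hab he) (sq_sqrt_add_mul_add hab he)
  have hDD := sq_sqrt_add_mul_add hab he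
  have hD0 := sqrt_add_mul_add_pos hab he
  generalize √((a + e) * (b + e)) = D at *
  simp_rw [← hX] at hA hB
  have hAi : Continuous fun θ => 1 / (arcPoint a b θ + e) ^ 2 :=
    continuous_const.div (((continuous_arcPoint a b).add continuous_const).pow 2)
      fun θ => (pow_pos (hpos θ) 2).ne'
  have hBi : Continuous fun θ => cos θ / (arcPoint a b θ + e) ^ 2 :=
    continuous_cos.div (((continuous_arcPoint a b).add continuous_const).pow 2)
      fun θ => (pow_pos (hpos θ) 2).ne'
  rw [arcsineEnergy_eq hab]
  have h1 : ∀ θ, ∫ η in (0 : ℝ)..π, angularKernel (fun θ => c₁ + c₂ / (arcPoint a b θ + e)) θ η =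
      c₂ ^ 2 * ((b - a) / 2) ^ 2 * (1 / (arcPoint a b θ + e) ^ 2 *
        (∫ η in (0 : ℝ)..π, 1 / (arcPoint a b η + e) ^ 2) - cos θ / (arcPoint a b θ + e) ^ 2 *
        ∫ η in (0 : ℝ)..π, cos η / (arcPoint a b η + e) ^ 2) := by
    intro θ
    rw [← intervalIntegral.integral_const_mul, ← intervalIntegral.integral_const_mul,
      ← intervalIntegral.integral_sub ((hAi.intervalIntegrable _ _).const_mul _)
        ((hBi.intervalIntegrable _ _).const_mul _), ← intervalIntegral.integral_const_mul]
    refine intervalIntegral.integral_congr_ae ?_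
    filter_upwards [ae_cos_ne θ] with η hη _
    have h2 := (hpos θ).ne'
    have h3 := (hpos η).ne'
    have h4 : c₁ + c₂ / (arcPoint a b θ + e) - (c₁ + c₂ / (arcPoint a b η + e)) =
        -(c₂ * ((b - a) / 2)) / ((arcPoint a b θ + e) * (arcPoint a b η + e)) *
          (cos θ - cos η) := by
      have h5 : arcPoint a b η - arcPoint a b θ = -((b - a) / 2) * (cos θ - cos η) := by
        unfold arcPoint; ring
      field_simp
      linear_combination c₂ * 2 * h5
    unfold angularKernel
    rw [h4, mul_div_cancel_right₀ _ hη]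
    field_simp
  simp_rw [h1]
  rw [intervalIntegral.integral_const_mul, intervalIntegral.integral_sub
    ((hAi.intervalIntegrable _ _).mul_const _) ((hBi.intervalIntegrable _ _).mul_const _),
    intervalIntegral.integral_mul_const, intervalIntegral.integral_mul_const, hA, hB]
  generalize (a + b) / 2 + e = m at hDD ⊢
  generalize (b - a) / 2 = d at hDD ⊢
  rw [show c₂ ^ 2 * d ^ 2 * (π * m / D ^ 3 * (π * m / D ^ 3) -
    -(π * d / D ^ 3) * -(π * d / D ^ 3)) = c₂ ^ 2 * d ^ 2 * π ^ 2 * (m ^ 2 - d ^ 2) / D ^ 6 by ring,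
    ← hDD]
  field_simp

lemma arcsineEnergy_add_mul (hab : a < b) :
    arcsineEnergy a b (fun x => c₁ + c₂ * x) = c₂ ^ 2 * π ^ 2 * ((b - a) / 2) ^ 2 := by
  have h0 : ∫ η in (0 : ℝ)..π, cos η = 0 := by simp
  rw [arcsineEnergy_eq hab]
  have h1 : ∀ θ, ∫ η in (0 : ℝ)..π, angularKernel (fun θ => c₁ + c₂ * arcPoint a b θ) θ η =
      (c₂ * ((b - a) / 2)) ^ 2 * π := by
    intro θ
    have h2 : ∫ η in (0 : ℝ)..π, angularKernel (fun θ => c₁ + c₂ * arcPoint a b θ) θ η =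
        ∫ η in (0 : ℝ)..π, (c₂ * ((b - a) / 2)) ^ 2 * (1 - cos θ * cos η) := by
      refine intervalIntegral.integral_congr_ae ?_
      filter_upwards [ae_cos_ne θ] with η hη _
      unfold angularKernel
      rw [show c₁ + c₂ * arcPoint a b θ - (c₁ + c₂ * arcPoint a b η) =
        c₂ * ((b - a) / 2) * (cos θ - cos η) by unfold arcPoint; ring,
        mul_div_cancel_right₀ _ hη]
    rw [h2, intervalIntegral.integral_const_mul, intervalIntegral.integral_sub
      intervalIntegrable_const (Continuous.intervalIntegrable (by fun_prop) _ _),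
      intervalIntegral.integral_const_mul, h0]
    simp
  simp_rw [h1]
  rw [intervalIntegral.integral_const, smul_eq_mul]
  ring

end extremal

/-! ### Dirichlet forms of equilibrium measures -/

section dirichlet
variable {μ : Measure ℝ} {a b : ℝ} {φ : ℝ → ℝ}

lemma ContDiffOn.continuousOn_mul_sq_derivWithin (hab : a < b) (hφ : ContDiffOn ℝ 1 φ (Icc a b))
    {w : ℝ → ℝ} (hw : Continuous w) :
    ContinuousOn (fun x => w x * derivWithin φ (Icc a b) x ^ 2) (Icc a b) :=
  hw.continuousOn.mul ((hφ.continuousOn_derivWithin (uniqueDiffOn_Icc hab) (by norm_num)).pow 2)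

lemma dirichletForm_eq_zero_of_const (hae : ∀ᵐ x ∂μ, x ∈ Icc a b) {c : ℝ}
    (hc : ∀ x ∈ Icc a b, φ x = c) (w : ℝ → ℝ) : dirichletForm a b w μ φ = 0 := by
  unfold dirichletForm
  rw [integral_eq_zero_of_ae]
  filter_upwards [hae] with x hx
  have h : derivWithin φ (Icc a b) x = derivWithin (fun _ => c) (Icc a b) x :=
    derivWithin_congr hc (hc x hx)
  rw [h]
  simp

lemma exists_eq_const_of_variance_arcsineLaw_eq_zero (hab : a < b) (hφ : ContinuousOn φ (Icc a b))
    (h : variance φ (arcsineLaw a b) = 0) : ∃ c : ℝ, ∀ x ∈ Icc a b, φ x = c := by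
  refine ⟨(∫ η in (0 : ℝ)..π, φ (arcPoint a b η)) / π, fun x hx => ?_⟩
  obtain ⟨θ, hθ, rfl⟩ := exists_arcPoint_eq hab hx
  by_contra hne
  have hc := hφ.continuous_comp_arcPoint hab.le
  have hpos := intervalIntegral.integral_pos pi_pos
    ((hc.sub continuous_const).pow 2).continuousOn (fun η _ => sq_nonneg _)
    ⟨θ, hθ, pow_pos (abs_pos.2 (sub_ne_zero.2 hne)) 2 |>.trans_eq (sq_abs _)⟩
  rw [variance_arcsineLaw hab hφ, div_eq_zero_iff, or_iff_left pi_ne_zero] at h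
  exact hpos.ne' h

lemma variance_arcsineLaw_of_const (hab : a < b) {c : ℝ} (hc : ∀ x ∈ Icc a b, φ x = c) :
    variance φ (arcsineLaw a b) = 0 := by
  rw [variance_arcsineLaw hab (continuousOn_const.congr hc)]
  simp_rw [fun θ => hc _ (arcPoint_mem_Icc hab.le θ)]
  rw [intervalIntegral.integral_const, smul_eq_mul, sub_zero, mul_div_cancel_left₀ _ pi_ne_zero]
  simp

section convex
variable {Q : ℝ → ℝ} {s : ℝ}

lemma integral_sq_mul_marchenkoPasturWeight (ha : 0 < a) (hab : a ≤ b) (f : ℝ → ℝ) :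
    ∫ θ in (0 : ℝ)..π, (arcPoint a b θ ^ 2 * f (arcPoint a b θ) ^ 2) *
      marchenkoPasturWeight s a b θ =
    s / (2 * π * √(a * b)) * ∫ θ in (0 : ℝ)..π, ((a + b) / 2 + (b - a) / 2 * cos θ) *
      (f (arcPoint a b θ) * ((b - a) / 2 * sin θ)) ^ 2 := by
  rw [← intervalIntegral.integral_const_mul]
  refine intervalIntegral.integral_congr fun θ _ => ?_
  have h := (arcPoint_pos ha hab θ).ne'
  change _ = s / (2 * π * √(a * b)) * (arcPoint a b θ *
    (f (arcPoint a b θ) * ((b - a) / 2 * sin θ)) ^ 2)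
  unfold marchenkoPasturWeight
  generalize √(a * b) = D
  field_simp

lemma mul_integral_le_dirichletForm (hQ : ConvexOn ℝ (Ici 0) Q) (hs0 : 0 < s)
    (hμ : IsEquilibriumMeasure (fun x => Q x - s * log x) μ) (hs : μ.support = Icc a b)
    (hφ : ContDiffOn ℝ 1 φ (Icc a b)) :
    s / (2 * π * √(a * b)) * ∫ θ in (0 : ℝ)..π, ((a + b) / 2 + (b - a) / 2 * cos θ) *
      (derivWithin φ (Icc a b) (arcPoint a b θ) * ((b - a) / 2 * sin θ)) ^ 2 ≤
    dirichletForm a b (fun x => x ^ 2) μ φ := by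
  have ha := pos_of_support_eq hQ hs0 hμ hs
  have hab := (hμ.nonneg_and_lt (hQ.continuousOn_sub_mul_log s) hs).2
  rw [← integral_sq_mul_marchenkoPasturWeight ha hab.le]
  exact integral_marchenkoPasturWeight_le hQ hs0 hμ hs
    (hφ.continuousOn_mul_sq_derivWithin hab (continuous_id.pow 2)) fun x _ =>
      mul_nonneg (sq_nonneg _) (sq_nonneg _)

theorem mul_arcsineEnergy_le_dirichletForm_sq (hQ : ConvexOn ℝ (Ici 0) Q) (hs0 : 0 < s)
    (hμ : IsEquilibriumMeasure (fun x => Q x - s * log x) μ) (hs : μ.support = Icc a b)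
    (hφ : ContDiffOn ℝ 1 φ (Icc a b)) :
    s / (4 * π ^ 2) * arcsineEnergy a b φ ≤ dirichletForm a b (fun x => x ^ 2) μ φ := by
  have ha := pos_of_support_eq hQ hs0 hμ hs
  have hab := (hμ.nonneg_and_lt (hQ.continuousOn_sub_mul_log s) hs).2
  refine le_trans ?_ (mul_integral_le_dirichletForm hQ hs0 hμ hs hφ)
  have hDm := sq_sqrt_mul_eq ha hab
  have hD0 : 0 < √(a * b) := sqrt_pos.2 (mul_pos ha (ha.trans hab))
  have hDM : √(a * b) ≤ (a + b) / 2 := by nlinarith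
  have h := mul_arcsineEnergy_le hab hφ hD0.le (by linarith : 0 ≤ (b - a) / 2) hDM hDm
  refine le_trans (le_of_eq ?_)
    (mul_le_mul_of_nonneg_left h (by positivity : 0 ≤ s / (2 * π * √(a * b))))
  generalize √(a * b) = D at hD0
  field_simp
  ring

/-- The inequality for the variance holds with a constant better than `s / 2`, which forces the
variance to vanish in the case of equality. -/
lemma exists_mul_variance_le_dirichletForm_sq (hQ : ConvexOn ℝ (Ici 0) Q) (hs0 : 0 < s)
    (hμ : IsEquilibriumMeasure (fun x => Q x - s * log x) μ) (hs : μ.support = Icc a b) :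
    ∃ κ > 0, ∀ φ : ℝ → ℝ, ContDiffOn ℝ 1 φ (Icc a b) →
      (s / 2 + κ) * variance φ (arcsineLaw a b) ≤ dirichletForm a b (fun x => x ^ 2) μ φ := by
  have ha := pos_of_support_eq hQ hs0 hμ hs
  have hab := (hμ.nonneg_and_lt (hQ.continuousOn_sub_mul_log s) hs).2
  have hDm := sq_sqrt_mul_eq ha hab
  have hD0 : 0 < √(a * b) := sqrt_pos.2 (mul_pos ha (ha.trans hab))
  have hDM : √(a * b) < (a + b) / 2 := by nlinarith
  obtain ⟨κ, hκ, h⟩ := exists_mul_variance_le hab hD0 (by linarith : 0 ≤ (b - a) / 2) hDM hDm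
  refine ⟨s * κ / (2 * √(a * b)), by positivity, fun φ hφ => ?_⟩
  refine le_trans ?_ (mul_integral_le_dirichletForm hQ hs0 hμ hs hφ)
  refine le_trans (le_of_eq ?_)
    (mul_le_mul_of_nonneg_left (h φ hφ) (by positivity : 0 ≤ s / (2 * π * √(a * b))))
  generalize √(a * b) = D at hD0
  field_simp

lemma dirichletForm_sq_add_div (hQ : ConvexOn ℝ (Ici 0) Q) (hs0 : 0 < s)
    (hμ : IsEquilibriumMeasure (fun x => Q x - s * log x) μ) (hs : μ.support = Icc a b)
    {r t : ℝ} (hQrt : ∀ x ∈ Ici (0 : ℝ), Q x = r * x + t) (c₁ c₂ : ℝ) :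
    dirichletForm a b (fun x => x ^ 2) μ (fun x => c₁ + c₂ / x) =
      s / (4 * π ^ 2) * arcsineEnergy a b (fun x => c₁ + c₂ / x) := by
  have ha := pos_of_support_eq hQ hs0 hμ hs
  have hab := (hμ.nonneg_and_lt (hQ.continuousOn_sub_mul_log s) hs).2
  have ha0 : 0 < a + 0 := by linarith
  have hφ := contDiffOn_add_div_add (b := b) (c₁ := c₁) (c₂ := c₂) ha0 1
  have hE := arcsineEnergy_add_div_add (c₁ := c₁) (c₂ := c₂) hab ha0
  have hder := fun θ => derivWithin_add_div_add (c₁ := c₁) (c₂ := c₂) hab ha0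
    (arcPoint_mem_Icc hab.le θ)
  simp only [add_zero] at hφ hE hder
  have h := integral_eq_marchenkoPasturWeight hQ hs0 hμ hs hQrt
    (hφ.continuousOn_mul_sq_derivWithin hab (continuous_id.pow 2))
  have hcube := integral_sin_sq_div_cube (abs_half_sub_lt ha hab)
    (by linarith : (b - a) / 2 ≠ 0) (sqrt_pos.2 (mul_pos ha (ha.trans hab)))
    (sq_sqrt_mul_eq ha hab)
  have hD0 : 0 < √(a * b) := sqrt_pos.2 (mul_pos ha (ha.trans hab))
  unfold dirichletForm
  simp only [id, Pi.pow_apply] at h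
  rw [h, integral_sq_mul_marchenkoPasturWeight ha hab.le, hE]
  have e1 : ∫ θ in (0 : ℝ)..π, ((a + b) / 2 + (b - a) / 2 * cos θ) *
      (derivWithin (fun x => c₁ + c₂ / x) (Icc a b) (arcPoint a b θ) *
        ((b - a) / 2 * sin θ)) ^ 2 =
      c₂ ^ 2 * ((b - a) / 2) ^ 2 *
        ∫ θ in (0 : ℝ)..π, sin θ ^ 2 / ((a + b) / 2 + (b - a) / 2 * cos θ) ^ 3 := by
    rw [← intervalIntegral.integral_const_mul]
    refine intervalIntegral.integral_congr fun θ _ => ?_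
    have hx := (arcPoint_pos ha hab.le θ).ne'
    simp only [hder]
    change arcPoint a b θ * _ = c₂ ^ 2 * ((b - a) / 2) ^ 2 * (sin θ ^ 2 / arcPoint a b θ ^ 3)
    field_simp
  rw [e1, hcube]
  generalize √(a * b) = D at hD0
  field_simp
  ring

end convex

section linear
variable {r : ℝ}

theorem mul_arcsineEnergy_le_dirichletForm_id (hr : 0 < r)
    (hμ : IsEquilibriumMeasure (fun x => r * x) μ) (hs : μ.support = Icc a b)
    (hφ : ContDiffOn ℝ 1 φ (Icc a b)) :
    r / (4 * π ^ 2) * arcsineEnergy a b φ ≤ dirichletForm a b (fun x => x) μ φ := by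
  have hab := (hμ.nonneg_and_lt (by fun_prop) hs).2
  obtain ⟨ha, hb⟩ := support_eq_of_linear hr hμ hs
  have h := mul_arcsineEnergy_le (M := 1) (D := 1) (δ := 0) hab hφ zero_le_one le_rfl le_rfl
    (by norm_num)
  have hd : r * ((b - a) / 2) = 2 := by rw [ha, hb]; field_simp; norm_num
  have h0 := integral_eq_of_linear hr hμ hs (hφ.continuousOn_mul_sq_derivWithin hab continuous_id)
  simp only [id] at h0
  unfold dirichletForm
  rw [h0]
  have e : ∫ θ in (0 : ℝ)..π, arcPoint a b θ *
      derivWithin φ (Icc a b) (arcPoint a b θ) ^ 2 * ((1 - cos θ) / π) =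
      r / (2 * π) * ∫ θ in (0 : ℝ)..π, (1 + 0 * cos θ) *
        (derivWithin φ (Icc a b) (arcPoint a b θ) * ((b - a) / 2 * sin θ)) ^ 2 := by
    rw [← intervalIntegral.integral_const_mul]
    refine intervalIntegral.integral_congr fun θ _ => ?_
    have hx : arcPoint a b θ = (b - a) / 2 * (1 + cos θ) := by unfold arcPoint; rw [ha]; ring
    have h1 : arcPoint a b θ * (1 - cos θ) = r / 2 * ((b - a) / 2 * sin θ) ^ 2 := by
      rw [hx, mul_pow, sin_sq]
      linear_combination (-((b - a) / 2) * (1 - cos θ ^ 2) / 2) * hd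
    generalize derivWithin φ (Icc a b) (arcPoint a b θ) = y
    rw [show arcPoint a b θ * y ^ 2 * ((1 - cos θ) / π) =
      arcPoint a b θ * (1 - cos θ) * (y ^ 2 / π) by ring, h1]
    field_simp
    ring
  rw [e]
  refine le_trans (le_of_eq ?_)
    (mul_le_mul_of_nonneg_left h (by positivity : 0 ≤ r / (2 * π)))
  field_simp
  ring

lemma dirichletForm_id_add_mul (hr : 0 < r)
    (hμ : IsEquilibriumMeasure (fun x => r * x) μ) (hs : μ.support = Icc a b) (c₁ c₂ : ℝ) :
    dirichletForm a b (fun x => x) μ (fun x => c₁ + c₂ * x) =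
      r / (4 * π ^ 2) * arcsineEnergy a b (fun x => c₁ + c₂ * x) := by
  have hab := (hμ.nonneg_and_lt (by fun_prop) hs).2
  obtain ⟨ha, hb⟩ := support_eq_of_linear hr hμ hs
  have hφ : ContDiffOn ℝ 1 (fun x : ℝ => c₁ + c₂ * x) (Icc a b) := by fun_prop
  have hder : ∀ θ, derivWithin (fun x : ℝ => c₁ + c₂ * x) (Icc a b) (arcPoint a b θ) = c₂ := by
    intro θ
    have h : HasDerivAt (fun x : ℝ => c₁ + c₂ * x) c₂ (arcPoint a b θ) := by
      simpa using ((hasDerivAt_id (arcPoint a b θ)).const_mul c₂).const_add c₁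
    exact h.hasDerivWithinAt.derivWithin
      (uniqueDiffOn_Icc hab _ (arcPoint_mem_Icc hab.le θ))
  have h0 := integral_eq_of_linear hr hμ hs (hφ.continuousOn_mul_sq_derivWithin hab continuous_id)
  simp only [id] at h0
  unfold dirichletForm
  rw [h0, arcsineEnergy_add_mul hab]
  simp_rw [hder]
  have e : ∫ θ in (0 : ℝ)..π, arcPoint a b θ * c₂ ^ 2 * ((1 - cos θ) / π) =
      c₂ ^ 2 * ((b - a) / 2) / π * ∫ θ in (0 : ℝ)..π, sin θ ^ 2 := by
    rw [← intervalIntegral.integral_const_mul]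
    refine intervalIntegral.integral_congr fun θ _ => ?_
    simp only [arcPoint]
    rw [ha, sin_sq]
    ring
  rw [e, integral_sin_sq, ha, hb]
  simp
  field_simp

/-- The functions `1 / (x + e)` with `e → 0` have an energy which is not controlled by the
Dirichlet form with weight `x ^ 2`. -/
lemma le_sqrt_of_forall_mul_arcsineEnergy_le (hr : 0 < r)
    (hμ : IsEquilibriumMeasure (fun x => r * x) μ) (hs : μ.support = Icc a b) {C : ℝ}
    (hC : ∀ φ : ℝ → ℝ, ContDiffOn ℝ ∞ φ (Icc a b) →
      C * arcsineEnergy a b φ ≤ dirichletForm a b (fun x => x ^ 2) μ φ) {e : ℝ} (he : 0 < e) :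
    C ≤ √((a + e) * (b + e)) / (2 * π ^ 2 * ((b - a) / 2)) := by
  have hab := (hμ.nonneg_and_lt (by fun_prop) hs).2
  obtain ⟨ha, hb⟩ := support_eq_of_linear hr hμ hs
  have hae : 0 < a + e := by rw [ha]; linarith
  have h := hC _ (contDiffOn_add_div_add (c₁ := 0) (c₂ := 1) hae _)
  rw [arcsineEnergy_add_div_add hab hae] at h
  have hφ := contDiffOn_add_div_add (b := b) (c₁ := 0) (c₂ := 1) hae 1
  have hcube := integral_sin_sq_div_cube (abs_half_sub_lt_add hab hae)
    (by linarith : (b - a) / 2 ≠ 0) (sqrt_add_mul_add_pos hab hae) (sq_sqrt_add_mul_add hab hae)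
  have hD0 := sqrt_add_mul_add_pos hab hae
  have hd : 0 < (b - a) / 2 := by linarith
  have hle : dirichletForm a b (fun x => x ^ 2) μ (fun x => 0 + 1 / (x + e)) ≤
      (b - a) / 2 / π * (π / (2 * √((a + e) * (b + e)) ^ 3)) := by
    unfold dirichletForm
    have hg := hφ.continuousOn_mul_sq_derivWithin hab (continuous_id.pow 2)
    have h1 := integral_eq_of_linear hr hμ hs hg
    simp only [id, Pi.pow_apply] at h1
    rw [h1, ← hcube, ← intervalIntegral.integral_const_mul]
    have hX : ∀ θ, (a + b) / 2 + e + (b - a) / 2 * cos θ = arcPoint a b θ + e := fun θ => by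
      unfold arcPoint; ring
    refine intervalIntegral.integral_mono_on pi_pos.le (Continuous.intervalIntegrable
      ((hg.continuous_comp_arcPoint hab.le).mul (by fun_prop)) _ _)
      (Continuous.intervalIntegrable (continuous_const.mul ((continuous_sin.pow 2).div
        (by fun_prop) fun θ => ?_)) _ _) fun θ _ => ?_
    · rw [hX]
      exact (pow_pos (add_arcPoint_pos hab hae θ) 3).ne'
    · rw [derivWithin_add_div_add hab hae (arcPoint_mem_Icc hab.le θ), hX]
      have hXp := add_arcPoint_pos hab hae θ
      have hx : arcPoint a b θ = (b - a) / 2 * (1 + cos θ) := by unfold arcPoint; rw [ha]; ring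
      have h2 : arcPoint a b θ * (1 - cos θ) = (b - a) / 2 * sin θ ^ 2 := by
        rw [hx, sin_sq]; ring
      have h3 : arcPoint a b θ ^ 2 * (-1 / (arcPoint a b θ + e) ^ 2) ^ 2 * ((1 - cos θ) / π) =
          (b - a) / 2 / π * (sin θ ^ 2 / (arcPoint a b θ + e) ^ 4) * arcPoint a b θ := by
        rw [show arcPoint a b θ ^ 2 * (-1 / (arcPoint a b θ + e) ^ 2) ^ 2 * ((1 - cos θ) / π) =
          arcPoint a b θ * (1 - cos θ) * (arcPoint a b θ / (arcPoint a b θ + e) ^ 4 / π) by field_simp,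
          h2]
        ring
      have h4 : (b - a) / 2 / π * (sin θ ^ 2 / (arcPoint a b θ + e) ^ 3) =
          (b - a) / 2 / π * (sin θ ^ 2 / (arcPoint a b θ + e) ^ 4) * (arcPoint a b θ + e) := by
        field_simp
      rw [h3, h4]
      exact mul_le_mul_of_nonneg_left (by linarith) (by positivity)
  have h5 := h.trans hle
  generalize √((a + e) * (b + e)) = D at *
  generalize (b - a) / 2 = d at *
  rw [le_div_iff₀ (by positivity)]
  have h6 : C * (1 ^ 2 * π ^ 2 * d ^ 2 / D ^ 4) * (2 * D ^ 4 / d) ≤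
      d / π * (π / (2 * D ^ 3)) * (2 * D ^ 4 / d) :=
    mul_le_mul_of_nonneg_right h5 (by positivity)
  have h7 : C * (1 ^ 2 * π ^ 2 * d ^ 2 / D ^ 4) * (2 * D ^ 4 / d) = C * (2 * π ^ 2 * d) := by
    field_simp
  have h8 : d / π * (π / (2 * D ^ 3)) * (2 * D ^ 4 / d) = D := by field_simp
  linarith

end linear
end dirichlet

end

theorem mainTheorem12 :
    -- the case `V(x) = Q(x) - s log x` with `Q` convex and `s > 0`
    (∀ (Q : ℝ → ℝ) (s : ℝ), ConvexOn ℝ (Ici 0) Q → 0 < s →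
      Tendsto (fun x : ℝ => (Q x - s * Real.log x) - 2 * Real.log x) atTop atTop →
      ∀ (μ : Measure ℝ) (a b : ℝ),
        IsEquilibriumMeasure (fun x => Q x - s * Real.log x) μ →
        μ.support = Icc a b →
        -- the Poincaré type inequality
        (∀ φ : ℝ → ℝ, ContDiffOn ℝ ∞ φ (Icc a b) →
          s / (4 * Real.pi ^ 2) * arcsineEnergy a b φ ≤
            dirichletForm a b (fun x => x ^ 2) μ φ) ∧
        -- equality and sharpness of the constant for affine `Q`
        (∀ r t : ℝ, (∀ x ∈ Ici (0 : ℝ), Q x = r * x + t) →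
          (∀ c₁ c₂ : ℝ,
            dirichletForm a b (fun x => x ^ 2) μ (fun x => c₁ + c₂ / x) =
              s / (4 * Real.pi ^ 2) * arcsineEnergy a b (fun x => c₁ + c₂ / x)) ∧
          (∀ C : ℝ,
            (∀ φ : ℝ → ℝ, ContDiffOn ℝ ∞ φ (Icc a b) →
              C * arcsineEnergy a b φ ≤ dirichletForm a b (fun x => x ^ 2) μ φ) →
            C ≤ s / (4 * Real.pi ^ 2))) ∧
        -- the consequence for the variance under the arcsine law, with its equality case
        (∀ φ : ℝ → ℝ, ContDiffOn ℝ ∞ φ (Icc a b) →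
          s / 2 * variance φ (arcsineLaw a b) ≤ dirichletForm a b (fun x => x ^ 2) μ φ ∧
          (dirichletForm a b (fun x => x ^ 2) μ φ = s / 2 * variance φ (arcsineLaw a b) ↔
            ∃ c : ℝ, ∀ x ∈ Icc a b, φ x = c))) ∧
    -- the case `V(x) = r x` on `[0,∞)`
    (∀ r : ℝ, 0 < r → ∀ (μ : Measure ℝ) (a b : ℝ),
      IsEquilibriumMeasure (fun x => r * x) μ →
      μ.support = Icc a b →
      (¬ ∃ C : ℝ, 0 < C ∧ ∀ φ : ℝ → ℝ, ContDiffOn ℝ ∞ φ (Icc a b) →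
        C * arcsineEnergy a b φ ≤ dirichletForm a b (fun x => x ^ 2) μ φ) ∧
      (∀ φ : ℝ → ℝ, ContDiffOn ℝ ∞ φ (Icc a b) →
        r / (4 * Real.pi ^ 2) * arcsineEnergy a b φ ≤
          dirichletForm a b (fun x => x) μ φ) ∧
      (∀ c₁ c₂ : ℝ,
        dirichletForm a b (fun x => x) μ (fun x => c₁ + c₂ * x) =
          r / (4 * Real.pi ^ 2) * arcsineEnergy a b (fun x => c₁ + c₂ * x))) := by
  refine ⟨fun Q s hQ hs0 _ μ a b hμ hs => ?_, fun r hr μ a b hμ hs => ?_⟩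
  · have ha := pos_of_support_eq hQ hs0 hμ hs
    have hab := (hμ.nonneg_and_lt (hQ.continuousOn_sub_mul_log s) hs).2
    have h1 : ∀ {φ : ℝ → ℝ}, ContDiffOn ℝ ∞ φ (Icc a b) → ContDiffOn ℝ 1 φ (Icc a b) :=
      fun hφ => hφ.of_le (by exact_mod_cast le_top)
    refine ⟨fun φ hφ => mul_arcsineEnergy_le_dirichletForm_sq hQ hs0 hμ hs (h1 hφ),
      fun r t hQrt => ⟨dirichletForm_sq_add_div hQ hs0 hμ hs hQrt, fun C hC => ?_⟩,
      fun φ hφ => ?_⟩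
    · have ha0 : 0 < a + 0 := by linarith
      have hφ := contDiffOn_add_div_add (b := b) (c₁ := 0) (c₂ := 1) ha0 ∞
      have hE := arcsineEnergy_add_div_add (c₁ := 0) (c₂ := 1) hab ha0
      have hD := sqrt_add_mul_add_pos hab ha0
      simp only [add_zero] at hφ hE hD
      have h := hC _ hφ
      rw [dirichletForm_sq_add_div hQ hs0 hμ hs hQrt] at h
      refine le_of_mul_le_mul_right h ?_
      rw [hE]
      have := sub_pos.2 hab
      positivity
    · obtain ⟨κ, hκ, h⟩ := exists_mul_variance_le_dirichletForm_sq hQ hs0 hμ hs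
      have hle := h φ (h1 hφ)
      have hv := variance_nonneg φ (arcsineLaw a b)
      have hκv := mul_nonneg hκ.le hv
      refine ⟨by linarith, fun heq => ?_, ?_⟩
      · refine exists_eq_const_of_variance_arcsineLaw_eq_zero hab hφ.continuousOn ?_
        have : κ * variance φ (arcsineLaw a b) ≤ κ * 0 := by linarith
        exact le_antisymm (le_of_mul_le_mul_left this hκ) hv
      · rintro ⟨c, hc⟩
        rw [dirichletForm_eq_zero_of_const (ae_mem_of_support_eq hs) hc,
          variance_arcsineLaw_of_const hab hc, mul_zero]
  · have hab := (hμ.nonneg_and_lt (by fun_prop) hs).2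
    have ha := (support_eq_of_linear hr hμ hs).1
    refine ⟨?_, fun φ hφ => mul_arcsineEnergy_le_dirichletForm_id hr hμ hs
      (hφ.of_le (by exact_mod_cast le_top)), dirichletForm_id_add_mul hr hμ hs⟩
    rintro ⟨C, hC0, hC⟩
    have hcont : Continuous fun e : ℝ =>
        √((a + e) * (b + e)) / (2 * Real.pi ^ 2 * ((b - a) / 2)) := by fun_prop
    have hlim : Tendsto (fun e : ℝ => √((a + e) * (b + e)) / (2 * Real.pi ^ 2 * ((b - a) / 2)))
        (nhdsWithin 0 (Ioi 0)) (nhds 0) := by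
      have := (hcont.tendsto 0).mono_left (nhdsWithin_le_nhds (s := Ioi (0 : ℝ)))
      simpa [ha] using this
    have : C ≤ 0 := ge_of_tendsto hlim (by
      filter_upwards [self_mem_nhdsWithin] with e he
      exact le_sqrt_of_forall_mul_arcsineEnergy_le hr hμ hs hC he)
    linarith
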